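/- Let $d\ge 1$, let $\Omega\subset\mathbb R^\nu$ be closed, and let $\mu_0$ be a finite nonzero Borel measure on $\Omega$ (the a priori spin law). For $x\in\mathbb Z^d$ let $(\tau_xS)_y:=S_{y-x}$ on $\Omega^{\mathbb Z^d}$. For each finite $A\subset\mathbb Z^d$ let $\Phi_A\colon\Omega^{\mathbb Z^d}\to\mathbb R$ be a measurable function depending only on $S_A=(S_x)_{x\in A}$, with $\Phi_{A+x}\circ\tau_x=\Phi_A$ for all $x$ and $\sum_{A\ni 0}\|\Phi_A\|_\infty<\infty$, where $\|\cdot\|_\infty$ is the sup-norm. For finite $\Lambda\subset\mathbb Z^d$ put $$H_\Lambda(S):=\sum_{A\text{ finite},\,A\cap\Lambda\neq\emptyset}\Phi_A(S).$$ Fix $\beta\ge 0$. For a boundary condition $S_{\Lambda^c}$, the Gibbs measure in $\Lambda$ is the probability measure on $\Omega^\Lambda$ proportional to $e^{-\beta H_\Lambda(S)}\prod_{x\in\Lambda}\mu_0(dS_x)$. Let $\mathfrak G_\beta$ be the set of probability measures $\mu$ on $\Omega^{\mathbb Z^d}$ such that, for every finite $\Lambda$ and $\mu$-a.e. $S_{\Lambda^c}$,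 the conditional law of $S_\Lambda$ given $S_{\Lambda^c}$ under $\mu$ is the Gibbs measure in $\Lambda$ with boundary condition $S_{\Lambda^c}$. Let $\Lambda_L:=\{1,\dots,L\}^d$ and $\mathbb T_L:=(\mathbb Z/L\mathbb Z)^d$. Let $\mu_{L,\beta}$ be the probability measure on $\Omega^{\mathbb T_L}$ proportional to $e^{-\beta H_L(S)}\prod_{x\in\mathbb T_L}\mu_0(dS_x)$, where the torus Hamiltonian is either $H_L(S):=H_{\Lambda_L}(S^{\mathrm{per}})$ with $S^{\mathrm{per}}$ the periodic extension of $S$ to $\mathbb Z^d$, or its periodized version $H_L(S):=\sum_{A\cap\Lambda_L\ne\emptyset}\frac{|A\cap\Lambda_L|}{|A|}\Phi_A(S^{\mathrm{per}})$, in which each class of finite nonempty sets $A$ modulo translations by $L\mathbb Z^d$ is counted once. Let $g\colon\Omega^{\mathbb Z^d}\to\mathbb R$ be bounded, measurable and local (depending on finitely many spins). On $\Omega^{\mathbb T_L}$ evaluate $g\circ\tau_x$, $x\in\mathbb T_L$, through the periodic extension. Then: 1. For all $h\in\mathbb R$ the limit $$f(h):=\lim_{L\to\infty}\frac1{L^d}\log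 E_{\mu_{L,\beta}}\Bigl\{\exp\Bigl(h\sum_{x\in\mathbb T_L}g\circ\tau_x\Bigr)\Bigr\}$$ exists in $\mathbb R$, is the same for both choices of $H_L$, and is convex in $h$. In particular, the one-sided derivatives $\frac{\partial f}{\partial h^\pm}\big|_{h=0}$ exist and are finite. 2. If $\mu\in\mathfrak G_\beta$ is translation invariant, then $$\frac{\partial f}{\partial h^-}\Big|_{h=0}\le E_\mu(g)\le\frac{\partial f}{\partial h^+}\Big|_{h=0}.$$ 3. There exist translation-invariant measures $\mu^+,\mu^-\in\mathfrak G_\beta$, ergodic under the group of lattice translations, such that $$E_{\mu^\pm}(g)=\frac{\partial f}{\partial h^\pm}\Big|_{h=0}.$$ -/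

import Mathlib

open MeasureTheory ProbabilityTheory Filter Topology
open scoped ENNReal

noncomputable section

namespace LatticeSpin

/-- The sites of the hypercubic lattice. -/
abbrev Site (d : ℕ) : Type := Fin d → ℤ

/-- Spin configurations on the lattice, with spins in `E`. -/
abbrev Config (d : ℕ) (E : Type*) : Type _ := Site d → E

/-- The discrete torus of side `L`. -/
abbrev Torus (d L : ℕ) : Type := Fin d → ZMod L

variable {d : ℕ} {E : Type*}

/-- The shift by `x`: `(τ_x S)_y = S_{y - x}`. -/
def shift (x : Site d) (S : Config d E) : Config d E := fun y => S (y - x)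

/-- A bounded, local (measurable) function: it depends on finitely many spins only. -/
structure IsBoundedLocal [MeasurableSpace E] (g : Config d E → ℝ) : Prop where
  measurable : Measurable g
  bounded : ∃ C : ℝ, ∀ S, |g S| ≤ C
  isLocal : ∃ D : Finset (Site d), DependsOn g (D : Set (Site d))

/-- A translation-invariant, absolutely summable family of potentials `Φ_A`, indexed by the
finite sets `A` of sites; `Φ_A` depends only on the spins in `A`, and
`∑_{A ∋ 0} ‖Φ_A‖_∞ < ∞` (as a sum of extended nonnegative numbers). -/
structure IsInteraction [MeasurableSpace E] (Φ : Finset (Site d) → Config d E → ℝ) : Prop where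
  measurable : ∀ A, Measurable (Φ A)
  dependsOn : ∀ A, DependsOn (Φ A) (A : Set (Site d))
  translation : ∀ (A : Finset (Site d)) (x : Site d) (S : Config d E),
    Φ (A.image (fun y => y + x)) (shift x S) = Φ A S
  summable : (∑' A : {A : Finset (Site d) // (0 : Site d) ∈ A}, ⨆ S, ‖Φ A.1 S‖ₑ) < ∞

/-- The Hamiltonian in `Λ`: the sum of `Φ_A` over all finite `A` that meet `Λ`. -/
def hamiltonian (Φ : Finset (Site d) → Config d E → ℝ) (Λ : Finset (Site d))
    (S : Config d E) : ℝ :=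
  ∑' A : {A : Finset (Site d) // (A ∩ Λ).Nonempty}, Φ A.1 S

/-- The probability measure with density proportional to `exp (-β H)` with respect to `ρ`. -/
def boltzmann {X : Type*} [MeasurableSpace X] (β : ℝ) (H : X → ℝ) (ρ : Measure X) : Measure X :=
  (∫⁻ s, ENNReal.ofReal (Real.exp (-β * H s)) ∂ρ)⁻¹ •
    ρ.withDensity (fun s => ENNReal.ofReal (Real.exp (-β * H s)))

/-- The concatenation of a configuration `T` in `Λ` with the restriction of `S` to the
complement of `Λ`. -/
def glue (Λ : Finset (Site d)) (T : Λ → E) (S : Config d E) : Config d E :=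
  fun x => if hx : x ∈ Λ then T ⟨x, hx⟩ else S x

/-- The finite-volume Gibbs measure in `Λ`, for the boundary condition given by the restriction
of `S` to the complement of `Λ`. -/
def finiteGibbs [MeasurableSpace E] (Φ : Finset (Site d) → Config d E → ℝ) (β : ℝ)
    (μ₀ : Measure E) (Λ : Finset (Site d)) (S : Config d E) : Measure (Λ → E) :=
  boltzmann β (fun T => hamiltonian Φ Λ (glue Λ T S)) (Measure.pi fun _ : Λ => μ₀)

/-- Infinite-volume (DLR) Gibbs measures: for every finite `Λ`, the conditional law of the spins
in `Λ` given the spins in the complement of `Λ` is the finite-volume Gibbs measure. -/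
structure IsGibbs [MeasurableSpace E] (Φ : Finset (Site d) → Config d E → ℝ) (β : ℝ)
    (μ₀ : Measure E) (μ : Measure (Config d E)) : Prop where
  isProbability : IsProbabilityMeasure μ
  dlr : ∀ (Λ : Finset (Site d)) (B : Set (Λ → E)), MeasurableSet B →
    μ⟦(fun (S : Config d E) (x : Λ) => S x) ⁻¹' B |
        (cylinderEvents ((Λ : Set (Site d))ᶜ) : MeasurableSpace (Config d E))⟧
      =ᵐ[μ] fun S => (finiteGibbs Φ β μ₀ Λ S).real B

/-- Invariance under all lattice translations. -/
def IsTranslationInvariant [MeasurableSpace E] (μ : Measure (Config d E)) : Prop :=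
  ∀ x : Site d, MeasurePreserving (shift x) μ μ

/-- Ergodicity under the group of lattice translations: `μ` is translation invariant and every
translation-invariant event has probability zero or one. -/
structure IsErgodic [MeasurableSpace E] (μ : Measure (Config d E)) : Prop where
  isProbability : IsProbabilityMeasure μ
  invariant : IsTranslationInvariant μ
  trivial_of_invariant : ∀ B : Set (Config d E), MeasurableSet B →
    (∀ x : Site d, shift x ⁻¹' B = B) → μ B = 0 ∨ μ B = 1

/-- The box `{1, …, L}^d`. -/
def box (d L : ℕ) : Finset (Site d) := Fintype.piFinset fun _ => Finset.Icc 1 (L : ℤ)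

/-- The periodic extension of a torus configuration to the lattice. -/
def periodicExt {L : ℕ} (S : Torus d L → E) : Config d E := fun x => S fun i => (x i : ZMod L)

/-- The shift on torus configurations. -/
def torusShift {L : ℕ} (x : Torus d L) (S : Torus d L → E) : Torus d L → E := fun y => S (y - x)

/-- The torus Hamiltonian: the Hamiltonian in the box at the periodic extension. -/
def torusHamiltonian (Φ : Finset (Site d) → Config d E → ℝ) (L : ℕ) (S : Torus d L → E) : ℝ :=
  hamiltonian Φ (box d L) (periodicExt S)

/-- The periodized torus Hamiltonian: every `Φ_A` is counted once per orbit of `A` under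
translations by vectors in `L ℤ^d`. As the translates of `A` by these vectors
together meet the box in exactly `|A|` sites, this is the sum over all `A` of
`(|A ∩ Λ_L| / |A|) Φ_A`. For pair potentials `Φ_{x,y} = -J_{x,y} S_x · S_y` it is
`-(1/2) ∑_{x,y} J^{(L)}_{x,y} S_x · S_y`, with periodized couplings
`J^{(L)}_{x,y} = ∑_z J_{x,y+Lz}`. -/
def periodizedHamiltonian (Φ : Finset (Site d) → Config d E → ℝ) (L : ℕ)
    (S : Torus d L → E) : ℝ :=
  ∑' A : {A : Finset (Site d) // (A ∩ box d L).Nonempty},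
    ((A.1 ∩ box d L).card / A.1.card : ℝ) * Φ A.1 (periodicExt S)

/-- The torus Gibbs measure for a Hamiltonian `H` on torus configurations. -/
def torusGibbs [MeasurableSpace E] {L : ℕ} [NeZero L] (H : (Torus d L → E) → ℝ) (β : ℝ)
    (μ₀ : Measure E) : Measure (Torus d L → E) :=
  boltzmann β H (Measure.pi fun _ : Torus d L => μ₀)

/-- The finite-volume torus free energy
`L^{-d} log E exp (h ∑_{x ∈ 𝕋_L} g ∘ τ_x)`, for a law `P` of torus configurations; a torus
configuration is inserted into `g` through its periodic extension. -/
def torusFreeEnergy [MeasurableSpace E] {L : ℕ} [NeZero L] (g : Config d E → ℝ)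
    (P : Measure (Torus d L → E)) (h : ℝ) : ℝ :=
  1 / (L : ℝ) ^ d *
    Real.log (∫ S, Real.exp (h * ∑ x : Torus d L, g (periodicExt (torusShift x S))) ∂P)

end LatticeSpin

end

namespace LatticeSpin

/-! ### Shifts, boxes and a convergence criterion -/

section

variable {d : ℕ} {E : Type*}

/-! Normalize the a priori law to a probability measure and let p(h) be the limit of L^{-d} log ∫
exp(-β H_Λ + h ∑_{x ∈ Λ} g ∘ τ_{-x}), with Λ the box of side L and the integral over the product
measure on the whole lattice. The free energy is f(h) = p(h) - p(0).

Existence of p. The exponent is, up to ε L^d and uniformly in the configuration, a sum of translates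
of one bounded local function (`IsInteraction.exists_local_approximation`). For such sums the
partition function is superadditive along cubes separated by corridors
(`log_partition_superadditive`), because distant cubes are independent under the product measure.
Replacing a configuration by the periodic extension of its restriction to the box, or one torus
Hamiltonian by the other, changes the exponent only by o(L^d). Hence both torus free energies
converge to the same f, and Hölder's inequality makes f convex.

Bounds. For a translation-invariant Gibbs measure μ, Jensen's inequality gives h L^d E_μ(g) ≤ log
E_μ exp(h ∑ g ∘ τ_{-x}). By the DLR equation the right-hand expectation is an average of ratios of
partition functions with boundary conditions, and the boundary costs o(L^d). So h E_μ(g) ≤ f(h)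
(`IsGibbs.mul_integral_le`), and dividing by h > 0 and h < 0 bounds E_μ(g) by the one-sided
derivatives.

Attainment. In a box with field h > 0, Jensen's inequality used in the other direction bounds the
expectation of g, averaged over translates of the box, from below by the finite-volume difference
quotient. Let h tend to 0 and L to infinity together. The averaged measures become translation
invariant, and in a fixed finite volume the field perturbs the conditional laws by O(h), so a limit
is a translation-invariant Gibbs measure with E(g) ≥ f'(0+), hence with equality
(`exists_isGibbs_le_integral`). The left derivative follows by replacing g with -g.

The spin space need not be compact. Limits exist because the DLR kernels in a finite volume have
densities bounded uniformly in the boundary condition. An ultrafilter limit on cylinders is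
therefore dominated by a finite measure in each finite volume, and inner regularity turns the
finitely additive limit into a measure (`exists_measure_eq_addContent`, `exists_isGibbs_limit`).

Ergodicity. Recorded by their values on cylinders, the translation-invariant Gibbs measures with
maximal E(g) form a compact set in a product of real lines, which therefore has an extreme point. A
translation-invariant event is approximated by events far from any given volume, so conditioning on
it preserves the Gibbs property. If such an event had probability strictly between 0 and 1,
conditioning on it and on its complement would split the extreme point into two maximizers
(`isErgodic_of_mem_extremePoints`). -/

lemma shift_shift (x y : Site d) (S : Config d E) : shift x (shift y S) = shift (x + y) S := by
  funext z; simp only [shift]; congr 1; abel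

lemma shift_zero (S : Config d E) : shift 0 S = S := by
  funext z; simp [shift]

lemma shift_neg_apply (x y : Site d) (S : Config d E) : shift (-x) S y = S (y + x) := by
  simp [shift]

lemma measurable_shift [MeasurableSpace E] (x : Site d) :
    Measurable (shift x : Config d E → Config d E) :=
  measurable_pi_lambda _ fun _ => measurable_pi_apply _

lemma mem_box {L : ℕ} {x : Site d} : x ∈ box d L ↔ ∀ i, 1 ≤ x i ∧ x i ≤ L := by
  simp [box, Fintype.mem_piFinset]

lemma card_box (L : ℕ) : (box d L).card = L ^ d := by
  simp [box, Fintype.card_piFinset]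

/-- The boxes form a Følner sequence. -/
lemma eventually_card_boundary_le (D : Finset (Site d)) {ε : ℝ} (hε : 0 < ε) :
    ∀ᶠ L : ℕ in atTop,
      (((box d L).filter fun x => ∃ y ∈ D, x + y ∉ box d L).card : ℝ) ≤ ε * (L : ℝ) ^ d := by
  obtain ⟨R, hR⟩ : ∃ R : ℕ, ∀ y ∈ D, ∀ i, |y i| ≤ R := by
    refine ⟨D.sup fun y => Finset.univ.sup fun i => (y i).natAbs, fun y hy i => ?_⟩
    rw [Int.abs_eq_natAbs]
    exact_mod_cast (Finset.le_sup (f := fun i => (y i).natAbs) (Finset.mem_univ i)).trans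
      (Finset.le_sup (f := fun y : Site d => Finset.univ.sup fun i => (y i).natAbs) hy)
  have hlim : Tendsto (fun L : ℕ => (1 - 2 * (R : ℝ) / L) ^ d) atTop (𝓝 1) := by
    have : Tendsto (fun L : ℕ => 1 - 2 * (R : ℝ) / L) atTop (𝓝 (1 - 0)) :=
      tendsto_const_nhds.sub (tendsto_const_div_atTop_nhds_zero_nat _)
    simpa using this.pow d
  filter_upwards [hlim.eventually_const_lt (show 1 - ε < 1 by linarith), eventually_ge_atTop (2 * R + 1)]
    with L hL hLR
  set inner : Finset (Site d) := Fintype.piFinset fun _ => Finset.Icc ((R : ℤ) + 1) (L - R)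
  have hinner : inner ⊆ box d L := by
    intro x hx
    rw [mem_box]
    intro i
    have := Finset.mem_Icc.1 (Fintype.mem_piFinset.1 hx i)
    constructor <;> linarith [this.1, this.2]
  have hsub : ((box d L).filter fun x => ∃ y ∈ D, x + y ∉ box d L) ⊆ box d L \ inner := by
    intro x hx
    obtain ⟨hx, y, hy, hxy⟩ := Finset.mem_filter.1 hx
    refine Finset.mem_sdiff.2 ⟨hx, fun hin => hxy (mem_box.2 fun i => ?_)⟩
    have h1 := Finset.mem_Icc.1 (Fintype.mem_piFinset.1 hin i)
    have h2 := abs_le.1 (hR y hy i)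
    simp only [Pi.add_apply]
    constructor <;> linarith [h1.1, h1.2, h2.1, h2.2]
  have hcard : (inner.card : ℝ) = ((L : ℝ) - 2 * R) ^ d := by
    have : ((L : ℤ) - R + 1 - (R + 1)).toNat = L - 2 * R := by omega
    simp only [inner, Fintype.card_piFinset, Int.card_Icc, Finset.prod_const, Finset.card_univ,
      Fintype.card_fin, this]
    push_cast [Nat.cast_sub (show 2 * R ≤ L by omega)]
    ring
  have hL0 : (0 : ℝ) < L := by exact_mod_cast (show 0 < L by omega)
  have hpow : ((L : ℝ) - 2 * R) ^ d = (1 - 2 * (R : ℝ) / L) ^ d * (L : ℝ) ^ d := by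
    rw [← mul_pow]; congr 1; field_simp
  calc (((box d L).filter fun x => ∃ y ∈ D, x + y ∉ box d L).card : ℝ)
      ≤ ((box d L \ inner).card : ℝ) := by exact_mod_cast Finset.card_le_card hsub
    _ = (L : ℝ) ^ d - ((L : ℝ) - 2 * R) ^ d := by
        rw [Finset.cast_card_sdiff hinner, hcard, card_box]; push_cast; ring
    _ ≤ ε * (L : ℝ) ^ d := by
        rw [hpow]; nlinarith [pow_pos hL0 d]

/-- A bounded sequence each of whose terms is, up to a factor tending to one, an asymptotic lower
bound of the sequence converges. -/
lemma exists_tendsto_of_eventually_ge {b c : ℕ → ℝ} {C : ℝ} (hb : ∀ n, |b n| ≤ C)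
    (hc : Tendsto c atTop (𝓝 1))
    (h : ∀ l, ∀ ε > 0, ∀ᶠ L in atTop, c l * b l - ε ≤ b L) :
    ∃ p, Tendsto b atTop (𝓝 p) := by
  have hle : IsBoundedUnder (· ≤ ·) atTop b :=
    isBoundedUnder_of ⟨C, fun n => (abs_le.1 (hb n)).2⟩
  have hge : IsBoundedUnder (· ≥ ·) atTop b :=
    isBoundedUnder_of ⟨-C, fun n => (abs_le.1 (hb n)).1⟩
  have h1 : ∀ l, c l * b l ≤ liminf b atTop := fun l =>
    le_of_forall_sub_le fun ε hε => le_liminf_of_le hle.isCoboundedUnder_ge (h l ε hε)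
  refine ⟨liminf b atTop, tendsto_of_le_liminf_of_limsup_le le_rfl ?_ hle hge⟩
  refine le_of_forall_pos_le_add fun ε hε => limsup_le_of_le hge.isCoboundedUnder_le ?_
  have h2 : Tendsto (fun l => |1 - c l| * C) atTop (𝓝 0) := by
    have := ((tendsto_const_nhds (x := (1 : ℝ))).sub hc).abs.mul_const C
    simpa using this
  filter_upwards [h2.eventually_lt_const hε] with l hl
  have h3 : (1 - c l) * b l ≤ |1 - c l| * C := by
    calc (1 - c l) * b l ≤ |(1 - c l) * b l| := le_abs_self _
      _ = |1 - c l| * |b l| := abs_mul _ _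
      _ ≤ _ := mul_le_mul_of_nonneg_left (hb l) (abs_nonneg _)
  linarith [h1 l]

end

/-! ### Interactions and Hamiltonians -/

section

variable {d : ℕ} {E : Type*}

/-- The sup-norm of `Φ_A`, as a real number. -/
noncomputable def supNorm (Φ : Finset (Site d) → Config d E → ℝ) (A : Finset (Site d)) : ℝ :=
  (⨆ S, ‖Φ A S‖ₑ).toReal

lemma supNorm_nonneg (Φ : Finset (Site d) → Config d E → ℝ) (A : Finset (Site d)) :
    0 ≤ supNorm Φ A := ENNReal.toReal_nonneg

/-- Translation of finite sets of sites. -/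
def translate (x : Site d) : Finset (Site d) ≃ Finset (Site d) := (Equiv.addRight x).finsetCongr

lemma translate_apply (x : Site d) (A : Finset (Site d)) :
    translate x A = A.image fun y => y + x := by
  simp [translate, Finset.map_eq_image]

lemma mem_translate {x y : Site d} {A : Finset (Site d)} : y ∈ translate x A ↔ y - x ∈ A := by
  rw [translate_apply, Finset.mem_image]
  constructor
  · rintro ⟨z, hz, rfl⟩; simpa using hz
  · intro h; exact ⟨y - x, h, by abel⟩

lemma card_translate (x : Site d) (A : Finset (Site d)) : (translate x A).card = A.card := by
  simp [translate]

/-- The norm `∑_{A ∋ 0} ‖Φ_A‖_∞`. -/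
noncomputable def totalNorm (Φ : Finset (Site d) → Config d E → ℝ) : ℝ :=
  ∑' A : Finset (Site d), if (0 : Site d) ∈ A then supNorm Φ A else 0

lemma totalNorm_nonneg (Φ : Finset (Site d) → Config d E → ℝ) : 0 ≤ totalNorm Φ :=
  tsum_nonneg fun A => by split_ifs <;> simp [supNorm_nonneg]

lemma hamiltonian_eq_tsum (Φ : Finset (Site d) → Config d E → ℝ) (Λ : Finset (Site d)) (S : Config d E) :
    hamiltonian Φ Λ S = ∑' A : Finset (Site d), if (A ∩ Λ).Nonempty then Φ A S else 0 := by
  refine (tsum_subtype {A : Finset (Site d) | (A ∩ Λ).Nonempty} (fun A => Φ A S)).trans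
    (tsum_congr fun A => ?_)
  simp [Set.indicator_apply]

/-- The sum over the sets that meet `Λ`, weighted by the proportion of their points in `Λ`. -/
noncomputable def proportionalHamiltonian (Φ : Finset (Site d) → Config d E → ℝ)
    (Λ : Finset (Site d)) (S : Config d E) : ℝ :=
  ∑' A : {A : Finset (Site d) // (A ∩ Λ).Nonempty}, ((A.1 ∩ Λ).card / A.1.card : ℝ) * Φ A.1 S

lemma proportionalHamiltonian_eq_tsum (Φ : Finset (Site d) → Config d E → ℝ)
    (Λ : Finset (Site d)) (S : Config d E) : proportionalHamiltonian Φ Λ S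
      = ∑' A : Finset (Site d),
        if (A ∩ Λ).Nonempty then ((A ∩ Λ).card / A.card : ℝ) * Φ A S else 0 := by
  refine (tsum_subtype {A : Finset (Site d) | (A ∩ Λ).Nonempty}
    (fun A => ((A ∩ Λ).card / A.card : ℝ) * Φ A S)).trans (tsum_congr fun A => ?_)
  simp [Set.indicator_apply]

section Interaction

variable [MeasurableSpace E] {Φ : Finset (Site d) → Config d E → ℝ}

lemma IsInteraction.apply_translate (hΦ : IsInteraction Φ) (A : Finset (Site d)) (x : Site d)
    (S : Config d E) : Φ (translate x A) S = Φ A (shift (-x) S) := by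
  have := hΦ.translation A x (shift (-x) S)
  rwa [shift_shift, add_neg_cancel, shift_zero, ← translate_apply] at this

lemma IsInteraction.iSup_translate (hΦ : IsInteraction Φ) (A : Finset (Site d)) (x : Site d) :
    (⨆ S, ‖Φ (translate x A) S‖ₑ) = ⨆ S, ‖Φ A S‖ₑ := by
  apply le_antisymm
  · refine iSup_le fun S => ?_
    rw [hΦ.apply_translate]
    exact le_iSup (fun S => ‖Φ A S‖ₑ) _
  · refine iSup_le fun S => ?_
    have h := hΦ.apply_translate A x (shift x S)
    rw [shift_shift, neg_add_cancel, shift_zero] at h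
    rw [← h]
    exact le_iSup (fun S => ‖Φ (translate x A) S‖ₑ) _

lemma IsInteraction.supNorm_translate (hΦ : IsInteraction Φ) (A : Finset (Site d)) (x : Site d) :
    supNorm Φ (translate x A) = supNorm Φ A := by
  rw [supNorm, hΦ.iSup_translate, supNorm]

/-- Moving a point of `A` to the origin makes this norm one of the terms of the finite sum over sets
containing 0. -/
lemma IsInteraction.iSup_ne_top (hΦ : IsInteraction Φ) {A : Finset (Site d)} (hA : A.Nonempty) :
    (⨆ S, ‖Φ A S‖ₑ) ≠ ∞ := by
  obtain ⟨a, ha⟩ := hA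
  rw [← hΦ.iSup_translate A (-a)]
  exact ENNReal.ne_top_of_tsum_ne_top hΦ.summable.ne
    ⟨translate (-a) A, mem_translate.2 (by simpa using ha)⟩

lemma IsInteraction.abs_apply_le (hΦ : IsInteraction Φ) {A : Finset (Site d)} (hA : A.Nonempty)
    (S : Config d E) : |Φ A S| ≤ supNorm Φ A := by
  have := ENNReal.toReal_mono (hΦ.iSup_ne_top hA) (le_iSup (fun S => ‖Φ A S‖ₑ) S)
  simpa [supNorm] using this

lemma IsInteraction.summable_zero (hΦ : IsInteraction Φ) :
    Summable fun A : Finset (Site d) => if (0 : Site d) ∈ A then supNorm Φ A else 0 := by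
  have h := ENNReal.summable_toReal hΦ.summable.ne
  have h2 := summable_subtype_iff_indicator (f := supNorm Φ) (s := {A | (0 : Site d) ∈ A}) |>.1 h
  refine h2.congr fun A => ?_
  simp [Set.indicator_apply]

lemma IsInteraction.summable_mem (hΦ : IsInteraction Φ) (x : Site d) :
    Summable fun A : Finset (Site d) => if x ∈ A then supNorm Φ A else 0 := by
  rw [← (translate x).summable_iff]
  refine hΦ.summable_zero.congr fun A => ?_
  simp [mem_translate, hΦ.supNorm_translate]

lemma IsInteraction.summable_meet (hΦ : IsInteraction Φ) (Λ : Finset (Site d)) :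
    Summable fun A : Finset (Site d) => if (A ∩ Λ).Nonempty then supNorm Φ A else 0 := by
  refine (summable_sum fun x (_ : x ∈ Λ) => hΦ.summable_mem x).of_nonneg_of_le
    (fun A => by split_ifs <;> simp [supNorm_nonneg]) fun A => ?_
  have h0 : ∀ x ∈ Λ, 0 ≤ if x ∈ A then supNorm Φ A else 0 := fun x _ => by
    split_ifs <;> simp [supNorm_nonneg]
  split_ifs with h
  · obtain ⟨x, hx⟩ := h
    rw [Finset.mem_inter] at hx
    refine le_trans ?_ (Finset.single_le_sum h0 hx.2)
    simp [hx.1]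
  · exact Finset.sum_nonneg h0

lemma nonempty_of_inter_nonempty {A Λ : Finset (Site d)} (h : (A ∩ Λ).Nonempty) : A.Nonempty :=
  h.mono Finset.inter_subset_left

/-- Weighted sums over the sets that meet `Λ`, regrouped according to the points of `Λ`. -/
lemma IsInteraction.tsum_meet_eq (hΦ : IsInteraction Φ) (Λ : Finset (Site d))
    {w : Finset (Site d) → ℝ} (hw : ∀ A, |w A| ≤ 1) (S : Config d E) :
    (∑' A : {A : Finset (Site d) // (A ∩ Λ).Nonempty}, ((A.1 ∩ Λ).card * w A.1) * Φ A.1 S)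
      = ∑ x ∈ Λ, ∑' A : Finset (Site d),
          if (0 : Site d) ∈ A then w (translate x A) * Φ A (shift (-x) S) else 0 := by
  have h1 : ∀ x ∈ Λ, (∑' A : Finset (Site d),
      if (0 : Site d) ∈ A then w (translate x A) * Φ A (shift (-x) S) else 0)
      = ∑' A : Finset (Site d), if x ∈ A then w A * Φ A S else 0 := by
    intro x _
    rw [← (translate x).tsum_eq (fun A => if x ∈ A then w A * Φ A S else 0)]
    refine tsum_congr fun A => ?_
    simp [mem_translate, hΦ.apply_translate]
  have h2 : ∀ x ∈ Λ, Summable fun A : Finset (Site d) => if x ∈ A then w A * Φ A S else 0 := by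
    intro x _
    refine (hΦ.summable_mem x).of_norm_bounded fun A => ?_
    split_ifs with h
    · rw [Real.norm_eq_abs, abs_mul]
      have := hΦ.abs_apply_le ⟨x, h⟩ S
      nlinarith [hw A, abs_nonneg (w A), abs_nonneg (Φ A S)]
    · simp
  rw [Finset.sum_congr rfl h1, ← Summable.tsum_finsetSum h2]
  refine (tsum_subtype {A : Finset (Site d) | (A ∩ Λ).Nonempty}
    (fun A => ((A ∩ Λ).card * w A) * Φ A S)).trans (tsum_congr fun A => ?_)
  rw [Finset.sum_ite, Finset.sum_const_zero, add_zero, Finset.sum_const, nsmul_eq_mul,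
    Set.indicator_apply]
  have : Λ.filter (fun x => x ∈ A) = A ∩ Λ := by ext; simp [and_comm]
  simp only [this, Set.mem_ofPred_eq]
  split_ifs with h
  · ring
  · rw [Finset.not_nonempty_iff_eq_empty.1 h]; simp

lemma IsInteraction.summable_hamiltonian (hΦ : IsInteraction Φ) (Λ : Finset (Site d))
    (S : Config d E) :
    Summable fun A : Finset (Site d) => if (A ∩ Λ).Nonempty then Φ A S else 0 := by
  refine (hΦ.summable_meet Λ).of_norm_bounded fun A => ?_
  split_ifs with h
  · exact hΦ.abs_apply_le (nonempty_of_inter_nonempty h) S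
  · simp

lemma IsInteraction.exists_abs_hamiltonian_le (hΦ : IsInteraction Φ) (Λ : Finset (Site d)) :
    ∃ C, ∀ S, |hamiltonian Φ Λ S| ≤ C := by
  refine ⟨∑' A : Finset (Site d), if (A ∩ Λ).Nonempty then supNorm Φ A else 0, fun S => ?_⟩
  rw [hamiltonian_eq_tsum, ← Real.norm_eq_abs]
  refine tsum_of_norm_bounded (hΦ.summable_meet Λ).hasSum fun A => ?_
  split_ifs with h
  · exact hΦ.abs_apply_le (nonempty_of_inter_nonempty h) S
  · simp

lemma IsInteraction.measurable_hamiltonian (hΦ : IsInteraction Φ) (Λ : Finset (Site d)) :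
    Measurable (hamiltonian Φ Λ) := by
  have h : ∀ S, Tendsto (fun s : Finset (Finset (Site d)) =>
      ∑ A ∈ s, if (A ∩ Λ).Nonempty then Φ A S else 0) atTop (𝓝 (hamiltonian Φ Λ S)) := by
    intro S
    rw [hamiltonian_eq_tsum]
    exact (hΦ.summable_hamiltonian Λ S).hasSum
  refine measurable_of_tendsto_metrizable' atTop (fun s => ?_) (tendsto_pi_nhds.2 h)
  refine Finset.measurable_sum _ fun A _ => ?_
  split_ifs
  · exact hΦ.measurable A
  · exact measurable_const

/-- The Hamiltonian in `Λ` is quasilocal. -/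
lemma IsInteraction.hamiltonian_quasilocal (hΦ : IsInteraction Φ) (Λ : Finset (Site d))
    {ε : ℝ} (hε : 0 < ε) : ∃ D : Finset (Site d), ∀ S S' : Config d E, (∀ x ∈ D, S x = S' x) →
      |hamiltonian Φ Λ S - hamiltonian Φ Λ S'| ≤ ε := by
  -- Finitely many sets carry all but ε / 2 of the norm. Configurations that agree on their union
  -- differ only in the remaining terms, each counted twice.
  obtain ⟨s, hs⟩ := ((tendsto_order.1 (tendsto_tsum_compl_atTop_zero
    fun A : Finset (Site d) => if (A ∩ Λ).Nonempty then supNorm Φ A else 0)).2 (ε / 2)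
      (by positivity)).exists
  refine ⟨s.biUnion id, fun S S' h => ?_⟩
  have hsum := (hΦ.summable_meet Λ).indicator ((s : Set (Finset (Site d)))ᶜ)
  rw [hamiltonian_eq_tsum, hamiltonian_eq_tsum,
    ← (hΦ.summable_hamiltonian Λ S).tsum_sub (hΦ.summable_hamiltonian Λ S'), ← Real.norm_eq_abs]
  refine (tsum_of_norm_bounded (hsum.mul_left 2).hasSum fun A => ?_).trans ?_
  · by_cases hA : A ∈ s
    · have : Φ A S = Φ A S' := hΦ.dependsOn A fun x hx =>
        h x (Finset.mem_biUnion.2 ⟨A, hA, hx⟩)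
      simp [this, hA]
    · rw [Set.indicator_of_mem (by simpa using hA)]
      split_ifs with hne
      · have h1 := hΦ.abs_apply_le (nonempty_of_inter_nonempty hne) S
        have h2 := hΦ.abs_apply_le (nonempty_of_inter_nonempty hne) S'
        calc ‖Φ A S - Φ A S'‖ ≤ |Φ A S| + |Φ A S'| := abs_sub _ _
          _ ≤ _ := by linarith
      · simp
  · rw [tsum_mul_left, ← tsum_subtype]
    have : (∑' x : ((s : Set (Finset (Site d)))ᶜ : Set _),
      if ((x : Finset (Site d)) ∩ Λ).Nonempty then supNorm Φ x else 0) < ε / 2 := hs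
    linarith

/-- The terms that meet `Λ` but not `Δ` do not see the spins in `Δ`. This is the consistency of the
specification: given the outside of `Δ`, the remainder `R` is a constant and cancels on
normalization. -/
lemma IsInteraction.hamiltonian_of_subset (hΦ : IsInteraction Φ) {Δ Λ : Finset (Site d)}
    (h : Δ ⊆ Λ) : ∃ R : Config d E → ℝ, DependsOn R ((Δ : Set (Site d))ᶜ) ∧
      ∀ S, hamiltonian Φ Λ S = hamiltonian Φ Δ S + R S := by
  have hmono : ∀ A : Finset (Site d), (A ∩ Δ).Nonempty → (A ∩ Λ).Nonempty := fun A hA =>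
    hA.mono (Finset.inter_subset_inter_left h)
  refine ⟨fun S => hamiltonian Φ Λ S - hamiltonian Φ Δ S, fun S S' hS => ?_, fun S => by ring⟩
  simp only [hamiltonian_eq_tsum]
  rw [← (hΦ.summable_hamiltonian Λ S).tsum_sub (hΦ.summable_hamiltonian Δ S),
    ← (hΦ.summable_hamiltonian Λ S').tsum_sub (hΦ.summable_hamiltonian Δ S')]
  refine tsum_congr fun A => ?_
  by_cases hA : (A ∩ Δ).Nonempty
  · simp [hA, hmono A hA]
  · have : Φ A S = Φ A S' := hΦ.dependsOn A fun x hx => hS x fun hxΔ =>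
      hA ⟨x, Finset.mem_inter.2 ⟨hx, hxΔ⟩⟩
    simp [this]

lemma IsInteraction.hamiltonian_shift (hΦ : IsInteraction Φ) (Λ : Finset (Site d)) (x : Site d)
    (S : Config d E) : hamiltonian Φ Λ (shift (-x) S) = hamiltonian Φ (translate x Λ) S := by
  rw [hamiltonian_eq_tsum, hamiltonian_eq_tsum, ← (translate x).tsum_eq
    fun A : Finset (Site d) => if (A ∩ translate x Λ).Nonempty then Φ A S else 0]
  refine tsum_congr fun A => ?_
  have : translate x A ∩ translate x Λ = translate x (A ∩ Λ) := by
    ext y; simp [mem_translate]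
  rw [this, hΦ.apply_translate]
  have h2 : (translate x (A ∩ Λ)).Nonempty ↔ (A ∩ Λ).Nonempty := by
    rw [← Finset.card_pos, card_translate, Finset.card_pos]
  simp [h2]

end Interaction

/-! ### Energies that are nearly sums of local densities -/

section AsymptoticallyLocal

variable [MeasurableSpace E]

/-- Functions of the box `{1, …, L}^d` that are, up to an error of small order in the volume and
uniformly in the configuration, sums over the box of the translates of a local function. -/
def IsAsymptoticallyLocal (W : ℕ → Config d E → ℝ) : Prop :=
  ∀ ε > 0, ∃ φ : Config d E → ℝ, IsBoundedLocal φ ∧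
    ∀ᶠ L : ℕ in atTop, ∀ S, |W L S - ∑ x ∈ box d L, φ (shift (-x) S)| ≤ ε * (L : ℝ) ^ d

lemma IsBoundedLocal.add {φ ψ : Config d E → ℝ} (hφ : IsBoundedLocal φ) (hψ : IsBoundedLocal ψ) :
    IsBoundedLocal fun S => φ S + ψ S := by
  obtain ⟨C, hC⟩ := hφ.bounded
  obtain ⟨C', hC'⟩ := hψ.bounded
  obtain ⟨D, hD⟩ := hφ.isLocal
  obtain ⟨D', hD'⟩ := hψ.isLocal
  refine ⟨hφ.measurable.add hψ.measurable, ⟨C + C', fun S =>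
    (abs_add_le _ _).trans (add_le_add (hC S) (hC' S))⟩, D ∪ D', fun S S' h => ?_⟩
  simp only
  rw [hD fun x hx => h x (Finset.mem_union_left _ hx),
    hD' fun x hx => h x (Finset.mem_union_right _ hx)]

lemma IsBoundedLocal.const_mul {φ : Config d E → ℝ} (hφ : IsBoundedLocal φ) (a : ℝ) :
    IsBoundedLocal fun S => a * φ S := by
  obtain ⟨C, hC⟩ := hφ.bounded
  obtain ⟨D, hD⟩ := hφ.isLocal
  refine ⟨hφ.measurable.const_mul a, ⟨|a| * C, fun S => ?_⟩, D, fun S S' h => ?_⟩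
  · rw [abs_mul]; exact mul_le_mul_of_nonneg_left (hC S) (abs_nonneg a)
  · simp only [hD h]

lemma isBoundedLocal_zero : IsBoundedLocal fun _ : Config d E => (0 : ℝ) :=
  ⟨measurable_const, ⟨0, by simp⟩, ∅, fun _ _ _ => rfl⟩

lemma IsBoundedLocal.sum {ι : Type*} (s : Finset ι) {φ : ι → Config d E → ℝ}
    (hφ : ∀ i ∈ s, IsBoundedLocal (φ i)) : IsBoundedLocal fun S => ∑ i ∈ s, φ i S := by
  classical
  induction s using Finset.induction_on with
  | empty => simpa using isBoundedLocal_zero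
  | insert i s hi ih =>
    simp only [Finset.sum_insert hi]
    exact (hφ i (Finset.mem_insert_self _ _)).add
      (ih fun j hj => hφ j (Finset.mem_insert_of_mem hj))

lemma IsAsymptoticallyLocal.add {W W' : ℕ → Config d E → ℝ} (hW : IsAsymptoticallyLocal W)
    (hW' : IsAsymptoticallyLocal W') : IsAsymptoticallyLocal fun L S => W L S + W' L S := by
  intro ε hε
  obtain ⟨φ, hφ, h⟩ := hW (ε / 2) (by positivity)
  obtain ⟨φ', hφ', h'⟩ := hW' (ε / 2) (by positivity)
  refine ⟨_, hφ.add hφ', ?_⟩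
  filter_upwards [h, h'] with L hL hL' S
  rw [Finset.sum_add_distrib, add_sub_add_comm]
  refine (abs_add_le _ _).trans ?_
  linarith [hL S, hL' S]

lemma IsAsymptoticallyLocal.const_mul {W : ℕ → Config d E → ℝ} (hW : IsAsymptoticallyLocal W)
    (a : ℝ) : IsAsymptoticallyLocal fun L S => a * W L S := by
  intro ε hε
  obtain ⟨φ, hφ, h⟩ := hW (ε / (|a| + 1)) (by positivity)
  refine ⟨_, hφ.const_mul a, ?_⟩
  filter_upwards [h] with L hL S
  rw [← Finset.mul_sum, ← mul_sub, abs_mul]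
  have h1 : |a| * (ε / (|a| + 1)) ≤ ε := by
    rw [mul_div_assoc', div_le_iff₀ (by positivity)]
    nlinarith [abs_nonneg a]
  calc _ ≤ |a| * (ε / (|a| + 1) * (L : ℝ) ^ d) := mul_le_mul_of_nonneg_left (hL S) (abs_nonneg a)
    _ = |a| * (ε / (|a| + 1)) * (L : ℝ) ^ d := by ring
    _ ≤ _ := by gcongr

lemma IsBoundedLocal.isAsymptoticallyLocal {g : Config d E → ℝ} (hg : IsBoundedLocal g) :
    IsAsymptoticallyLocal fun L S => ∑ x ∈ box d L, g (shift (-x) S) := fun ε hε =>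
  ⟨g, hg, Eventually.of_forall fun L S => by simp; positivity⟩

variable {Φ : Finset (Site d) → Config d E → ℝ}

/-- Share each Φ_A equally among the points of A, so that the density at the origin is the sum of
Φ_A / |A| over A ∋ 0, and truncate to finitely many sets. The weights are prescribed only for sets
inside the box, since the retained sets that leave it are felt only at boundary sites. This freedom
lets a single φ serve both torus Hamiltonians. -/
lemma IsInteraction.exists_local_approximation (hΦ : IsInteraction Φ) {ε : ℝ} (hε : 0 < ε) :
    ∃ φ : Config d E → ℝ, IsBoundedLocal φ ∧ ∀ w : ℕ → Finset (Site d) → ℝ,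
      (∀ L A, |w L A| ≤ 1) → (∀ L A, A ⊆ box d L → w L A = 1 / A.card) →
      ∀ᶠ L : ℕ in atTop, ∀ S,
        |(∑' A : {A : Finset (Site d) // (A ∩ box d L).Nonempty},
          ((A.1 ∩ box d L).card * w L A.1) * Φ A.1 S) - ∑ x ∈ box d L, φ (shift (-x) S)|
        ≤ ε * (L : ℝ) ^ d := by
  set M := totalNorm Φ
  have hM : 0 ≤ M := totalNorm_nonneg Φ
  obtain ⟨s, hs⟩ := ((tendsto_order.1 (tendsto_tsum_compl_atTop_zero
    fun A : Finset (Site d) => if (0 : Site d) ∈ A then supNorm Φ A else 0)).2 (ε / 2)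
      (by positivity)).exists
  have hs : (∑' A, ((s : Set (Finset (Site d)))ᶜ).indicator
      (fun A => if (0 : Site d) ∈ A then supNorm Φ A else 0) A) < ε / 2 := by
    rw [← tsum_subtype]; exact hs
  have hsum := hΦ.summable_zero.indicator ((s : Set (Finset (Site d)))ᶜ)
  set s' := s.filter fun A => (0 : Site d) ∈ A
  set φ : Config d E → ℝ := fun S => ∑ A ∈ s', (1 / A.card : ℝ) * Φ A S
  have hφ : IsBoundedLocal φ := IsBoundedLocal.sum _ fun A hA =>
    IsBoundedLocal.const_mul ⟨hΦ.measurable A, ⟨_, fun S => hΦ.abs_apply_le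
      ⟨0, (Finset.mem_filter.1 hA).2⟩ S⟩, A, hΦ.dependsOn A⟩ _
  refine ⟨φ, hφ, fun w hw hw' => ?_⟩
  have hcard : ∀ A : Finset (Site d), |(1 / A.card : ℝ)| ≤ 1 := by
    intro A
    rw [abs_of_nonneg (by positivity)]
    rcases Nat.eq_zero_or_pos A.card with h | h
    · simp [h]
    · rw [div_le_one (by exact_mod_cast h)]; exact_mod_cast h
  have hφ' : ∀ S, φ S = ∑' A : Finset (Site d),
      if (0 : Site d) ∈ A then (if A ∈ s then 1 / A.card else 0 : ℝ) * Φ A S else 0 := by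
    intro S
    rw [tsum_eq_sum (s := s')]
    · refine Finset.sum_congr rfl fun A hA => ?_
      have := Finset.mem_filter.1 hA
      simp [this.1, this.2]
    · intro A hA
      by_cases h0 : (0 : Site d) ∈ A
      · have : A ∉ s := fun h => hA (Finset.mem_filter.2 ⟨h, h0⟩)
        simp [this]
      · simp [h0]
  have hsummable : ∀ (v : Finset (Site d) → ℝ) (_ : ∀ A, |v A| ≤ 1) (S : Config d E),
      Summable fun A : Finset (Site d) => if (0 : Site d) ∈ A then v A * Φ A S else 0 := by
    intro v hv S
    refine hΦ.summable_zero.of_norm_bounded fun A => ?_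
    split_ifs with h
    · rw [Real.norm_eq_abs, abs_mul]
      nlinarith [hv A, abs_nonneg (v A), abs_nonneg (Φ A S), hΦ.abs_apply_le ⟨0, h⟩ S]
    · simp
  have hv2 : ∀ A, |(if A ∈ s then 1 / A.card else 0 : ℝ)| ≤ 1 := by
    intro A; split_ifs
    · exact hcard A
    · simp
  -- A boundary site costs at most 2 * M beyond the tail ε / 2 allowed everywhere. The bound on
  -- their number keeps the total below ε / 2 per site, and the + 1 avoids division by zero when M =
  -- 0.
  filter_upwards [eventually_card_boundary_le (s'.biUnion id)
    (show 0 < ε / (2 * (2 * M + 1)) by positivity)] with L hL S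
  set bad := (box d L).filter fun x => ∃ y ∈ s'.biUnion id, x + y ∉ box d L
  rw [hΦ.tsum_meet_eq _ (hw L), ← Finset.sum_sub_distrib]
  have hpt : ∀ x ∈ box d L, |(∑' A : Finset (Site d),
      if (0 : Site d) ∈ A then w L (translate x A) * Φ A (shift (-x) S) else 0)
        - φ (shift (-x) S)| ≤ ε / 2 + if x ∈ bad then 2 * M else 0 := by
    intro x hx
    rw [hφ', ← (hsummable _ (fun A => hw L _) _).tsum_sub (hsummable _ hv2 _), ← Real.norm_eq_abs]
    by_cases hb : x ∈ bad
    · rw [if_pos hb]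
      refine (tsum_of_norm_bounded (hΦ.summable_zero.mul_left 2).hasSum fun A => ?_).trans ?_
      · split_ifs with h0
        · rw [← sub_mul, norm_mul]
          have h1 := hΦ.abs_apply_le ⟨0, h0⟩ (shift (-x) S)
          have h2 := (norm_sub_le (w L (translate x A)) (if A ∈ s then 1 / A.card else 0 : ℝ)).trans
            (add_le_add (hw L (translate x A)) (hv2 A))
          rw [if_pos ‹A ∈ s›] at h2
          rw [Real.norm_eq_abs (Φ A _)]
          nlinarith [norm_nonneg (w L (translate x A) - (1 / A.card : ℝ)), abs_nonneg (Φ A (shift (-x) S))]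
        · rw [← sub_mul, norm_mul]
          have h1 := hΦ.abs_apply_le ⟨0, h0⟩ (shift (-x) S)
          have h2 := hw L (translate x A)
          rw [sub_zero, Real.norm_eq_abs, Real.norm_eq_abs (Φ A _)]
          nlinarith [abs_nonneg (w L (translate x A)), abs_nonneg (Φ A (shift (-x) S))]
        · simp
      · rw [tsum_mul_left]
        have : (∑' A : Finset (Site d), if (0 : Site d) ∈ A then supNorm Φ A else 0) = M := rfl
        rw [this]; linarith
    -- Away from the boundary the retained sets translate into the box, so their weights agree with
    -- those in φ and only the tail outside `s` contributes.
    · rw [if_neg hb, add_zero]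
      refine (tsum_of_norm_bounded hsum.hasSum fun A => ?_).trans hs.le
      by_cases hA : A ∈ s
      · by_cases h0 : (0 : Site d) ∈ A
        · have hsub : translate x A ⊆ box d L := by
            intro y hy
            by_contra hcon
            refine hb (Finset.mem_filter.2 ⟨hx, y - x, Finset.mem_biUnion.2
              ⟨A, Finset.mem_filter.2 ⟨hA, h0⟩, mem_translate.1 hy⟩, by simpa using hcon⟩)
          simp [hA, h0, hw' L _ hsub, card_translate]
        · simp [hA, h0]
      · rw [Set.indicator_of_mem (by simpa using hA)]
        split_ifs with h0
        · rw [zero_mul, sub_zero, Real.norm_eq_abs, abs_mul]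
          nlinarith [hw L (translate x A), abs_nonneg (w L (translate x A)),
            abs_nonneg (Φ A (shift (-x) S)), hΦ.abs_apply_le ⟨0, h0⟩ (shift (-x) S)]
        · simp
  calc _ ≤ ∑ x ∈ box d L, (ε / 2 + if x ∈ bad then 2 * M else 0) :=
        (Finset.abs_sum_le_sum_abs _ _).trans (Finset.sum_le_sum hpt)
    _ = ε / 2 * (L : ℝ) ^ d + bad.card * (2 * M) := by
        rw [Finset.sum_add_distrib, Finset.sum_const, card_box, ← Finset.sum_filter,
          Finset.sum_const, nsmul_eq_mul, nsmul_eq_mul]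
        have : (box d L).filter (fun x => x ∈ bad) = bad := by
          ext x; simp only [Finset.mem_filter, bad]; tauto
        rw [this]; push_cast; ring
    _ ≤ ε / 2 * (L : ℝ) ^ d + ε / (2 * (2 * M + 1)) * (L : ℝ) ^ d * (2 * M) := by gcongr
    _ ≤ ε * (L : ℝ) ^ d := by
        have h3 : ε / (2 * (2 * M + 1)) * (2 * M) ≤ ε / 2 := by
          rw [div_mul_eq_mul_div, div_le_div_iff₀ (by positivity) (by positivity)]
          nlinarith
        have h4 : (0 : ℝ) ≤ (L : ℝ) ^ d := by positivity
        nlinarith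

lemma abs_one_div_natCast_le_one (n : ℕ) : |(1 / n : ℝ)| ≤ 1 := by
  rw [abs_of_nonneg (by positivity)]
  rcases Nat.eq_zero_or_pos n with h | h
  · simp [h]
  · rw [div_le_one (by exact_mod_cast h)]; exact_mod_cast h

/-- The weights 1 / |A ∩ Λ| and 1 / |A| give the full and the proportional Hamiltonian. The common φ
is what makes the two differ by o(L^d). -/
lemma IsInteraction.exists_local_approximation_hamiltonian (hΦ : IsInteraction Φ) {ε : ℝ}
    (hε : 0 < ε) : ∃ φ : Config d E → ℝ, IsBoundedLocal φ ∧ (∀ᶠ L : ℕ in atTop, ∀ S,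
        |hamiltonian Φ (box d L) S - ∑ x ∈ box d L, φ (shift (-x) S)| ≤ ε * (L : ℝ) ^ d) ∧
      ∀ᶠ L : ℕ in atTop, ∀ S,
        |proportionalHamiltonian Φ (box d L) S - ∑ x ∈ box d L, φ (shift (-x) S)|
          ≤ ε * (L : ℝ) ^ d := by
  obtain ⟨φ, hφ, h⟩ := hΦ.exists_local_approximation hε
  refine ⟨φ, hφ, ?_, ?_⟩
  · have h1 := h (fun L A => 1 / (A ∩ box d L).card) (fun L A => abs_one_div_natCast_le_one _)
      (fun L A hA => by rw [Finset.inter_eq_left.2 hA])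
    filter_upwards [h1] with L hL S
    convert hL S using 3
    refine tsum_congr fun A => ?_
    have := A.2.card_pos
    field_simp
  · have h1 := h (fun _ A => 1 / A.card) (fun L A => abs_one_div_natCast_le_one _)
      (fun L A _ => rfl)
    filter_upwards [h1] with L hL S
    convert hL S using 3
    exact tsum_congr fun A => by ring

lemma IsInteraction.isAsymptoticallyLocal_hamiltonian (hΦ : IsInteraction Φ) :
    IsAsymptoticallyLocal fun L S => hamiltonian Φ (box d L) S := fun _ hε =>
  let ⟨φ, hφ, h, _⟩ := hΦ.exists_local_approximation_hamiltonian hε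
  ⟨φ, hφ, h⟩

lemma IsInteraction.isAsymptoticallyLocal_proportionalHamiltonian (hΦ : IsInteraction Φ) :
    IsAsymptoticallyLocal fun L S => proportionalHamiltonian Φ (box d L) S := fun _ hε =>
  let ⟨φ, hφ, _, h⟩ := hΦ.exists_local_approximation_hamiltonian hε
  ⟨φ, hφ, h⟩

lemma IsInteraction.eventually_abs_hamiltonian_sub_le (hΦ : IsInteraction Φ) {ε : ℝ}
    (hε : 0 < ε) : ∀ᶠ L : ℕ in atTop, ∀ S,
      |proportionalHamiltonian Φ (box d L) S - hamiltonian Φ (box d L) S| ≤ ε * (L : ℝ) ^ d := by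
  obtain ⟨φ, -, h, h'⟩ := hΦ.exists_local_approximation_hamiltonian (half_pos hε)
  filter_upwards [h, h'] with L hL hL' S
  have h1 := abs_le.1 (hL S)
  have h2 := abs_le.1 (hL' S)
  rw [abs_le]; constructor <;> linarith [h1.1, h1.2, h2.1, h2.2]

lemma IsInteraction.norm_proportion_mul_le (hΦ : IsInteraction Φ) (Λ A : Finset (Site d))
    (S : Config d E) :
    ‖(if (A ∩ Λ).Nonempty then ((A ∩ Λ).card / A.card : ℝ) * Φ A S else 0)‖
      ≤ if (A ∩ Λ).Nonempty then supNorm Φ A else 0 := by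
  split_ifs with h
  · rw [norm_mul]
    have h1 : ‖((A ∩ Λ).card / A.card : ℝ)‖ ≤ 1 := by
      rw [Real.norm_of_nonneg (by positivity)]
      exact div_le_one_of_le₀ (by exact_mod_cast Finset.card_le_card Finset.inter_subset_left)
        (by positivity)
    have h2 : ‖Φ A S‖ ≤ supNorm Φ A := hΦ.abs_apply_le (nonempty_of_inter_nonempty h) S
    nlinarith [norm_nonneg (Φ A S)]
  · simp

lemma IsInteraction.exists_abs_proportionalHamiltonian_le (hΦ : IsInteraction Φ)
    (Λ : Finset (Site d)) : ∃ C, ∀ S, |proportionalHamiltonian Φ Λ S| ≤ C := by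
  refine ⟨∑' A : Finset (Site d), if (A ∩ Λ).Nonempty then supNorm Φ A else 0, fun S => ?_⟩
  rw [proportionalHamiltonian_eq_tsum, ← Real.norm_eq_abs]
  exact tsum_of_norm_bounded (hΦ.summable_meet Λ).hasSum fun A => hΦ.norm_proportion_mul_le Λ A S

lemma IsInteraction.measurable_proportionalHamiltonian (hΦ : IsInteraction Φ)
    (Λ : Finset (Site d)) : Measurable (proportionalHamiltonian Φ Λ) := by
  have h : ∀ S, Tendsto (fun s : Finset (Finset (Site d)) => ∑ A ∈ s,
      if (A ∩ Λ).Nonempty then ((A ∩ Λ).card / A.card : ℝ) * Φ A S else 0) atTop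
      (𝓝 (proportionalHamiltonian Φ Λ S)) := by
    intro S
    rw [proportionalHamiltonian_eq_tsum]
    exact ((hΦ.summable_meet Λ).of_norm_bounded
      fun A => hΦ.norm_proportion_mul_le Λ A S).hasSum
  refine measurable_of_tendsto_metrizable' atTop (fun s => ?_) (tendsto_pi_nhds.2 h)
  refine Finset.measurable_sum _ fun A _ => ?_
  split_ifs
  · exact (hΦ.measurable A).const_mul _
  · exact measurable_const

end AsymptoticallyLocal

end

/-! ### Bounded measurable functions, gluing and the product measure -/

section

section BoundedMeasurable

variable {X : Type*} [MeasurableSpace X]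

/-- Bounded measurable real functions. -/
structure IsBoundedMeasurable (F : X → ℝ) : Prop where
  measurable : Measurable F
  bounded : ∃ C : ℝ, ∀ x, |F x| ≤ C

variable {F G : X → ℝ}

lemma IsBoundedMeasurable.integrable (hF : IsBoundedMeasurable F) (μ : Measure X)
    [IsFiniteMeasure μ] : Integrable F μ := by
  obtain ⟨C, hC⟩ := hF.bounded
  exact .of_bound hF.measurable.aestronglyMeasurable C (ae_of_all _ hC)

lemma isBoundedMeasurable_const (a : ℝ) : IsBoundedMeasurable fun _ : X => a :=
  ⟨measurable_const, |a|, fun _ => le_rfl⟩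

lemma IsBoundedMeasurable.add (hF : IsBoundedMeasurable F) (hG : IsBoundedMeasurable G) :
    IsBoundedMeasurable fun x => F x + G x := by
  obtain ⟨C, hC⟩ := hF.bounded
  obtain ⟨C', hC'⟩ := hG.bounded
  exact ⟨hF.measurable.add hG.measurable, C + C', fun x =>
    (abs_add_le _ _).trans (add_le_add (hC x) (hC' x))⟩

lemma IsBoundedMeasurable.mul (hF : IsBoundedMeasurable F) (hG : IsBoundedMeasurable G) :
    IsBoundedMeasurable fun x => F x * G x := by
  obtain ⟨C, hC⟩ := hF.bounded
  obtain ⟨C', hC'⟩ := hG.bounded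
  refine ⟨hF.measurable.mul hG.measurable, C * C', fun x => ?_⟩
  rw [abs_mul]
  exact mul_le_mul (hC x) (hC' x) (abs_nonneg _) ((abs_nonneg _).trans (hC x))

lemma IsBoundedMeasurable.const_mul (hF : IsBoundedMeasurable F) (a : ℝ) :
    IsBoundedMeasurable fun x => a * F x := (isBoundedMeasurable_const a).mul hF

lemma IsBoundedMeasurable.sub (hF : IsBoundedMeasurable F) (hG : IsBoundedMeasurable G) :
    IsBoundedMeasurable fun x => F x - G x := by
  simpa [sub_eq_add_neg] using hF.add (hG.const_mul (-1))

lemma IsBoundedMeasurable.sum {ι : Type*} (s : Finset ι) {F : ι → X → ℝ}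
    (hF : ∀ i ∈ s, IsBoundedMeasurable (F i)) : IsBoundedMeasurable fun x => ∑ i ∈ s, F i x := by
  classical
  induction s using Finset.induction_on with
  | empty => simpa using isBoundedMeasurable_const 0
  | insert i s hi ih =>
    simp only [Finset.sum_insert hi]
    exact (hF i (Finset.mem_insert_self _ _)).add
      (ih fun j hj => hF j (Finset.mem_insert_of_mem hj))

lemma IsBoundedMeasurable.exp (hF : IsBoundedMeasurable F) :
    IsBoundedMeasurable fun x => Real.exp (F x) := by
  obtain ⟨C, hC⟩ := hF.bounded
  refine ⟨hF.measurable.exp, Real.exp C, fun x => ?_⟩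
  rw [Real.abs_exp]
  exact Real.exp_le_exp.2 (abs_le.1 (hC x)).2

lemma IsBoundedMeasurable.comp {Y : Type*} [MeasurableSpace Y] (hF : IsBoundedMeasurable F)
    {T : Y → X} (hT : Measurable T) : IsBoundedMeasurable fun y => F (T y) := by
  obtain ⟨C, hC⟩ := hF.bounded
  exact ⟨hF.measurable.comp hT, C, fun y => hC _⟩

lemma isBoundedMeasurable_indicator {B : Set X} (hB : MeasurableSet B) :
    IsBoundedMeasurable (B.indicator fun _ => (1 : ℝ)) :=
  ⟨measurable_const.indicator hB, 1, fun x => by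
    by_cases h : x ∈ B <;> simp [h]⟩

lemma IsBoundedMeasurable.integral_exp_pos (hF : IsBoundedMeasurable F) (μ : Measure X)
    [IsProbabilityMeasure μ] : 0 < ∫ x, Real.exp (F x) ∂μ :=
  MeasureTheory.integral_exp_pos (hF.exp.integrable μ)

lemma integral_exp_le_of_le_add (hF : IsBoundedMeasurable F) (hG : IsBoundedMeasurable G)
    (μ : Measure X) [IsProbabilityMeasure μ] {c : ℝ} (h : ∀ x, F x ≤ G x + c) :
    ∫ x, Real.exp (F x) ∂μ ≤ Real.exp c * ∫ x, Real.exp (G x) ∂μ := by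
  rw [← integral_const_mul]
  refine integral_mono (hF.exp.integrable μ) ((hG.exp.integrable μ).const_mul _) fun x => ?_
  rw [← Real.exp_add]
  exact Real.exp_le_exp.2 (by linarith [h x])

lemma log_integral_exp_le_of_le_add (hF : IsBoundedMeasurable F) (hG : IsBoundedMeasurable G)
    (μ : Measure X) [IsProbabilityMeasure μ] {c : ℝ} (h : ∀ x, F x ≤ G x + c) :
    Real.log (∫ x, Real.exp (F x) ∂μ) ≤ Real.log (∫ x, Real.exp (G x) ∂μ) + c := by
  have := Real.log_le_log (hF.integral_exp_pos μ) (integral_exp_le_of_le_add hF hG μ h)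
  rwa [Real.log_mul (Real.exp_pos _).ne' (hG.integral_exp_pos μ).ne', Real.log_exp,
    add_comm] at this

/-- A uniform error in the exponent passes unchanged to the logarithm of the integral, so errors
o(L^d) do not affect a pressure. -/
lemma abs_log_integral_exp_sub_le (hF : IsBoundedMeasurable F) (hG : IsBoundedMeasurable G)
    (μ : Measure X) [IsProbabilityMeasure μ] {c : ℝ} (h : ∀ x, |F x - G x| ≤ c) :
    |Real.log (∫ x, Real.exp (F x) ∂μ) - Real.log (∫ x, Real.exp (G x) ∂μ)| ≤ c := by
  have h1 := log_integral_exp_le_of_le_add hF hG μ (c := c) fun x => by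
    linarith [(abs_le.1 (h x)).2]
  have h2 := log_integral_exp_le_of_le_add hG hF μ (c := c) fun x => by
    linarith [(abs_le.1 (h x)).1]
  rw [abs_le]; constructor <;> linarith

end BoundedMeasurable

variable {d : ℕ} {E : Type*}

lemma glue_of_mem {Λ : Finset (Site d)} {T : Λ → E} {S : Config d E} {x : Site d} (h : x ∈ Λ) :
    glue Λ T S x = T ⟨x, h⟩ := by simp [glue, h]

lemma glue_of_notMem {Λ : Finset (Site d)} {T : Λ → E} {S : Config d E} {x : Site d}
    (h : x ∉ Λ) : glue Λ T S x = S x := by simp [glue, h]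

lemma apply_glue_of_dependsOn {Λ : Finset (Site d)} {β : Type*} {R : Config d E → β}
    (hR : DependsOn R ((Λ : Set (Site d))ᶜ)) (T : Λ → E) (S : Config d E) :
    R (glue Λ T S) = R S :=
  hR fun x hx => glue_of_notMem (by simpa using hx)

section Measurable

variable [MeasurableSpace E]

lemma measurable_glue (Λ : Finset (Site d)) :
    Measurable fun p : (Λ → E) × Config d E => glue Λ p.1 p.2 := by
  refine measurable_pi_lambda _ fun x => ?_
  by_cases h : x ∈ Λ
  · simp only [glue_of_mem h]; fun_prop
  · simp only [glue_of_notMem h]; fun_prop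

lemma measurable_glue_left (Λ : Finset (Site d)) (S : Config d E) :
    Measurable fun T : Λ → E => glue Λ T S :=
  (measurable_glue Λ).comp (measurable_id.prodMk measurable_const)

lemma IsBoundedLocal.isBoundedMeasurable {φ : Config d E → ℝ} (hφ : IsBoundedLocal φ) :
    IsBoundedMeasurable φ := ⟨hφ.measurable, hφ.bounded⟩

/-- The law of independent spins. -/
noncomputable abbrev freeMeasure (d : ℕ) (μ₀ : Measure E) : Measure (Config d E) :=
  Measure.infinitePi fun _ : Site d => μ₀

variable (μ₀ : Measure E) [IsProbabilityMeasure μ₀]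

/-- Redrawing the spins in `Λ` independently does not change the product law. It is checked on
rectangles, whose factors split into those over `s ∩ Λ` and those over `s \ Λ`. -/
lemma map_glue_freeMeasure (Λ : Finset (Site d)) :
    ((Measure.pi fun _ : Λ => μ₀).prod (freeMeasure d μ₀)).map (fun p => glue Λ p.1 p.2)
      = freeMeasure d μ₀ := by
  refine Measure.eq_infinitePi _ fun s t ht => ?_
  classical
  rw [Measure.map_apply (measurable_glue Λ) (MeasurableSet.pi s.countable_toSet fun i _ => ht i)]
  have : (fun p : (Λ → E) × Config d E => glue Λ p.1 p.2) ⁻¹' (Set.pi s t) =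
      (Set.univ.pi fun x : Λ => if (x : Site d) ∈ s then t x else Set.univ) ×ˢ
        Set.pi ((s \ Λ : Finset (Site d)) : Set (Site d)) t := by
    ext p
    simp only [Set.mem_preimage, Set.mem_pi, Set.mem_prod, Finset.mem_coe, Finset.mem_sdiff,
      Set.mem_univ, true_imp_iff, Subtype.forall]
    constructor
    · intro h
      refine ⟨fun x hx => ?_, fun x hx => ?_⟩
      · split_ifs with hs
        · simpa [glue_of_mem hx] using h x hs
        · trivial
      · simpa [glue_of_notMem hx.2] using h x hx.1
    · rintro ⟨h1, h2⟩ x hx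
      by_cases hΛ : x ∈ Λ
      · simpa [glue_of_mem hΛ, hx] using h1 x hΛ
      · simpa [glue_of_notMem hΛ] using h2 x ⟨hx, hΛ⟩
  rw [this, Measure.prod_prod, Measure.pi_pi, Measure.infinitePi_pi _ (fun i _ => ht i),
    Finset.prod_coe_sort Λ fun x => μ₀ (if x ∈ s then t x else Set.univ)]
  have h1 : ∏ x ∈ Λ, μ₀ (if x ∈ s then t x else Set.univ) = ∏ x ∈ s ∩ Λ, μ₀ (t x) := by
    rw [Finset.inter_comm, ← Finset.filter_mem_eq_inter, Finset.prod_filter]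
    exact Finset.prod_congr rfl fun x _ => by split_ifs <;> simp
  rw [h1, Finset.prod_inter_mul_prod_sdiff s Λ fun x => μ₀ (t x)]

lemma integral_freeMeasure_glue (Λ : Finset (Site d)) {F : Config d E → ℝ}
    (hF : IsBoundedMeasurable F) :
    ∫ S, F S ∂(freeMeasure d μ₀)
      = ∫ S, ∫ T, F (glue Λ T S) ∂(Measure.pi fun _ : Λ => μ₀) ∂(freeMeasure d μ₀) := by
  conv_lhs => rw [← map_glue_freeMeasure μ₀ Λ]
  rw [integral_map (measurable_glue Λ).aemeasurable hF.measurable.aestronglyMeasurable,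
    integral_prod_symm]
  exact (hF.comp (measurable_glue Λ)).integrable _

lemma measurePreserving_shift_freeMeasure (x : Site d) :
    MeasurePreserving (shift x) (freeMeasure d μ₀) (freeMeasure d μ₀) := by
  refine ⟨measurable_shift x, ?_⟩
  exact Measure.map_infinitePi_infinitePi_of_inj (P := fun _ : Site d => μ₀)
    (f := fun y : Site d => y - x) sub_left_injective

lemma integral_freeMeasure_shift (x : Site d) {F : Config d E → ℝ} (hF : Measurable F) :
    ∫ S, F (shift x S) ∂(freeMeasure d μ₀) = ∫ S, F S ∂(freeMeasure d μ₀) := by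
  have h := measurePreserving_shift_freeMeasure (d := d) μ₀ x
  conv_rhs => rw [← h.map_eq]
  rw [integral_map h.measurable.aemeasurable hF.aestronglyMeasurable]

/-- Redraw the spins in `J`: `F` sees only the new spins and `G` only the old ones. -/
lemma integral_freeMeasure_mul {J J' : Finset (Site d)} (hJ : Disjoint J J')
    {F G : Config d E → ℝ} (hF : IsBoundedMeasurable F) (hG : IsBoundedMeasurable G)
    (hFJ : DependsOn F (J : Set (Site d))) (hGJ : DependsOn G (J' : Set (Site d))) :
    ∫ S, F S * G S ∂(freeMeasure d μ₀)
      = (∫ S, F S ∂(freeMeasure d μ₀)) * ∫ S, G S ∂(freeMeasure d μ₀) := by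
  rw [integral_freeMeasure_glue μ₀ J (hF.mul hG)]
  have hG' : ∀ (T : J → E) S, G (glue J T S) = G S := fun T S => hGJ fun x hx =>
    glue_of_notMem fun h => Finset.disjoint_left.1 hJ h hx
  simp only [hG', integral_mul_const]
  have hF' : ∀ S, ∫ T, F (glue J T S) ∂(Measure.pi fun _ : J => μ₀)
      = ∫ S, F S ∂(freeMeasure d μ₀) := by
    intro S
    rw [integral_freeMeasure_glue μ₀ J hF]
    have : ∀ S' (T : J → E), F (glue J T S') = F (glue J T S) := fun S' T => hFJ fun x hx => by
      rw [glue_of_mem hx, glue_of_mem hx]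
    simp only [this]
    rw [integral_const]; simp
  simp only [hF', integral_const_mul]

lemma integral_freeMeasure_prod {ι : Type*} (s : Finset ι) {J : ι → Finset (Site d)}
    (hJ : Pairwise fun i j => Disjoint (J i) (J j)) {F : ι → Config d E → ℝ}
    (hF : ∀ i, IsBoundedMeasurable (F i)) (hFJ : ∀ i, DependsOn (F i) (J i : Set (Site d))) :
    ∫ S, ∏ i ∈ s, F i S ∂(freeMeasure d μ₀) = ∏ i ∈ s, ∫ S, F i S ∂(freeMeasure d μ₀) := by
  classical
  have hbm : ∀ s : Finset ι, IsBoundedMeasurable fun S => ∏ i ∈ s, F i S := by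
    intro s
    induction s using Finset.induction_on with
    | empty => simpa using isBoundedMeasurable_const 1
    | insert i s hi ih => simp only [Finset.prod_insert hi]; exact (hF i).mul ih
  induction s using Finset.induction_on with
  | empty => simp
  | insert i s hi ih =>
    simp only [Finset.prod_insert hi]
    rw [integral_freeMeasure_mul μ₀ (J := J i) (J' := s.biUnion J) _ (hF i) (hbm s) (hFJ i), ih]
    · intro S S' h
      refine Finset.prod_congr rfl fun j hj => hFJ j fun x hx => h x ?_
      exact Finset.mem_coe.2 (Finset.mem_biUnion.2 ⟨j, hj, hx⟩)
    · rw [Finset.disjoint_biUnion_right]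
      exact fun j hj => hJ fun h => hi (h ▸ hj)

end Measurable

end

/-! ### Existence of the pressure by tiling -/

section

variable {d : ℕ} {E : Type*}

lemma abs_sum_shift_le {φ : Config d E → ℝ} {C : ℝ} (hC : ∀ S, |φ S| ≤ C) (Λ : Finset (Site d))
    (S : Config d E) : |∑ x ∈ Λ, φ (shift (-x) S)| ≤ Λ.card * C :=
  (Finset.abs_sum_le_sum_abs _ _).trans <| by
    simpa using Finset.sum_le_sum fun x (_ : x ∈ Λ) => hC (shift (-x) S)

lemma sum_shift_translate (φ : Config d E → ℝ) (Λ : Finset (Site d)) (a : Site d)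
    (S : Config d E) :
    ∑ x ∈ translate a Λ, φ (shift (-x) S) = ∑ x ∈ Λ, φ (shift (-x) (shift (-a) S)) := by
  rw [translate_apply, Finset.sum_image fun x _ y _ h => add_right_cancel h]
  exact Finset.sum_congr rfl fun x _ => by rw [shift_shift, neg_add]

/-- The cells of a tiling of the lattice by cubes of side `s`. -/
noncomputable def cell (s : ℕ) (k : Fin d → ℕ) : Finset (Site d) :=
  Fintype.piFinset fun i => Finset.Icc ((s : ℤ) * k i + 1) (s * k i + s)

lemma mem_cell {s : ℕ} {k : Fin d → ℕ} {x : Site d} :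
    x ∈ cell s k ↔ ∀ i, (s : ℤ) * k i + 1 ≤ x i ∧ x i ≤ s * k i + s := by
  simp [cell, Fintype.mem_piFinset]

lemma disjoint_cell {s : ℕ} : Pairwise fun k k' : Fin d → ℕ => Disjoint (cell s k) (cell s k') := by
  intro k k' hk
  rw [Finset.disjoint_left]
  intro x hx hx'
  refine hk (funext fun i => ?_)
  have h1 := mem_cell.1 hx i
  have h2 := mem_cell.1 hx' i
  by_contra hne
  rcases lt_or_gt_of_ne hne with h | h
  · have h3 : (k i : ℤ) + 1 ≤ k' i := by exact_mod_cast h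
    nlinarith [h1.2, h2.1]
  · have h3 : (k' i : ℤ) + 1 ≤ k i := by exact_mod_cast h
    nlinarith [h1.1, h2.2]

variable [MeasurableSpace E]

lemma isBoundedMeasurable_sum_shift {φ : Config d E → ℝ} (hφ : IsBoundedMeasurable φ)
    (Λ : Finset (Site d)) : IsBoundedMeasurable fun S => ∑ x ∈ Λ, φ (shift (-x) S) :=
  IsBoundedMeasurable.sum _ fun x _ => hφ.comp (measurable_shift (-x))

variable (μ₀ : Measure E) [IsProbabilityMeasure μ₀]

/-- Superadditivity of the partition function of a local energy density, along cubes separated by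
corridors. -/
lemma log_partition_superadditive {φ : Config d E → ℝ} (hφ : IsBoundedLocal φ) {C : ℝ}
    (hC : ∀ S, |φ S| ≤ C) {D : Finset (Site d)} (hD : DependsOn φ (D : Set (Site d))) {R : ℕ}
    (hR : ∀ y ∈ D, ∀ i, |y i| ≤ R) (l s q L : ℕ) (hs : l + 2 * R ≤ s) (hq : s * q ≤ L) :
    (q : ℝ) ^ d * (Real.log (∫ S, Real.exp (∑ x ∈ box d l, φ (shift (-x) S))
        ∂(freeMeasure d μ₀)) + C * (l : ℝ) ^ d)
      ≤ Real.log (∫ S, Real.exp (∑ x ∈ box d L, φ (shift (-x) S)) ∂(freeMeasure d μ₀))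
        + C * (L : ℝ) ^ d := by
  classical
  set K : Finset (Fin d → ℕ) := Fintype.piFinset fun _ => Finset.range q
  have hKcard : K.card = q ^ d := by simp [K, Fintype.card_piFinset]
  -- The offset R centres a cube of side l in its cell. Since s ≥ l + 2 * R, the range of φ around
  -- any point of the cube stays inside the cell, and the contributions of different cells are
  -- independent.
  set a : (Fin d → ℕ) → Site d := fun k i => (s : ℤ) * k i + R
  set G : Config d E → ℝ := fun S => ∑ x ∈ box d l, φ (shift (-x) S)
  have hG : IsBoundedMeasurable G := isBoundedMeasurable_sum_shift hφ.isBoundedMeasurable _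
  have hs' : (l : ℤ) + 2 * R ≤ s := by exact_mod_cast hs
  have hcell : ∀ k, ∀ x ∈ translate (a k) (box d l), ∀ y : Site d, (∀ i, |y i| ≤ R) →
      x + y ∈ cell s k := by
    intro k x hx y hy
    have h1 := mem_box.1 (mem_translate.1 hx)
    refine mem_cell.2 fun i => ?_
    have h2 := h1 i
    have h3 := abs_le.1 (hy i)
    simp only [Pi.sub_apply, Pi.add_apply, a] at h2 ⊢
    constructor <;> linarith [h2.1, h2.2, h3.1, h3.2]
  have hcell0 : ∀ k, translate (a k) (box d l) ⊆ cell s k := fun k x hx => by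
    simpa using hcell k x hx 0 (by simp)
  have hdisj : (K : Set (Fin d → ℕ)).PairwiseDisjoint fun k => translate (a k) (box d l) :=
    fun k _ k' _ hk => (disjoint_cell (s := s) hk).mono (hcell0 k) (hcell0 k')
  set U := K.biUnion fun k => translate (a k) (box d l)
  have hUcard : (U.card : ℝ) = (q : ℝ) ^ d * (l : ℝ) ^ d := by
    rw [Finset.card_biUnion hdisj]
    simp [card_translate, card_box, hKcard]
  have hU : U ⊆ box d L := by
    intro x hx
    obtain ⟨k, hk, hx⟩ := Finset.mem_biUnion.1 hx
    refine mem_box.2 fun i => ?_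
    have h1 := mem_cell.1 (hcell0 k hx) i
    have h2 : (k i : ℤ) + 1 ≤ q := by
      exact_mod_cast Finset.mem_range.1 (Fintype.mem_piFinset.1 hk i)
    have h3 : (s : ℤ) * q ≤ L := by exact_mod_cast hq
    have h4 : (s : ℤ) * (k i + 1) ≤ s * q := mul_le_mul_of_nonneg_left h2 (by positivity)
    have h5 : (0 : ℤ) ≤ (s : ℤ) * k i := by positivity
    constructor <;> nlinarith [h1.1, h1.2]
  have hprod : ∫ S, Real.exp (∑ x ∈ U, φ (shift (-x) S)) ∂(freeMeasure d μ₀)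
      = (∫ S, Real.exp (G S) ∂(freeMeasure d μ₀)) ^ (q ^ d) := by
    have h1 : ∀ S, Real.exp (∑ x ∈ U, φ (shift (-x) S))
        = ∏ k ∈ K, Real.exp (G (shift (-a k) S)) := by
      intro S
      rw [← Real.exp_sum, Finset.sum_biUnion hdisj]
      congr 1
      exact Finset.sum_congr rfl fun k _ => sum_shift_translate φ _ _ S
    simp only [h1]
    rw [integral_freeMeasure_prod μ₀ K (J := cell s) disjoint_cell
      (F := fun k S => Real.exp (G (shift (-a k) S)))
      (fun k => hG.exp.comp (measurable_shift _))]
    · have h2 : ∀ k, ∫ S, Real.exp (G (shift (-a k) S)) ∂(freeMeasure d μ₀)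
          = ∫ S, Real.exp (G S) ∂(freeMeasure d μ₀) := fun k =>
        integral_freeMeasure_shift μ₀ _ hG.measurable.exp
      simp only [h2, Finset.prod_const, hKcard]
    · intro k S S' h
      simp only [G, ← sum_shift_translate]
      congr 1
      refine Finset.sum_congr rfl fun x hx => hD fun y hy => ?_
      rw [shift_neg_apply, shift_neg_apply, add_comm]
      exact h _ (hcell k x hx y (hR y hy))
  -- The uncovered sites lower the exponent by at most C each. Adding C per site on both sides of
  -- the final inequality absorbs this loss.
  have hle : ∀ S, ∑ x ∈ U, φ (shift (-x) S) ≤ ∑ x ∈ box d L, φ (shift (-x) S)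
      + C * ((L : ℝ) ^ d - (q : ℝ) ^ d * (l : ℝ) ^ d) := by
    intro S
    have h1 := abs_le.1 (abs_sum_shift_le hC (box d L \ U) S)
    rw [Finset.cast_card_sdiff hU, hUcard, card_box] at h1
    push_cast at h1
    rw [← Finset.sum_sdiff hU]
    linarith [h1.1]
  have h := log_integral_exp_le_of_le_add
    (isBoundedMeasurable_sum_shift hφ.isBoundedMeasurable U)
    (isBoundedMeasurable_sum_shift hφ.isBoundedMeasurable (box d L)) (freeMeasure d μ₀) hle
  rw [hprod, Real.log_pow] at h
  push_cast at h
  linarith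

/-- Adding C per site makes the normalized logarithms nonnegative. Tiling by cells of side l + 2R +
1 then loses only the factor (l / (l + 2R + 1))^d, which tends to 1, so
`exists_tendsto_of_eventually_ge` applies. -/
lemma exists_tendsto_pressure_local {φ : Config d E → ℝ} (hφ : IsBoundedLocal φ) :
    ∃ p, Tendsto (fun L : ℕ => 1 / (L : ℝ) ^ d *
      Real.log (∫ S, Real.exp (∑ x ∈ box d L, φ (shift (-x) S)) ∂(freeMeasure d μ₀)))
      atTop (𝓝 p) := by
  obtain ⟨C, hC⟩ := hφ.bounded
  have hC0 : 0 ≤ C := by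
    obtain ⟨S⟩ : Nonempty (Config d E) := nonempty_of_isProbabilityMeasure (freeMeasure d μ₀)
    exact (abs_nonneg _).trans (hC S)
  obtain ⟨D, hD⟩ := hφ.isLocal
  obtain ⟨R, hR⟩ : ∃ R : ℕ, ∀ y ∈ D, ∀ i, |y i| ≤ R := by
    refine ⟨D.sup fun y => Finset.univ.sup fun i => (y i).natAbs, fun y hy i => ?_⟩
    rw [Int.abs_eq_natAbs]
    exact_mod_cast (Finset.le_sup (f := fun i => (y i).natAbs) (Finset.mem_univ i)).trans
      (Finset.le_sup (f := fun y : Site d => Finset.univ.sup fun i => (y i).natAbs) hy)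
  set Z : ℕ → ℝ := fun L =>
    Real.log (∫ S, Real.exp (∑ x ∈ box d L, φ (shift (-x) S)) ∂(freeMeasure d μ₀))
  have hZ : ∀ L, |Z L| ≤ C * (L : ℝ) ^ d := by
    intro L
    have h := abs_log_integral_exp_sub_le
      (isBoundedMeasurable_sum_shift hφ.isBoundedMeasurable (box d L))
      (isBoundedMeasurable_const 0) (freeMeasure d μ₀) (c := C * (L : ℝ) ^ d) fun S => by
        have := abs_sum_shift_le hC (box d L) S
        rw [card_box] at this
        push_cast at this
        rw [sub_zero]; linarith
    simpa using h
  have hpow : ∀ L : ℕ, (0 : ℝ) ≤ (L : ℝ) ^ d := fun L => by positivity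
  obtain ⟨p, hp⟩ := exists_tendsto_of_eventually_ge
    (b := fun L => (Z L + C * (L : ℝ) ^ d) / (L : ℝ) ^ d) (C := 2 * C)
    (c := fun l => ((l : ℝ) / (l + (2 * R + 1 : ℕ))) ^ d) (fun L => by
      have h1 := abs_le.1 (hZ L)
      rw [abs_of_nonneg (div_nonneg (by linarith) (hpow L))]
      exact div_le_of_le_mul₀ (hpow L) (by positivity) (by linarith [h1.2]))
    (by
      have := (tendsto_natCast_div_add_atTop ((2 * R + 1 : ℕ) : ℝ)).pow d
      simpa using this)
    (by
      intro l ε hε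
      -- The extra 1 keeps the cell side positive even when l = 0 and R = 0.
      set s := l + (2 * R + 1) with hs
      have hs0 : (0 : ℝ) < s := by positivity
      have h1 : ((l : ℝ) / (l + (2 * R + 1 : ℕ))) ^ d * ((Z l + C * (l : ℝ) ^ d) / (l : ℝ) ^ d)
          ≤ (1 / (s : ℝ)) ^ d * (Z l + C * (l : ℝ) ^ d) := by
        have h2 : (0 : ℝ) ≤ Z l + C * (l : ℝ) ^ d := by linarith [(abs_le.1 (hZ l)).1]
        have h3 : (l : ℝ) + (2 * R + 1 : ℕ) = s := by push_cast [hs]; ring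
        rw [h3]
        -- If l^d = 0, the quotient by l^d is 0 by convention, and the right side is nonnegative.
        rcases (hpow l).eq_or_lt with h0 | h0
        · rw [← h0, div_zero, mul_zero]
          rw [← h0] at h2
          positivity
        · rw [div_pow, div_pow, one_pow]
          apply le_of_eq
          field_simp
      have h4 : Tendsto (fun L : ℕ => ((L / s : ℕ) : ℝ) / L) atTop (𝓝 (1 / s)) := by
        have h5 : Tendsto (fun L : ℕ => 1 / (s : ℝ) - 1 / L) atTop (𝓝 (1 / s - 0)) :=
          tendsto_const_nhds.sub tendsto_one_div_atTop_nhds_zero_nat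
        rw [sub_zero] at h5
        refine tendsto_of_tendsto_of_tendsto_of_le_of_le' h5 tendsto_const_nhds ?_ ?_
        · filter_upwards [eventually_gt_atTop 0] with L hL
          have hL' : (0 : ℝ) < L := by exact_mod_cast hL
          rw [div_sub_div _ _ hs0.ne' hL'.ne', div_le_div_iff₀ (by positivity) hL']
          have h6 : (L : ℝ) ≤ s * ((L / s : ℕ) : ℝ) + s := by
            have := Nat.div_add_mod L s
            have h7 := Nat.mod_lt L (show 0 < s by omega)
            exact_mod_cast (show L ≤ s * (L / s) + s by omega)
          nlinarith
        · filter_upwards [eventually_gt_atTop 0] with L hL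
          have hL' : (0 : ℝ) < L := by exact_mod_cast hL
          rw [div_le_div_iff₀ hL' hs0]
          have : (((L / s : ℕ) : ℝ)) * s ≤ L := by exact_mod_cast Nat.div_mul_le_self L s
          linarith
      have h5 := (h4.pow d).mul_const (Z l + C * (l : ℝ) ^ d)
      filter_upwards [h5.eventually (lt_mem_nhds (show (1 / (s : ℝ)) ^ d * (Z l + C * (l : ℝ) ^ d) - ε
        < _ by linarith)), eventually_gt_atTop 0] with L hL hL0
      have hL' : (0 : ℝ) < L := by exact_mod_cast hL0
      have h6 := log_partition_superadditive μ₀ hφ hC hD hR l s (L / s) L (by omega)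
        (Nat.mul_div_le L s)
      have h7 : ((((L / s : ℕ) : ℝ)) / L) ^ d * (Z l + C * (l : ℝ) ^ d)
          ≤ (Z L + C * (L : ℝ) ^ d) / (L : ℝ) ^ d := by
        rw [div_pow, div_mul_eq_mul_div]
        exact div_le_div_of_nonneg_right h6 (hpow L)
      linarith)
  refine ⟨p - C, (hp.sub_const C).congr' ?_⟩
  filter_upwards [eventually_gt_atTop 0] with L hL
  have hL' : (0 : ℝ) < (L : ℝ) ^ d := by
    have : (0 : ℝ) < L := by exact_mod_cast hL
    positivity
  field_simp
  simp [Z]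

/-- Existence of the pressure for asymptotically local Hamiltonians. -/
theorem IsAsymptoticallyLocal.exists_tendsto_pressure {W : ℕ → Config d E → ℝ}
    (hW : IsAsymptoticallyLocal W) (hWm : ∀ L, IsBoundedMeasurable (W L)) :
    ∃ p, Tendsto (fun L : ℕ => 1 / (L : ℝ) ^ d *
      Real.log (∫ S, Real.exp (W L S) ∂(freeMeasure d μ₀))) atTop (𝓝 p) := by
  -- The approximating density, and with it the limit p, changes with ε. Thus the sequence is shown
  -- to be Cauchy instead of being compared with a fixed limit.
  refine cauchySeq_tendsto_of_complete (Metric.cauchySeq_iff'.2 fun ε hε => ?_)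
  obtain ⟨φ, hφ, h⟩ := hW (ε / 4) (by positivity)
  obtain ⟨p, hp⟩ := exists_tendsto_pressure_local μ₀ hφ
  have hclose : ∀ᶠ L : ℕ in atTop, |1 / (L : ℝ) ^ d *
      Real.log (∫ S, Real.exp (W L S) ∂(freeMeasure d μ₀)) - p| < ε / 2 := by
    filter_upwards [h, Metric.tendsto_nhds.1 hp (ε / 4) (by positivity), eventually_gt_atTop 0]
      with L hL hLp hL0
    have hL' : (0 : ℝ) < (L : ℝ) ^ d := by
      have : (0 : ℝ) < L := by exact_mod_cast hL0
      positivity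
    have h1 := abs_log_integral_exp_sub_le (hWm L)
      (isBoundedMeasurable_sum_shift hφ.isBoundedMeasurable (box d L)) (freeMeasure d μ₀) hL
    rw [Real.dist_eq] at hLp
    refine (abs_sub_le _ _ _).trans_lt (add_lt_add_of_le_of_lt ?_ hLp |>.trans_le
      (show ε / 4 + ε / 4 ≤ ε / 2 by linarith))
    rw [← mul_sub, abs_mul, abs_of_pos (by positivity), one_div, inv_mul_le_iff₀ hL']
    linarith
  obtain ⟨N, hN⟩ := eventually_atTop.1 hclose
  refine ⟨N, fun n hn => ?_⟩
  rw [Real.dist_eq]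
  have h1 := abs_lt.1 (hN n hn)
  have h2 := abs_lt.1 (hN N le_rfl)
  rw [abs_lt]; constructor <;> linarith [h1.1, h1.2, h2.1, h2.2]

/-- Up to an error of small order in the volume, an asymptotically local Hamiltonian is determined
by the spins in the box. -/
lemma IsAsymptoticallyLocal.eventually_abs_sub_le {W : ℕ → Config d E → ℝ}
    (hW : IsAsymptoticallyLocal W) {ε : ℝ} (hε : 0 < ε) :
    ∀ᶠ L : ℕ in atTop, ∀ S S' : Config d E, (∀ x ∈ box d L, S x = S' x) →
      |W L S - W L S'| ≤ ε * (L : ℝ) ^ d := by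
  obtain ⟨φ, hφ, h⟩ := hW (ε / 4) (by positivity)
  obtain ⟨C, hC⟩ := hφ.bounded
  obtain ⟨D, hD⟩ := hφ.isLocal
  -- Only boundary sites see spins outside the box, at a cost of at most 2|C| each. Half of ε goes
  -- to them and a quarter to each use of the local approximation.
  filter_upwards [h, eventually_card_boundary_le D (show 0 < ε / (2 * (2 * |C| + 1)) by positivity)]
    with L hL hb S S' hS
  set bad := (box d L).filter fun x => ∃ y ∈ D, x + y ∉ box d L
  have h1 : |∑ x ∈ box d L, φ (shift (-x) S) - ∑ x ∈ box d L, φ (shift (-x) S')|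
      ≤ bad.card * (2 * |C|) := by
    rw [← Finset.sum_sub_distrib]
    refine (Finset.abs_sum_le_sum_abs _ _).trans ?_
    rw [← Finset.sum_filter_add_sum_filter_not (box d L) fun x => ∃ y ∈ D, x + y ∉ box d L]
    have h2 : ∑ x ∈ (box d L).filter (fun x => ¬ ∃ y ∈ D, x + y ∉ box d L),
        |φ (shift (-x) S) - φ (shift (-x) S')| = 0 := by
      refine Finset.sum_eq_zero fun x hx => ?_
      have hx2 := (Finset.mem_filter.1 hx).2
      rw [hD (x := shift (-x) S) (y := shift (-x) S') fun y hy => ?_, sub_self, abs_zero]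
      rw [shift_neg_apply, shift_neg_apply, add_comm]
      refine hS _ ?_
      by_contra hcon
      exact hx2 ⟨y, hy, hcon⟩
    rw [h2, add_zero, ← nsmul_eq_mul]
    refine Finset.sum_le_card_nsmul _ _ _ fun x _ => (abs_sub _ _).trans ?_
    have := le_abs_self C
    linarith [hC (shift (-x) S), hC (shift (-x) S')]
  have h3 : (bad.card : ℝ) * (2 * |C|) ≤ ε / 2 * (L : ℝ) ^ d := by
    have h4 : ε / (2 * (2 * |C| + 1)) * (2 * |C|) ≤ ε / 2 := by
      rw [div_mul_eq_mul_div, div_le_div_iff₀ (by positivity) (by positivity)]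
      nlinarith [abs_nonneg C]
    calc _ ≤ ε / (2 * (2 * |C| + 1)) * (L : ℝ) ^ d * (2 * |C|) := by gcongr
      _ = ε / (2 * (2 * |C| + 1)) * (2 * |C|) * (L : ℝ) ^ d := by ring
      _ ≤ _ := by gcongr
  have h5 := abs_le.1 (hL S)
  have h6 := abs_le.1 (hL S')
  have h7 := abs_le.1 (h1.trans h3)
  rw [abs_le]
  constructor <;> linarith [h5.1, h5.2, h6.1, h6.2, h7.1, h7.2]

end

/-! ### The torus: comparison with the box, and convexity -/

section

section Boltzmann

variable {X : Type*} [MeasurableSpace X]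

lemma boltzmann_eq_tilted {β : ℝ} {H : X → ℝ} (hH : IsBoundedMeasurable H) (ρ : Measure X)
    [IsProbabilityMeasure ρ] : boltzmann β H ρ = ρ.tilted fun s => -β * H s := by
  have hb := hH.const_mul (-β)
  have hpos := hb.integral_exp_pos ρ
  have h1 : ∫⁻ s, ENNReal.ofReal (Real.exp (-β * H s)) ∂ρ
      = ENNReal.ofReal (∫ s, Real.exp (-β * H s) ∂ρ) :=
    (ofReal_integral_eq_lintegral_ofReal (hb.exp.integrable ρ)
      (ae_of_all _ fun s => (Real.exp_pos _).le)).symm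
  rw [boltzmann, h1, Measure.tilted, ← withDensity_smul _ hb.exp.measurable.ennreal_ofReal]
  congr 1
  funext s
  rw [Pi.smul_apply, smul_eq_mul, ENNReal.ofReal_div_of_pos hpos, ENNReal.div_eq_inv_mul]

/-- The constant cancels against the normalization. This is why the a priori law may be taken to be
a probability measure. -/
lemma boltzmann_smul (β : ℝ) (H : X → ℝ) (ρ : Measure X) {c : ℝ≥0∞} (hc : c ≠ 0) (hc' : c ≠ ∞) :
    boltzmann β H (c • ρ) = boltzmann β H ρ := by
  rw [boltzmann, boltzmann, lintegral_smul_measure, withDensity_smul_measure, smul_smul,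
    smul_eq_mul, ENNReal.mul_inv (Or.inl hc) (Or.inl hc'), mul_right_comm,
    ENNReal.inv_mul_cancel hc hc', one_mul]

end Boltzmann

lemma tendsto_log_integral_exp_congr {X : ℕ → Type*} [∀ n, MeasurableSpace (X n)]
    (ρ : ∀ n, Measure (X n)) [∀ n, IsProbabilityMeasure (ρ n)] {U V : ∀ n, X n → ℝ} {a : ℕ → ℝ}
    (ha : ∀ᶠ n in atTop, 0 < a n)
    (hU : ∀ n, IsBoundedMeasurable (U n)) (hV : ∀ n, IsBoundedMeasurable (V n))
    (h : ∀ ε > 0, ∀ᶠ n in atTop, ∀ x, |U n x - V n x| ≤ ε * a n) {p : ℝ}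
    (hp : Tendsto (fun n => 1 / a n * Real.log (∫ x, Real.exp (V n x) ∂(ρ n))) atTop (𝓝 p)) :
    Tendsto (fun n => 1 / a n * Real.log (∫ x, Real.exp (U n x) ∂(ρ n))) atTop (𝓝 p) := by
  refine tendsto_of_tendsto_of_dist hp (tendsto_iff_norm_sub_tendsto_zero.2 ?_ )
  rw [Metric.tendsto_nhds]
  intro ε hε
  filter_upwards [h (ε / 2) (by positivity), ha] with n hn hn0
  have h1 := abs_log_integral_exp_sub_le (hU n) (hV n) (ρ n) hn
  rw [abs_sub_comm] at h1
  simp only [sub_zero, dist_zero_right, Real.norm_eq_abs, abs_abs, Real.dist_eq]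
  rw [← mul_sub, abs_mul, abs_of_pos (by positivity), one_div, inv_mul_lt_iff₀ hn0]
  nlinarith

variable {d : ℕ} {E : Type*}

lemma measurable_periodicExt [MeasurableSpace E] {L : ℕ} :
    Measurable (periodicExt : (Torus d L → E) → Config d E) :=
  measurable_pi_lambda _ fun _ => measurable_pi_apply _

section Torus

variable {L : ℕ} [NeZero L]

/-- The representative in the box `{1, …, L}^d` of a point of the torus. -/
def torusRep (t : Torus d L) : Site d := fun i => ((t i - 1).val : ℤ) + 1

lemma torusRep_mem_box (t : Torus d L) : torusRep t ∈ box d L := by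
  refine mem_box.2 fun i => ?_
  have := ZMod.val_lt (t i - 1)
  simp only [torusRep]
  constructor <;> omega

lemma cast_torusRep (t : Torus d L) (i : Fin d) : ((torusRep t i : ℤ) : ZMod L) = t i := by
  simp [torusRep]

lemma torusRep_cast {x : Site d} (hx : x ∈ box d L) :
    torusRep (L := L) (fun i => (x i : ZMod L)) = x := by
  funext i
  have h := mem_box.1 hx i
  have h1 : ((x i : ZMod L) - 1) = ((x i - 1 : ℤ) : ZMod L) := by push_cast; rfl
  simp only [torusRep]
  rw [h1, ZMod.val_intCast, Int.emod_eq_of_lt (by linarith [h.1]) (by linarith [h.2])]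
  ring

lemma torusRep_injective : Function.Injective (torusRep : Torus d L → Site d) := fun t t' h =>
  funext fun i => by rw [← cast_torusRep t i, h, cast_torusRep]

lemma periodicExt_comp_torusRep (S : Config d E) {x : Site d} (hx : x ∈ box d L) :
    periodicExt (fun t : Torus d L => S (torusRep t)) x = S x := by
  simp only [periodicExt]; rw [torusRep_cast hx]

lemma sum_torusShift (g : Config d E → ℝ) (S : Torus d L → E) :
    ∑ t : Torus d L, g (periodicExt (torusShift t S))
      = ∑ x ∈ box d L, g (shift (-x) (periodicExt S)) := by
  -- The two shifts have opposite signs, `S (y - t)` on the torus against `S (y + x)` on the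
  -- lattice, so the sum is reindexed by negation before passing to representatives.
  rw [← Equiv.sum_comp (Equiv.neg (Torus d L)) fun t : Torus d L =>
    g (periodicExt (torusShift t S))]
  refine Finset.sum_bij (fun t _ => torusRep t) (fun t _ => torusRep_mem_box t)
    (fun t _ t' _ h => torusRep_injective h)
    (fun x hx => ⟨_, Finset.mem_univ _, torusRep_cast hx⟩) fun t _ => ?_
  congr 1
  funext y
  rw [shift_neg_apply]
  simp only [periodicExt, torusShift, Equiv.neg_apply]
  congr 1
  funext i
  simp [cast_torusRep]

variable [MeasurableSpace E]

/-- The torus spins are realized as the lattice spins at the representatives in the box, so that all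
volumes live under one product measure. -/
lemma integral_torus (μ₀ : Measure E) [IsProbabilityMeasure μ₀] {F : (Torus d L → E) → ℝ}
    (hF : Measurable F) :
    ∫ S, F S ∂(Measure.pi fun _ : Torus d L => μ₀)
      = ∫ S, F (fun t => S (torusRep t)) ∂(freeMeasure d μ₀) := by
  have h := Measure.map_infinitePi_infinitePi_of_inj (P := fun _ : Site d => μ₀)
    (torusRep_injective (d := d) (L := L))
  rw [← Measure.infinitePi_eq_pi, ← h, integral_map
    (measurable_pi_lambda _ fun _ => measurable_pi_apply _).aemeasurable
    hF.aestronglyMeasurable]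

end Torus

variable [MeasurableSpace E] (μ₀ : Measure E) [IsProbabilityMeasure μ₀]

/-- The periodic extension agrees with the original configuration on the box, so it alters an
asymptotically local exponent by o(L^d). Numerator and normalization of the Gibbs expectation are
treated separately, whence the difference of two pressures. -/
lemma tendsto_torusFreeEnergy {V : ℕ → Config d E → ℝ} (hV : IsAsymptoticallyLocal V)
    (hVm : ∀ L, IsBoundedMeasurable (V L)) {g : Config d E → ℝ} (hg : IsBoundedLocal g)
    (β h : ℝ) {p p₀ : ℝ}
    (hp : Tendsto (fun L : ℕ => 1 / (L : ℝ) ^ d * Real.log (∫ S, Real.exp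
      (-β * V L S + h * ∑ x ∈ box d L, g (shift (-x) S)) ∂(freeMeasure d μ₀))) atTop (𝓝 p))
    (hp₀ : Tendsto (fun L : ℕ => 1 / (L : ℝ) ^ d * Real.log (∫ S, Real.exp
      (-β * V L S) ∂(freeMeasure d μ₀))) atTop (𝓝 p₀)) :
    Tendsto (fun n : ℕ => torusFreeEnergy g (torusGibbs
      (fun S : Torus d (n + 1) → E => V (n + 1) (periodicExt S)) β μ₀) h) atTop
      (𝓝 (p - p₀)) := by
  have key : ∀ (W : ℕ → Config d E → ℝ) (_ : IsAsymptoticallyLocal W)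
      (_ : ∀ L, IsBoundedMeasurable (W L)) (q : ℝ), Tendsto (fun L : ℕ => 1 / (L : ℝ) ^ d *
        Real.log (∫ S, Real.exp (W L S) ∂(freeMeasure d μ₀))) atTop (𝓝 q) →
      Tendsto (fun n : ℕ => 1 / ((n + 1 : ℕ) : ℝ) ^ d * Real.log (∫ S, Real.exp
        (W (n + 1) (periodicExt S)) ∂(Measure.pi fun _ : Torus d (n + 1) => μ₀)))
        atTop (𝓝 q) := by
    intro W hW hWm q hq
    have hrep : ∀ n : ℕ, Measurable fun S : Config d E =>
        periodicExt fun t : Torus d (n + 1) => S (torusRep t) := fun n =>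
      measurable_periodicExt.comp (measurable_pi_lambda _ fun _ => measurable_pi_apply _)
    have h1 := tendsto_log_integral_exp_congr (fun _ => freeMeasure d μ₀)
      (U := fun n S => W (n + 1) (periodicExt fun t : Torus d (n + 1) => S (torusRep t)))
      (V := fun n S => W (n + 1) S) (a := fun n => ((n + 1 : ℕ) : ℝ) ^ d)
      (Eventually.of_forall fun n => by positivity)
      (fun n => (hWm (n + 1)).comp (hrep n)) (fun n => hWm _)
      (fun ε hε => ((tendsto_add_atTop_nat 1).eventually (hW.eventually_abs_sub_le hε)).mono
        fun n hn S => hn _ _ fun x hx => periodicExt_comp_torusRep S hx)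
      (hq.comp (tendsto_add_atTop_nat 1))
    refine h1.congr fun n => ?_
    rw [integral_torus μ₀ (F := fun S => Real.exp (W (n + 1) (periodicExt S)))
      ((hWm (n + 1)).exp.measurable.comp measurable_periodicExt)]
  have hX := isBoundedMeasurable_sum_shift (d := d) hg.isBoundedMeasurable
  have h1 := key _ ((hV.const_mul (-β)).add (hg.isAsymptoticallyLocal.const_mul h))
    (fun L => ((hVm L).const_mul _).add ((hX _).const_mul _)) p hp
  have h2 := key _ (hV.const_mul (-β)) (fun L => (hVm L).const_mul _) p₀ hp₀
  refine (h1.sub h2).congr fun n => ?_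
  have hb := (hVm (n + 1)).comp (measurable_periodicExt (d := d) (L := n + 1))
  rw [torusFreeEnergy, torusGibbs, boltzmann_eq_tilted hb, ← mul_sub]
  simp only [sum_torusShift]
  rw [integral_exp_tilted, Real.log_div]
  · rfl
  · have := (((hVm (n + 1)).const_mul (-β)).add ((hX (box d (n + 1))).const_mul h)).comp
      (measurable_periodicExt (d := d) (L := n + 1))
    exact (this.integral_exp_pos _).ne'
  · exact ((hb.const_mul (-β)).integral_exp_pos _).ne'

/-- The logarithm of the exponential moments of a bounded function is convex. -/
lemma convexOn_log_integral_exp {X : Type*} [MeasurableSpace X] (ρ : Measure X)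
    [IsProbabilityMeasure ρ] {U V : X → ℝ} (hU : IsBoundedMeasurable U)
    (hV : IsBoundedMeasurable V) :
    ConvexOn ℝ Set.univ fun h : ℝ => Real.log (∫ x, Real.exp (U x + h * V x) ∂ρ) := by
  have hm : ∀ h : ℝ, IsBoundedMeasurable fun x => U x + h * V x := fun h => hU.add (hV.const_mul h)
  refine ⟨convex_univ, fun x _ y _ a b ha hb hab => ?_⟩
  simp only [smul_eq_mul]
  rcases ha.eq_or_lt with rfl | ha
  · have : b = 1 := by linarith
    subst this; simp
  rcases hb.eq_or_lt with rfl | hb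
  · have : a = 1 := by linarith
    subst this; simp
  have hpq : (1 / a).HolderConjugate (1 / b) := by
    rw [Real.holderConjugate_iff]
    refine ⟨?_, by simpa using hab⟩
    rw [lt_div_iff₀ ha]; linarith
  have hpos := fun h => (hm h).integral_exp_pos ρ
  have hmem : ∀ (h c q : ℝ), MemLp (fun s => Real.exp (c * (U s + h * V s))) (ENNReal.ofReal q) ρ :=
    fun h c q => by
      obtain ⟨C, hC⟩ := ((hm h).const_mul c).exp.bounded
      exact MemLp.of_bound ((hm h).const_mul c).exp.measurable.aestronglyMeasurable C
        (ae_of_all _ hC)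
  have hH := integral_mul_le_Lp_mul_Lq_of_nonneg hpq
    (μ := ρ) (f := fun s => Real.exp (a * (U s + x * V s)))
    (g := fun s => Real.exp (b * (U s + y * V s)))
    (ae_of_all _ fun s => (Real.exp_pos _).le) (ae_of_all _ fun s => (Real.exp_pos _).le)
    (hmem x a _) (hmem y b _)
  have h1 : ∀ s, Real.exp (a * (U s + x * V s)) * Real.exp (b * (U s + y * V s))
      = Real.exp (U s + (a * x + b * y) * V s) := by
    intro s
    rw [← Real.exp_add]; congr 1
    linear_combination U s * hab
  have h2 : ∀ (c h : ℝ) (_ : 0 < c) (s), Real.exp (c * (U s + h * V s)) ^ (1 / c)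
      = Real.exp (U s + h * V s) := by
    intro c h hc s
    rw [← Real.exp_mul]; congr 1; field_simp
  simp only [h1, h2 a _ ha, h2 b _ hb, one_div_one_div] at hH
  have h3 := Real.log_le_log (hpos _) hH
  rwa [Real.log_mul (Real.rpow_pos_of_pos (hpos _) _).ne' (Real.rpow_pos_of_pos (hpos _) _).ne',
    Real.log_rpow (hpos _), Real.log_rpow (hpos _)] at h3

lemma convexOn_of_tendsto {F : ℕ → ℝ → ℝ} {f : ℝ → ℝ} (hF : ∀ n, ConvexOn ℝ Set.univ (F n))
    (h : ∀ x, Tendsto (fun n => F n x) atTop (𝓝 (f x))) : ConvexOn ℝ Set.univ f :=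
  ⟨convex_univ, fun x _ y _ a b ha hb hab => le_of_tendsto_of_tendsto' (h _)
    (((h x).const_mul a).add ((h y).const_mul b)) fun n =>
      (hF n).2 (Set.mem_univ x) (Set.mem_univ y) ha hb hab⟩

end

/-! ### Conditional averages and the resampling kernel -/

section

/-- The ratio of tilted averages depends continuously on the exponent, uniformly. -/
lemma abs_integral_div_sub_le {X : Type*} [MeasurableSpace X] (ρ : Measure X)
    [IsProbabilityMeasure ρ] {F V V' : X → ℝ} {C δ : ℝ} (hF : IsBoundedMeasurable F)
    (hFC : ∀ x, |F x| ≤ C) (hV : IsBoundedMeasurable V) (hV' : IsBoundedMeasurable V')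
    (h : ∀ x, |V x - V' x| ≤ δ) :
    |(∫ x, F x * Real.exp (V x) ∂ρ) / (∫ x, Real.exp (V x) ∂ρ)
      - (∫ x, F x * Real.exp (V' x) ∂ρ) / (∫ x, Real.exp (V' x) ∂ρ)|
      ≤ 2 * C * (Real.exp δ - 1) * Real.exp δ := by
  obtain ⟨x₀⟩ := nonempty_of_isProbabilityMeasure ρ
  have hC : 0 ≤ C := (abs_nonneg _).trans (hFC x₀)
  have hδ : 0 ≤ δ := (abs_nonneg _).trans (h x₀)
  have hb := hV.integral_exp_pos ρ
  have hb' := hV'.integral_exp_pos ρ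
  set a := ∫ x, F x * Real.exp (V x) ∂ρ
  set b := ∫ x, Real.exp (V x) ∂ρ
  set a' := ∫ x, F x * Real.exp (V' x) ∂ρ
  set b' := ∫ x, Real.exp (V' x) ∂ρ
  have hexp : ∀ x, |Real.exp (V x) - Real.exp (V' x)| ≤ (Real.exp δ - 1) * Real.exp (V' x) := by
    intro x
    have h1 := abs_le.1 (h x)
    have h2 : Real.exp (V x) ≤ Real.exp δ * Real.exp (V' x) := by
      rw [← Real.exp_add]; exact Real.exp_le_exp.2 (by linarith [h1.2])
    have h3 : Real.exp (V' x) ≤ Real.exp δ * Real.exp (V x) := by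
      rw [← Real.exp_add]; exact Real.exp_le_exp.2 (by linarith [h1.1])
    have h4 : 1 ≤ Real.exp δ := Real.one_le_exp hδ
    -- This is 2 - e^δ ≤ e^{-δ}, a form of (e^δ - 1)² ≥ 0. It puts the lower error in the same form
    -- as the upper one.
    have h5 : (2 - Real.exp δ) * Real.exp (V' x) ≤ Real.exp (V x) := by
      by_contra hcon
      push Not at hcon
      have h6 := mul_lt_mul_of_pos_left hcon (Real.exp_pos δ)
      nlinarith [Real.exp_pos (V' x), mul_nonneg (sq_nonneg (Real.exp δ - 1)) (Real.exp_pos (V' x)).le]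
    rw [abs_le]
    constructor <;> nlinarith
  have hbb : |b - b'| ≤ (Real.exp δ - 1) * b' := by
    rw [← integral_sub (hV.exp.integrable ρ) (hV'.exp.integrable ρ), ← integral_const_mul]
    exact abs_integral_le_integral_abs.trans (integral_mono
      ((hV.exp.sub hV'.exp).integrable ρ).abs ((hV'.exp.integrable ρ).const_mul _) hexp)
  have haa : |a - a'| ≤ C * ((Real.exp δ - 1) * b') := by
    rw [← integral_sub ((hF.mul hV.exp).integrable ρ) ((hF.mul hV'.exp).integrable ρ),
      ← integral_const_mul, ← integral_const_mul]
    refine abs_integral_le_integral_abs.trans (integral_mono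
      (((hF.mul hV.exp).sub (hF.mul hV'.exp)).integrable ρ).abs
      (((hV'.exp.integrable ρ).const_mul _).const_mul _) fun x => ?_)
    simp only
    rw [← mul_sub, abs_mul]
    exact mul_le_mul (hFC x) (hexp x) (abs_nonneg _) hC
  have ha' : |a'| ≤ C * b' := by
    rw [← integral_const_mul]
    refine abs_integral_le_integral_abs.trans (integral_mono
      ((hF.mul hV'.exp).integrable ρ).abs ((hV'.exp.integrable ρ).const_mul _) fun x => ?_)
    simp only
    rw [abs_mul, Real.abs_exp]
    exact mul_le_mul_of_nonneg_right (hFC x) (Real.exp_pos _).le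
  have hb'b : b' ≤ Real.exp δ * b :=
    integral_exp_le_of_le_add hV' hV ρ fun x => by linarith [(abs_le.1 (h x)).1]
  -- Each of the two terms of this numerator is at most C (e^δ - 1) b'. With b' ≤ e^δ b this gives
  -- the stated constant.
  have key : a / b - a' / b' = ((a - a') + (a' / b') * (b' - b)) / b := by
    field_simp; ring
  rw [key, abs_div, abs_of_pos hb, div_le_iff₀ hb]
  have h7 : |a' / b'| ≤ C := by
    rw [abs_div, abs_of_pos hb', div_le_iff₀ hb']; exact ha'
  have h1 : 0 ≤ Real.exp δ - 1 := by linarith [Real.one_le_exp hδ]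
  calc |(a - a') + (a' / b') * (b' - b)| ≤ |a - a'| + |a' / b'| * |b' - b| := by
        rw [← abs_mul]; exact abs_add_le _ _
    _ ≤ C * ((Real.exp δ - 1) * b') + C * ((Real.exp δ - 1) * b') := by
        rw [abs_sub_comm b' b]
        exact add_le_add haa (mul_le_mul h7 hbb (abs_nonneg _) hC)
    _ = 2 * C * (Real.exp δ - 1) * b' := by ring
    _ ≤ 2 * C * (Real.exp δ - 1) * (Real.exp δ * b) := by gcongr
    _ = _ := by ring

variable {d : ℕ} {E : Type*}

lemma glue_congr {Λ : Finset (Site d)} (T : Λ → E) {S S' : Config d E}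
    (h : ∀ x ∈ ((Λ : Set (Site d))ᶜ), S x = S' x) : glue Λ T S = glue Λ T S' := by
  funext x
  by_cases hx : x ∈ Λ
  · rw [glue_of_mem hx, glue_of_mem hx]
  · rw [glue_of_notMem hx, glue_of_notMem hx]; exact h x (by simpa using hx)

variable [MeasurableSpace E]

/-- The average of `F` over the spins in `Λ`, distributed with density proportional to `exp V`
given the spins in the complement of `Λ`. -/
noncomputable def condAvg (μ₀ : Measure E) (V : Config d E → ℝ) (Λ : Finset (Site d))
    (F : Config d E → ℝ) (S : Config d E) : ℝ :=
  (∫ T, F (glue Λ T S) * Real.exp (V (glue Λ T S)) ∂(Measure.pi fun _ : Λ => μ₀))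
    / ∫ T, Real.exp (V (glue Λ T S)) ∂(Measure.pi fun _ : Λ => μ₀)

section

variable (μ₀ : Measure E) {V F G : Config d E → ℝ} {Λ : Finset (Site d)}

lemma dependsOn_condAvg : DependsOn (condAvg μ₀ V Λ F) ((Λ : Set (Site d))ᶜ) := by
  intro S S' h
  simp only [condAvg, glue_congr _ h]

lemma condAvg_mul_of_dependsOn (hG : DependsOn G ((Λ : Set (Site d))ᶜ)) (S : Config d E) :
    condAvg μ₀ V Λ (fun S => G S * F S) S = G S * condAvg μ₀ V Λ F S := by
  simp only [condAvg, apply_glue_of_dependsOn hG, mul_assoc, integral_const_mul, mul_div_assoc]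

lemma condAvg_add_of_dependsOn {R : Config d E → ℝ} (hR : DependsOn R ((Λ : Set (Site d))ᶜ))
    (S : Config d E) : condAvg μ₀ (fun S => V S + R S) Λ F S = condAvg μ₀ V Λ F S := by
  simp only [condAvg, apply_glue_of_dependsOn hR, Real.exp_add, ← mul_assoc, integral_mul_const]
  exact mul_div_mul_right _ _ (Real.exp_pos _).ne'

lemma condAvg_indicator_eq {B : Set (Config d E)}
    (hB : MeasurableSet B) (S : Config d E) :
    condAvg μ₀ V Λ (B.indicator fun _ => 1) S
      = ((Measure.pi fun _ : Λ => μ₀).tilted fun T => V (glue Λ T S)).real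
          {T | glue Λ T S ∈ B} := by
  have hg := measurable_glue_left Λ S
  have hm : MeasurableSet {T : Λ → E | glue Λ T S ∈ B} := hg hB
  rw [← integral_indicator_one hm, integral_tilted, condAvg, ← integral_div]
  congr 1
  funext T
  by_cases h : glue Λ T S ∈ B <;> simp [h, Set.indicator]

variable [IsProbabilityMeasure μ₀]

lemma abs_condAvg_le (hF : IsBoundedMeasurable F) (hV : IsBoundedMeasurable V) {C : ℝ}
    (hC : ∀ S, |F S| ≤ C) (S : Config d E) : |condAvg μ₀ V Λ F S| ≤ C := by
  have hF' := hF.comp (measurable_glue_left Λ S)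
  have hV' := hV.comp (measurable_glue_left Λ S)
  have hpos := hV'.integral_exp_pos (Measure.pi fun _ : Λ => μ₀)
  rw [condAvg, abs_div, abs_of_pos hpos, div_le_iff₀ hpos, ← integral_const_mul]
  refine abs_integral_le_integral_abs.trans (integral_mono
    ((hF'.mul hV'.exp).integrable _).abs ((hV'.exp.integrable _).const_mul _) fun x => ?_)
  simp only
  rw [abs_mul, Real.abs_exp]
  exact mul_le_mul_of_nonneg_right (hC _) (Real.exp_pos _).le

lemma IsBoundedMeasurable.condAvg (hF : IsBoundedMeasurable F) (hV : IsBoundedMeasurable V) :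
    IsBoundedMeasurable (condAvg μ₀ V Λ F) := by
  obtain ⟨C, hC⟩ := hF.bounded
  refine ⟨?_, C, fun S => abs_condAvg_le μ₀ hF hV hC S⟩
  have hg := measurable_glue (d := d) (E := E) Λ
  have h : ∀ {K : Config d E → ℝ}, IsBoundedMeasurable K →
      Measurable fun S => ∫ T, K (glue Λ T S) ∂(Measure.pi fun _ : Λ => μ₀) := fun hK =>
    (StronglyMeasurable.integral_prod_left' (hK.comp hg).measurable.stronglyMeasurable).measurable
  exact (h (hF.mul hV.exp)).div (h hV.exp)

/-- The constant `a` may depend on the outer configuration, since it cancels in the normalization.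
Only the variation of the exponents with the spins in `Λ` matters. -/
lemma condAvg_congr_exponent {V' : Config d E → ℝ} (hF : IsBoundedMeasurable F) {C δ : ℝ}
    (hFC : ∀ S, |F S| ≤ C) (hV : IsBoundedMeasurable V) (hV' : IsBoundedMeasurable V')
    {S : Config d E} {a : ℝ} (h : ∀ T : Λ → E, |V (glue Λ T S) - (V' (glue Λ T S) + a)| ≤ δ) :
    |condAvg μ₀ V Λ F S - condAvg μ₀ V' Λ F S| ≤ 2 * C * (Real.exp δ - 1) * Real.exp δ := by
  have hg := measurable_glue_left Λ S
  have h1 := abs_integral_div_sub_le (Measure.pi fun _ : Λ => μ₀) (hF.comp hg)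
    (fun T => hFC (glue Λ T S)) (hV.comp hg) ((hV'.comp hg).add (isBoundedMeasurable_const a)) h
  have h2 := condAvg_add_of_dependsOn μ₀ (V := V') (F := F) (Λ := Λ) (R := fun _ => a)
    (fun _ _ _ => rfl) S
  rw [← h2]
  exact h1

/-- Resampling the spins in `Λ`, as a Markov kernel. -/
noncomputable def condKernelOf (μ₀ : Measure E) [IsProbabilityMeasure μ₀] {V : Config d E → ℝ}
    (hV : IsBoundedMeasurable V) (Λ : Finset (Site d)) : Kernel (Config d E) (Config d E) where
  toFun S := ((Measure.pi fun _ : Λ => μ₀).tilted fun T => V (glue Λ T S)).map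
    fun T => glue Λ T S
  measurable' := by
    refine Measure.measurable_of_measurable_coe _ fun B hB => ?_
    have h : ∀ S, (((Measure.pi fun _ : Λ => μ₀).tilted fun T => V (glue Λ T S)).map
        fun T => glue Λ T S) B = ENNReal.ofReal (condAvg μ₀ V Λ (B.indicator fun _ => 1) S) := by
      intro S
      have := isProbabilityMeasure_tilted
        ((hV.comp (measurable_glue_left Λ S)).exp.integrable (Measure.pi fun _ : Λ => μ₀))
      rw [condAvg_indicator_eq μ₀ hB, Measure.map_apply (measurable_glue_left Λ S) hB,
        ofReal_measureReal]
      rfl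
    simp only [h]
    exact ((isBoundedMeasurable_indicator hB).condAvg μ₀ hV).measurable.ennreal_ofReal

instance (hV : IsBoundedMeasurable V) : IsMarkovKernel (condKernelOf μ₀ hV Λ) := ⟨fun S => by
  have := isProbabilityMeasure_tilted
    ((hV.comp (measurable_glue_left Λ S)).exp.integrable (Measure.pi fun _ : Λ => μ₀))
  exact Measure.isProbabilityMeasure_map (measurable_glue_left Λ S).aemeasurable⟩

lemma integral_condKernelOf (hV : IsBoundedMeasurable V) (hF : IsBoundedMeasurable F)
    (S : Config d E) : ∫ S', F S' ∂(condKernelOf μ₀ hV Λ S) = condAvg μ₀ V Λ F S := by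
  have h : condKernelOf μ₀ hV Λ S = ((Measure.pi fun _ : Λ => μ₀).tilted fun T =>
    V (glue Λ T S)).map fun T => glue Λ T S := rfl
  rw [h, integral_map (measurable_glue_left Λ S).aemeasurable
    hF.measurable.aestronglyMeasurable, integral_tilted, condAvg, ← integral_div]
  congr 1
  funext T
  rw [smul_eq_mul]; ring

/-- Invariance under resampling may be checked on a generating `π`-system. -/
lemma integral_condAvg_eq_of_isPiSystem (hV : IsBoundedMeasurable V) (μ : Measure (Config d E))
    [IsProbabilityMeasure μ] {𝒞 : Set (Set (Config d E))} (h𝒞 : IsPiSystem 𝒞)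
    (hgen : MeasurableSpace.pi = MeasurableSpace.generateFrom 𝒞)
    (h : ∀ B ∈ 𝒞, ∫ S, condAvg μ₀ V Λ (B.indicator fun _ => 1) S ∂μ = μ.real B)
    (hF : IsBoundedMeasurable F) : ∫ S, condAvg μ₀ V Λ F S ∂μ = ∫ S, F S ∂μ := by
  have hbind : (condKernelOf μ₀ hV Λ) ∘ₘ μ = μ := by
    refine ext_of_generate_finite 𝒞 hgen h𝒞 (fun B hB => ?_) (by simp)
    have hBm : MeasurableSet B := by
      rw [hgen]; exact MeasurableSpace.measurableSet_generateFrom hB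
    have h1 := (isBoundedMeasurable_indicator hBm).condAvg μ₀ hV (Λ := Λ)
    have h0 : ∀ S, 0 ≤ condAvg μ₀ V Λ (B.indicator fun _ => 1) S := fun S => by
      rw [condAvg_indicator_eq μ₀ hBm]; exact measureReal_nonneg
    rw [Measure.bind_apply hBm (Kernel.aemeasurable _), ← ofReal_measureReal (μ := μ), ← h B hB,
      ofReal_integral_eq_lintegral_ofReal (h1.integrable μ) (ae_of_all _ h0)]
    refine lintegral_congr fun S => ?_
    rw [← ofReal_measureReal, ← integral_indicator_one hBm, ← integral_condKernelOf μ₀ hV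
      (isBoundedMeasurable_indicator hBm)]
    rfl
  conv_rhs => rw [← hbind]
  have hint := Kernel.integral_comp (η := condKernelOf μ₀ hV Λ) (κ := Kernel.const Unit μ)
    (a := ()) (hF.integrable _)
  rw [Kernel.comp_apply, Kernel.const_apply] at hint
  rw [hint]
  exact integral_congr_ae (ae_of_all _ fun S => (integral_condKernelOf μ₀ hV hF S).symm)

/-- Tilted product measures have the tilted conditional distributions. -/
lemma integral_tilted_condAvg (hV : IsBoundedMeasurable V) (hF : IsBoundedMeasurable F) :
    ∫ S, condAvg μ₀ V Λ F S ∂((freeMeasure d μ₀).tilted V)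
      = ∫ S, F S ∂((freeMeasure d μ₀).tilted V) := by
  have h : ∀ {K : Config d E → ℝ}, ∫ S, K S ∂((freeMeasure d μ₀).tilted V)
      = (∫ S, K S * Real.exp (V S) ∂(freeMeasure d μ₀))
        / ∫ S, Real.exp (V S) ∂(freeMeasure d μ₀) := by
    intro K
    rw [integral_tilted, ← integral_div]
    congr 1
    funext S
    rw [smul_eq_mul]; ring
  rw [h, h]
  congr 1
  -- After redrawing the spins in `Λ`, the conditional average is constant in them and its
  -- denominator cancels the remaining integral of `exp V`.
  rw [integral_freeMeasure_glue μ₀ Λ ((hF.condAvg μ₀ hV).mul hV.exp),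
    integral_freeMeasure_glue μ₀ Λ (hF.mul hV.exp)]
  congr 1
  funext S
  simp only [apply_glue_of_dependsOn (dependsOn_condAvg μ₀), integral_const_mul]
  rw [condAvg]
  exact div_mul_cancel₀ _ ((hV.comp (measurable_glue_left Λ S)).integral_exp_pos _).ne'

end

end

/-! ### The DLR condition as invariance under resampling -/

section

variable {d : ℕ} {E : Type*} [MeasurableSpace E]

/-- The sets that do not separate `S` from `S'` form a σ-algebra, and it contains the generators of
the cylinder events over `Δ`. -/
lemma mem_iff_of_measurableSet_cylinderEvents {Δ : Set (Site d)} {C : Set (Config d E)}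
    (hC : MeasurableSet[cylinderEvents Δ] C) {S S' : Config d E} (h : ∀ x ∈ Δ, S x = S' x) :
    S ∈ C ↔ S' ∈ C := by
  let m : MeasurableSpace (Config d E) :=
    { MeasurableSet' := fun C => S ∈ C ↔ S' ∈ C
      measurableSet_empty := by simp
      measurableSet_compl := fun C hC => not_congr hC
      measurableSet_iUnion := fun f hf => by simp [hf] }
  have hle : cylinderEvents Δ ≤ m := by
    refine iSup₂_le fun x hx => ?_
    rintro _ ⟨t, -, rfl⟩
    change S x ∈ t ↔ S' x ∈ t
    rw [h x hx]
  exact hle C hC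

lemma dependsOn_indicator_of_cylinderEvents {Δ : Set (Site d)} {C : Set (Config d E)}
    (hC : MeasurableSet[cylinderEvents Δ] C) :
    DependsOn (C.indicator fun _ => (1 : ℝ)) Δ := by
  intro S S' h
  have := mem_iff_of_measurableSet_cylinderEvents hC h
  by_cases hS : S ∈ C
  · rw [Set.indicator_of_mem hS, Set.indicator_of_mem (this.1 hS)]
  · rw [Set.indicator_of_notMem hS, Set.indicator_of_notMem (mt this.2 hS)]

/-- Freezing the spins in `Λ` at an arbitrary value does not change `F` and factors it through the
outer spins. This supplies the measurability needed to recognize a conditional expectation. -/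
lemma measurable_cylinderEvents_of_dependsOn [Nonempty E] {Λ : Finset (Site d)}
    {F : Config d E → ℝ} (hF : Measurable F) (hFΛ : DependsOn F ((Λ : Set (Site d))ᶜ)) :
    Measurable[cylinderEvents ((Λ : Set (Site d))ᶜ)] F := by
  have T : Λ → E := fun _ => Classical.arbitrary E
  have hglue : @Measurable _ _ (cylinderEvents ((Λ : Set (Site d))ᶜ)) MeasurableSpace.pi
      (fun S : Config d E => glue Λ T S) := by
    refine @measurable_pi_lambda _ _ _ (cylinderEvents ((Λ : Set (Site d))ᶜ)) _ _ fun x => ?_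
    by_cases hx : x ∈ Λ
    · simp only [glue_of_mem hx]; exact measurable_const
    · simp only [glue_of_notMem hx]
      exact measurable_cylinderEvent_apply (by simpa using hx)
  have h : F = F ∘ fun S : Config d E => glue Λ T S := by
    funext S; exact (apply_glue_of_dependsOn hFΛ T S).symm
  rw [h]
  exact hF.comp hglue

variable {Φ : Finset (Site d) → Config d E → ℝ}

lemma IsInteraction.isBoundedMeasurable_hamiltonian (hΦ : IsInteraction Φ)
    (Λ : Finset (Site d)) : IsBoundedMeasurable (hamiltonian Φ Λ) :=
  ⟨hΦ.measurable_hamiltonian Λ, hΦ.exists_abs_hamiltonian_le Λ⟩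

lemma IsInteraction.isBoundedMeasurable_exponent (hΦ : IsInteraction Φ) (β : ℝ)
    (Λ : Finset (Site d)) : IsBoundedMeasurable fun S => -β * hamiltonian Φ Λ S :=
  (hΦ.isBoundedMeasurable_hamiltonian Λ).const_mul _

variable {β : ℝ} {μ₀ : Measure E} [IsProbabilityMeasure μ₀]

lemma finiteGibbs_real (hΦ : IsInteraction Φ) (Λ : Finset (Site d)) {B : Set (Λ → E)}
    (hB : MeasurableSet B) (S : Config d E) :
    (finiteGibbs Φ β μ₀ Λ S).real B = condAvg μ₀ (fun S => -β * hamiltonian Φ Λ S) Λ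
      (((fun (S : Config d E) (x : Λ) => S x) ⁻¹' B).indicator fun _ => 1) S := by
  have hm : Measurable fun (S : Config d E) (x : Λ) => S x := by fun_prop
  rw [condAvg_indicator_eq μ₀ (hm hB), finiteGibbs, boltzmann_eq_tilted
    ((hΦ.isBoundedMeasurable_hamiltonian Λ).comp (measurable_glue_left Λ S))]
  congr 1
  ext T
  have : (fun x : Λ => glue Λ T S x) = T := funext fun x => glue_of_mem x.2
  simp [this]

lemma integral_indicator_one_mul {X : Type*} [MeasurableSpace X] (μ : Measure X) {C : Set X}
    (hC : MeasurableSet C) (F : X → ℝ) :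
    ∫ x, C.indicator (fun _ => 1) x * F x ∂μ = ∫ x in C, F x ∂μ := by
  rw [← integral_indicator hC]
  congr 1
  funext x
  by_cases h : x ∈ C <;> simp [h]

lemma integral_indicator_one_real {X : Type*} [MeasurableSpace X] (μ : Measure X) {C : Set X}
    (hC : MeasurableSet C) : ∫ x, C.indicator (fun _ => (1 : ℝ)) x ∂μ = μ.real C :=
  integral_indicator_one hC

/-- Gibbs measures are invariant under resampling. -/
theorem IsGibbs.integral_condAvg (hΦ : IsInteraction Φ) {μ : Measure (Config d E)}
    (hμ : IsGibbs Φ β μ₀ μ) (Λ : Finset (Site d)) {F : Config d E → ℝ}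
    (hF : IsBoundedMeasurable F) :
    ∫ S, condAvg μ₀ (fun S => -β * hamiltonian Φ Λ S) Λ F S ∂μ = ∫ S, F S ∂μ := by
  classical
  have := hμ.isProbability
  refine integral_condAvg_eq_of_isPiSystem μ₀ (hΦ.isBoundedMeasurable_exponent β Λ) μ
    (isPiSystem_squareCylinders (fun _ => MeasurableSpace.isPiSystem_measurableSet)
      fun _ => MeasurableSet.univ) generateFrom_squareCylinders.symm ?_ hF
  rintro _ ⟨s, t, ht, rfl⟩
  have ht : ∀ x, MeasurableSet (t x) := fun x => ht x (Set.mem_univ x)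
  -- A rectangle splits into a condition `B` on the spins in `Λ` and a condition `C` outside. The
  -- factor of `C` passes through the conditional average, and DLR is then the defining identity of
  -- the conditional expectation on `C`.
  set B : Set (Λ → E) := Set.univ.pi fun x : Λ => if (x : Site d) ∈ s then t x else Set.univ
  set C : Set (Config d E) := Set.pi ((s \ Λ : Finset (Site d)) : Set (Site d)) t
  have hB : MeasurableSet B := MeasurableSet.univ_pi fun x => by
    split_ifs
    · exact ht x
    · exact MeasurableSet.univ
  have hC : MeasurableSet[cylinderEvents ((Λ : Set (Site d))ᶜ)] C := by
    have : C = ⋂ x ∈ (s \ Λ : Finset (Site d)), (fun S : Config d E => S x) ⁻¹' t x := by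
      ext S; simp [C, Set.mem_pi]
    rw [this]
    refine Finset.measurableSet_biInter _ fun x hx => ?_
    exact measurable_cylinderEvent_apply (by simpa using (Finset.mem_sdiff.1 hx).2) (ht x)
  have hm : (cylinderEvents ((Λ : Set (Site d))ᶜ) : MeasurableSpace (Config d E))
      ≤ MeasurableSpace.pi := cylinderEvents_le_pi
  set A : Set (Config d E) := (fun (S : Config d E) (x : Λ) => S x) ⁻¹' B
  have hA : MeasurableSet A := (by fun_prop : Measurable fun (S : Config d E) (x : Λ) => S x) hB
  have hsplit : (s : Set (Site d)).pi t = C ∩ A := by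
    ext S
    simp only [C, A, B, Set.mem_pi, Set.mem_inter_iff, Finset.mem_coe, Finset.mem_sdiff,
      Set.mem_preimage, Set.mem_univ, true_imp_iff, Subtype.forall]
    constructor
    · intro h
      refine ⟨fun x hx => h x hx.1, fun x hx => ?_⟩
      split_ifs with hs
      · exact h x hs
      · trivial
    · rintro ⟨h1, h2⟩ x hx
      by_cases hΛ : x ∈ Λ
      · simpa [hx] using h2 x hΛ
      · exact h1 x ⟨hx, hΛ⟩
  have hmul : ((s : Set (Site d)).pi t).indicator (fun _ => (1 : ℝ))
      = fun S => C.indicator (fun _ => 1) S * A.indicator (fun _ => 1) S := by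
    rw [hsplit]; funext S
    by_cases h1 : S ∈ C <;> by_cases h2 : S ∈ A <;> simp [h1, h2]
  have hCond := setIntegral_condExp hm (μ := μ) (f := A.indicator fun _ => (1 : ℝ))
    ((isBoundedMeasurable_indicator hA).integrable μ) hC
  rw [setIntegral_congr_ae (hm _ hC) ((hμ.dlr Λ B hB).mono fun S hS _ => hS),
    setIntegral_indicator hA] at hCond
  rw [hmul]
  simp only [condAvg_mul_of_dependsOn μ₀ (dependsOn_indicator_of_cylinderEvents hC)]
  rw [integral_indicator_one_mul μ (hm _ hC)]
  simp only [finiteGibbs_real hΦ Λ hB] at hCond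
  rw [hCond, hsplit]
  simp

/-- Measures that are invariant under resampling are Gibbs measures. -/
theorem isGibbs_of_integral_condAvg (hΦ : IsInteraction Φ) {μ : Measure (Config d E)}
    [IsProbabilityMeasure μ]
    (h : ∀ (Λ : Finset (Site d)), ∀ B ∈ measurableCylinders fun _ : Site d => E,
      ∫ S, condAvg μ₀ (fun S => -β * hamiltonian Φ Λ S) Λ (B.indicator fun _ => 1) S ∂μ
        = μ.real B) : IsGibbs Φ β μ₀ μ := by
  refine ⟨inferInstance, fun Λ B hB => ?_⟩
  have : Nonempty E := nonempty_of_isProbabilityMeasure μ₀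
  have hm : (cylinderEvents ((Λ : Set (Site d))ᶜ) : MeasurableSpace (Config d E))
      ≤ MeasurableSpace.pi := cylinderEvents_le_pi
  have hA := (by fun_prop : Measurable fun (S : Config d E) (x : Λ) => S x) hB
  have hV := hΦ.isBoundedMeasurable_exponent β Λ
  have hcond := (isBoundedMeasurable_indicator hA).condAvg μ₀ hV (Λ := Λ)
  have hfun : (fun S => (finiteGibbs Φ β μ₀ Λ S).real B) = condAvg μ₀
      (fun S => -β * hamiltonian Φ Λ S) Λ
      (((fun (S : Config d E) (x : Λ) => S x) ⁻¹' B).indicator fun _ => 1) :=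
    funext fun S => finiteGibbs_real hΦ Λ hB S
  rw [hfun]
  -- The set integral over an outer event `C` is resampling invariance for the product of the
  -- indicators of `C` and of the event in `Λ`. That product need not be a cylinder function, hence
  -- the extension from the π-system of cylinders.
  refine (ae_eq_condExp_of_forall_setIntegral_eq hm
    ((isBoundedMeasurable_indicator hA).integrable μ) (fun s _ _ => (hcond.integrable μ).integrableOn)
    (fun C hC _ => ?_) ?_).symm
  · rw [← integral_indicator_one_mul μ (hm _ hC), ← integral_indicator_one_mul μ (hm _ hC)]
    simp only [← condAvg_mul_of_dependsOn μ₀ (dependsOn_indicator_of_cylinderEvents hC)]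
    exact integral_condAvg_eq_of_isPiSystem μ₀ hV μ isPiSystem_measurableCylinders
      generateFrom_measurableCylinders.symm (h Λ)
      ((isBoundedMeasurable_indicator (hm _ hC)).mul (isBoundedMeasurable_indicator hA))
  · exact (measurable_cylinderEvents_of_dependsOn hcond.measurable
      (dependsOn_condAvg μ₀)).stronglyMeasurable.aestronglyMeasurable

end

/-! ### Limits of Gibbs measures without compactness of the spin space -/

section

section Extension

variable {ι E : Type*} [TopologicalSpace E] [PolishSpace E] [MeasurableSpace E] [BorelSpace E]

/-- A finitely additive set function on cylinders whose finite-dimensional marginals are dominated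
by finite measures is continuous at the empty set. -/
lemma addContent_tendsto_zero (m : AddContent ℝ≥0∞ (measurableCylinders fun _ : ι => E))
    (hm : ∀ J : Finset ι, ∃ ρ : Measure (J → E), IsFiniteMeasure ρ ∧
      ∀ B, MeasurableSet B → m (cylinder J B) ≤ ρ B)
    {A : ℕ → Set (ι → E)} (hA : ∀ n, A n ∈ measurableCylinders fun _ : ι => E)
    (hanti : Antitone A) (hempty : ⋂ n, A n = ∅) :
    Tendsto (fun n => m (A n)) atTop (𝓝 0) := by
  have hring : IsSetRing (measurableCylinders fun _ : ι => E) := isSetRing_measurableCylinders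
  have hmono : Antitone fun n => m (A n) := fun n k h =>
    addContent_mono hring.isSetSemiring (hA k) (hA n) (hanti h)
  have hlim := tendsto_atTop_iInf hmono
  by_contra hcon
  set ε := ⨅ n, m (A n)
  have hε : ε ≠ 0 := fun h => hcon (h ▸ hlim)
  have hle : ∀ n, ε ≤ m (A n) := fun n => iInf_le _ n
  choose J B hB hAB using fun n => (mem_measurableCylinders _).1 (hA n)
  choose ρ hρ hmρ using hm
  obtain ⟨ε', hε', hsum⟩ := ENNReal.exists_pos_sum_of_countable' hε ℕ
  -- Inner regularity of the dominating measures gives compact bases losing in total less than ε,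
  -- the supposed lower bound of the contents.
  have hK : ∀ n, ∃ K ⊆ B n, IsCompact K ∧ ρ (J n) (B n \ K) < ε' n := fun n => by
    have := hρ (J n)
    exact (hB n).exists_isCompact_sdiff_lt (measure_ne_top _ _) (hε' n).ne'
  choose K hKB hKc hKε using hK
  have hKm : ∀ n, MeasurableSet (K n) := fun n => (hKc n).measurableSet
  -- Otherwise `A n` would be covered by the discarded pieces, whose total content is below ε.
  have hpt : ∀ n, ∃ x : ι → E, ∀ k ≤ n, (J k).restrict x ∈ K k := by
    intro n
    by_contra hno
    push Not at hno
    have hcyl : ∀ k, cylinder (J k) (B k \ K k) ∈ measurableCylinders fun _ : ι => E := fun k =>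
      cylinder_mem_measurableCylinders _ _ ((hB k).diff (hKm k))
    have hU : ⋃ k ∈ Finset.range (n + 1), cylinder (J k) (B k \ K k)
        ∈ measurableCylinders fun _ : ι => E :=
      hring.biUnion_mem _ fun k _ => hcyl k
    have hsub : A n ⊆ ⋃ k ∈ Finset.range (n + 1), cylinder (J k) (B k \ K k) := by
      intro x hx
      obtain ⟨k, hk, hxk⟩ := hno x
      refine Set.mem_biUnion (Finset.mem_coe.2 (Finset.mem_range.2 (Nat.lt_succ_of_le hk))) ?_
      have h2 := hanti hk hx
      rw [hAB k] at h2
      exact ⟨h2, hxk⟩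
    have h3 : m (A n) ≤ ∑ k ∈ Finset.range (n + 1), ε' k :=
      (addContent_mono hring.isSetSemiring (hA n) hU hsub).trans
        ((addContent_biUnion_le hring fun k _ => hcyl k).trans
          (Finset.sum_le_sum fun k _ => (hmρ _ _ ((hB k).diff (hKm k))).trans (hKε k).le))
    exact absurd ((hle n).trans (h3.trans (ENNReal.sum_le_tsum _))) (not_le.2 hsum)
  choose x hx using hpt
  -- A nonprincipal ultrafilter replaces the extraction of a diagonal subsequence.
  have hmem : ∀ k, ∀ᶠ n in (hyperfilter ℕ : Filter ℕ), (J k).restrict (x n) ∈ K k := fun k =>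
    Eventually.mono (Nat.hyperfilter_le_atTop (eventually_ge_atTop k)) fun n hn => hx n k hn
  have hT : ∀ k, ∃ T ∈ K k, Tendsto (fun n => (J k).restrict (x n)) (hyperfilter ℕ) (𝓝 T) :=
    fun k => (hKc k).ultrafilter_le_nhds ((hyperfilter ℕ).map fun n => (J k).restrict (x n))
      (le_principal_iff.2 (hmem k))
  choose T hTK hTlim using hT
  classical
  -- Coordinates belonging to some `J k` have a limit. The others are not constrained, and the
  -- default value `x 0 j` is immaterial.
  let y : ι → E := fun j => if h : ∃ e, Tendsto (fun n => x n j) (hyperfilter ℕ) (𝓝 e) then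
    h.choose else x 0 j
  have hy : ∀ k, (J k).restrict y = T k := by
    intro k
    funext j
    have h1 : Tendsto (fun n => x n j) (hyperfilter ℕ) (𝓝 (T k j)) :=
      (tendsto_pi_nhds.1 (hTlim k)) j
    have h2 : ∃ e, Tendsto (fun n => x n j) (hyperfilter ℕ) (𝓝 e) := ⟨_, h1⟩
    simp only [Finset.restrict, y, dif_pos h2]
    exact tendsto_nhds_unique h2.choose_spec h1
  have hyA : y ∈ ⋂ n, A n := by
    refine Set.mem_iInter.2 fun n => ?_
    rw [hAB n, mem_cylinder, hy n]
    exact hKB n (hTK n)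
  rw [hempty] at hyA
  exact hyA

/-- Extension of dominated finitely additive set functions on cylinders to measures. -/
theorem exists_measure_eq_addContent
    (m : AddContent ℝ≥0∞ (measurableCylinders fun _ : ι => E))
    (hm : ∀ J : Finset ι, ∃ ρ : Measure (J → E), IsFiniteMeasure ρ ∧
      ∀ B, MeasurableSet B → m (cylinder J B) ≤ ρ B) :
    ∃ μ : Measure (ι → E), ∀ B ∈ measurableCylinders fun _ : ι => E, μ B = m B := by
  have hring : IsSetRing (measurableCylinders fun _ : ι => E) := isSetRing_measurableCylinders
  have hfin : ∀ s ∈ measurableCylinders fun _ : ι => E, m s ≠ ∞ := by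
    intro s hs
    obtain ⟨J, B, hB, rfl⟩ := (mem_measurableCylinders _).1 hs
    obtain ⟨ρ, hρ, h⟩ := hm J
    exact ne_top_of_le_ne_top (measure_ne_top ρ B) (h B hB)
  have hsub : m.IsSigmaSubadditive := by
    refine isSigmaSubadditive_of_addContent_iUnion_eq_tsum hring fun f hf hfU hf' => ?_
    exact addContent_iUnion_eq_sum_of_tendsto_zero hring m hfin
      (fun _ hs hanti hempty => addContent_tendsto_zero m hm hs hanti hempty) hf hfU hf'
  refine ⟨m.measure hring.isSetSemiring generateFrom_measurableCylinders.ge hsub, fun B hB => ?_⟩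
  exact AddContent.measure_eq _ _ generateFrom_measurableCylinders.symm _ hB

end Extension

variable {d : ℕ} {E : Type*} [MeasurableSpace E]

lemma mem_measurableCylinders_of_dependsOn [Nonempty E] {B : Set (Config d E)}
    (hB : MeasurableSet B) {D : Finset (Site d)}
    (hD : ∀ S S' : Config d E, (∀ x ∈ D, S x = S' x) → S ∈ B → S' ∈ B) :
    B ∈ measurableCylinders fun _ : Site d => E := by
  have ω : Config d E := fun _ => Classical.arbitrary E
  refine (mem_measurableCylinders _).2 ⟨D, {T | glue D T ω ∈ B}, measurable_glue_left D ω hB, ?_⟩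
  ext S
  have h : ∀ x ∈ D, S x = glue D (D.restrict S) ω x := fun x hx => by rw [glue_of_mem hx]; rfl
  exact ⟨hD _ _ h, hD _ _ fun x hx => (h x hx).symm⟩

lemma isBoundedLocal_indicator {B : Set (Config d E)}
    (hB : B ∈ measurableCylinders fun _ : Site d => E) :
    IsBoundedLocal (B.indicator fun _ => (1 : ℝ)) := by
  have h := isBoundedMeasurable_indicator (MeasurableSet.of_mem_measurableCylinders hB)
  obtain ⟨D, B', -, rfl⟩ := (mem_measurableCylinders _).1 hB
  exact ⟨h.measurable, h.bounded, D, dependsOn_cylinder_indicator_const _ _⟩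

/-- Local functions are uniform limits of linear combinations of indicators of cylinders. -/
lemma IsBoundedLocal.exists_approximation [Nonempty E] {F : Config d E → ℝ}
    (hF : IsBoundedLocal F) {ε : ℝ} (hε : 0 < ε) :
    ∃ (s : Finset ℤ) (B : ℤ → Set (Config d E)), (∀ k, B k ∈ measurableCylinders fun _ => E) ∧
      ∀ S, |F S - ∑ k ∈ s, (ε * k) * (B k).indicator (fun _ => 1) S| ≤ ε := by
  obtain ⟨C, hC⟩ := hF.bounded
  obtain ⟨D, hD⟩ := hF.isLocal
  -- `F` is rounded down to a multiple of ε. Boundedness leaves finitely many levels, and locality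
  -- makes each level set a cylinder.
  refine ⟨Finset.Icc ⌊-C / ε⌋ ⌊C / ε⌋, fun k => {S | ⌊F S / ε⌋ = k}, fun k => ?_, fun S => ?_⟩
  · refine mem_measurableCylinders_of_dependsOn (D := D)
      ((Int.measurable_floor.comp (hF.measurable.div_const ε)) (measurableSet_singleton k)) ?_
    intro S S' h hS
    have : F S = F S' := hD h
    simpa [this] using hS
  · have hmem : ⌊F S / ε⌋ ∈ Finset.Icc ⌊-C / ε⌋ ⌊C / ε⌋ := by
      have := abs_le.1 (hC S)
      exact Finset.mem_Icc.2 ⟨Int.floor_le_floor (by gcongr; exact this.1),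
        Int.floor_le_floor (by gcongr; exact this.2)⟩
    rw [Finset.sum_eq_single_of_mem _ hmem]
    · rw [Set.indicator_of_mem (by simp)]
      have h1 := Int.floor_le (F S / ε)
      have h2 := Int.lt_floor_add_one (F S / ε)
      rw [le_div_iff₀ hε] at h1
      rw [div_lt_iff₀ hε] at h2
      rw [abs_le]; constructor <;> nlinarith
    · intro k _ hk
      rw [Set.indicator_of_notMem (fun h => hk h.symm), mul_zero]

lemma abs_integral_sub_le {X : Type*} [MeasurableSpace X] (μ : Measure X) [IsProbabilityMeasure μ]
    {F G : X → ℝ} (hF : IsBoundedMeasurable F) (hG : IsBoundedMeasurable G) {ε : ℝ}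
    (h : ∀ x, |F x - G x| ≤ ε) : |∫ x, F x ∂μ - ∫ x, G x ∂μ| ≤ ε := by
  rw [← integral_sub (hF.integrable μ) (hG.integrable μ), ← Real.norm_eq_abs]
  simpa using norm_integral_le_of_norm_le_const (μ := μ) (ae_of_all μ fun x => (Real.norm_eq_abs (F x - G x)).trans_le (h x))

/-- Convergence on cylinders implies convergence of the expectations of local functions. -/
lemma tendsto_integral_of_tendsto_cylinders [Nonempty E] {I : Type*} {l : Filter I}
    {ν : I → Measure (Config d E)} [∀ i, IsProbabilityMeasure (ν i)] {μ : Measure (Config d E)}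
    [IsProbabilityMeasure μ] (h : ∀ B ∈ measurableCylinders fun _ : Site d => E,
      Tendsto (fun i => (ν i).real B) l (𝓝 (μ.real B))) {F : Config d E → ℝ}
    (hF : IsBoundedLocal F) : Tendsto (fun i => ∫ S, F S ∂(ν i)) l (𝓝 (∫ S, F S ∂μ)) := by
  rw [Metric.tendsto_nhds]
  intro ε hε
  obtain ⟨s, B, hB, happ⟩ := hF.exists_approximation (show 0 < ε / 4 by positivity)
  have hBm : ∀ k, MeasurableSet (B k) := fun k => .of_mem_measurableCylinders (hB k)
  have hG : IsBoundedMeasurable fun S => ∑ k ∈ s, (ε / 4 * k) * (B k).indicator (fun _ => 1) S :=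
    IsBoundedMeasurable.sum _ fun k _ => (isBoundedMeasurable_indicator (hBm k)).const_mul _
  have hint : ∀ (ρ : Measure (Config d E)) [IsProbabilityMeasure ρ],
      ∫ S, ∑ k ∈ s, (ε / 4 * k) * (B k).indicator (fun _ => 1) S ∂ρ
        = ∑ k ∈ s, (ε / 4 * k) * ρ.real (B k) := by
    intro ρ _
    rw [integral_finsetSum _ fun k _ =>
      ((isBoundedMeasurable_indicator (hBm k)).const_mul _).integrable ρ]
    refine Finset.sum_congr rfl fun k _ => ?_
    rw [integral_const_mul, integral_indicator_one_real _ (hBm k)]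
  have hlim : Tendsto (fun i => ∑ k ∈ s, (ε / 4 * k) * (ν i).real (B k)) l
      (𝓝 (∑ k ∈ s, (ε / 4 * k) * μ.real (B k))) :=
    tendsto_finsetSum _ fun k _ => (h _ (hB k)).const_mul _
  filter_upwards [Metric.tendsto_nhds.1 hlim (ε / 4) (by positivity)] with i hi
  have h1 := abs_le.1 (abs_integral_sub_le (ν i) hF.isBoundedMeasurable hG happ)
  have h2 := abs_le.1 (abs_integral_sub_le μ hF.isBoundedMeasurable hG happ)
  rw [hint] at h1 h2
  rw [Real.dist_eq] at hi ⊢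
  have h3 := abs_lt.1 hi
  rw [abs_lt]; constructor <;> linarith [h1.1, h1.2, h2.1, h2.2, h3.1, h3.2]

lemma exists_pos_exp_modulus_le (C : ℝ) {ε : ℝ} (hε : 0 < ε) :
    ∃ δ > 0, 2 * C * (Real.exp δ - 1) * Real.exp δ ≤ ε := by
  have hc : Continuous fun δ : ℝ => 2 * C * (Real.exp δ - 1) * Real.exp δ := by fun_prop
  have h0 : Tendsto (fun δ : ℝ => 2 * C * (Real.exp δ - 1) * Real.exp δ) (𝓝 0) (𝓝 0) := by
    simpa using hc.tendsto 0
  obtain ⟨r, hr, h⟩ := Metric.eventually_nhds_iff.1 (h0.eventually (ge_mem_nhds hε))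
  exact ⟨r / 2, by positivity, h (by rw [Real.dist_eq, sub_zero, abs_of_pos] <;> linarith)⟩

variable {Φ : Finset (Site d) → Config d E → ℝ} {β : ℝ} {μ₀ : Measure E} [IsProbabilityMeasure μ₀]

/-- The Gibbs specification is quasilocal. -/
lemma IsInteraction.exists_local_approximation_condAvg (hΦ : IsInteraction Φ)
    (Λ : Finset (Site d)) {F : Config d E → ℝ} (hF : IsBoundedLocal F) {ε : ℝ} (hε : 0 < ε) :
    ∃ G, IsBoundedLocal G ∧
      ∀ S, |condAvg μ₀ (fun S => -β * hamiltonian Φ Λ S) Λ F S - G S| ≤ ε := by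
  have : Nonempty E := nonempty_of_isProbabilityMeasure μ₀
  have ω : Config d E := fun _ => Classical.arbitrary E
  obtain ⟨C, hC⟩ := hF.bounded
  obtain ⟨D₁, hD₁⟩ := hF.isLocal
  obtain ⟨δ, hδ, hδε⟩ := exists_pos_exp_modulus_le C hε
  obtain ⟨D₂, hD₂⟩ := hΦ.hamiltonian_quasilocal Λ (show 0 < δ / (|β| + 1) by positivity)
  set D := D₁ ∪ D₂
  have hV := hΦ.isBoundedMeasurable_exponent β Λ
  have hA := hF.isBoundedMeasurable.condAvg μ₀ hV (Λ := Λ)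
  have hres : Measurable fun S : Config d E => glue D (D.restrict S) ω :=
    (measurable_glue_left D ω).comp (Finset.measurable_restrict D)
  -- The local approximant freezes all spins outside `D` at the reference configuration `ω`.
  refine ⟨fun S => condAvg μ₀ (fun S => -β * hamiltonian Φ Λ S) Λ F (glue D (D.restrict S) ω),
    ⟨hA.measurable.comp hres, (hA.comp hres).bounded, D, fun S S' h => ?_⟩, fun S => ?_⟩
  · have : D.restrict S = D.restrict S' := funext fun x => h x x.2
    simp only [this]
  · set S' := glue D (D.restrict S) ω
    have hSS' : ∀ (T : Λ → E), ∀ x ∈ D, glue Λ T S x = glue Λ T S' x := by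
      intro T x hx
      by_cases hΛ : x ∈ Λ
      · rw [glue_of_mem hΛ, glue_of_mem hΛ]
      · rw [glue_of_notMem hΛ, glue_of_notMem hΛ]
        change S x = glue D (D.restrict S) ω x
        rw [glue_of_mem hx]; rfl
    have hFeq : ∀ T, F (glue Λ T S') = F (glue Λ T S) := fun T => hD₁ fun x hx =>
      (hSS' T x (Finset.mem_union_left _ hx)).symm
    have h := abs_integral_div_sub_le (Measure.pi fun _ : Λ => μ₀)
      (hF.isBoundedMeasurable.comp (measurable_glue_left Λ S)) (fun T => hC (glue Λ T S))
      (hV.comp (measurable_glue_left Λ S)) (hV.comp (measurable_glue_left Λ S')) (δ := δ)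
      fun T => by
        rw [← mul_sub, abs_mul, abs_neg]
        have h1 := hD₂ _ _ fun x hx => hSS' T x (Finset.mem_union_right _ hx)
        calc |β| * _ ≤ |β| * (δ / (|β| + 1)) := mul_le_mul_of_nonneg_left h1 (abs_nonneg β)
          _ ≤ δ := by
            rw [mul_div_assoc', div_le_iff₀ (by positivity)]
            nlinarith [abs_nonneg β]
    refine le_trans (le_of_eq ?_) (h.trans hδε)
    change |condAvg _ _ Λ F S - condAvg _ _ Λ F S'| = _
    simp only [condAvg, hFeq]

/-- With the exponent bounded by c, the Boltzmann factor is at most e^c and the normalization at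
least e^{-c}, so the density is at most e^{2c} whatever the boundary condition. This domination
stands in for tightness. -/
lemma IsInteraction.exists_condAvg_indicator_le (hΦ : IsInteraction Φ) (Λ : Finset (Site d)) :
    ∃ C : ℝ, 0 ≤ C ∧ ∀ (B : Set (Λ → E)), MeasurableSet B → ∀ S,
      condAvg μ₀ (fun S => -β * hamiltonian Φ Λ S) Λ
        ((cylinder Λ B).indicator fun _ => 1) S ≤ C * (Measure.pi fun _ : Λ => μ₀).real B := by
  have hV := hΦ.isBoundedMeasurable_exponent β Λ
  obtain ⟨c, hc⟩ := hV.bounded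
  refine ⟨Real.exp (2 * c), (Real.exp_pos _).le, fun B hB S => ?_⟩
  have hVg := hV.comp (measurable_glue_left Λ S)
  have hpos := hVg.integral_exp_pos (Measure.pi fun _ : Λ => μ₀)
  have hind : ∀ T : Λ → E, (cylinder Λ B).indicator (fun _ => (1 : ℝ)) (glue Λ T S)
      = B.indicator (fun _ => 1) T := by
    intro T
    have h1 : Λ.restrict (glue Λ T S) = T := funext fun x => glue_of_mem x.2
    by_cases h : T ∈ B
    · rw [Set.indicator_of_mem h, Set.indicator_of_mem (by rw [mem_cylinder, h1]; exact h)]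
    · rw [Set.indicator_of_notMem h,
        Set.indicator_of_notMem (by rw [mem_cylinder, h1]; exact h)]
  simp only [condAvg, hind]
  rw [div_le_iff₀ hpos]
  have h1 : Real.exp (-c) ≤ ∫ T, Real.exp (-β * hamiltonian Φ Λ (glue Λ T S))
      ∂(Measure.pi fun _ : Λ => μ₀) := by
    have := integral_mono ((isBoundedMeasurable_const (Real.exp (-c))).integrable
      (Measure.pi fun _ : Λ => μ₀)) (hVg.exp.integrable (Measure.pi fun _ : Λ => μ₀)) fun T =>
        Real.exp_le_exp.2 (abs_le.1 (hc (glue Λ T S))).1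
    simpa using this
  have hBi := isBoundedMeasurable_indicator hB
  have h2 : ∫ T, B.indicator (fun _ => 1) T * Real.exp (-β * hamiltonian Φ Λ (glue Λ T S))
      ∂(Measure.pi fun _ : Λ => μ₀) ≤ (Measure.pi fun _ : Λ => μ₀).real B * Real.exp c := by
    rw [← integral_indicator_one_real _ hB, ← integral_mul_const]
    refine integral_mono ((hBi.mul hVg.exp).integrable _) ((hBi.integrable _).mul_const _)
      fun T => mul_le_mul_of_nonneg_left (Real.exp_le_exp.2 (abs_le.1 (hc _)).2)
        (Set.indicator_nonneg (fun _ _ => zero_le_one) _)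
  have h3 : Real.exp c = Real.exp (2 * c) * Real.exp (-c) := by
    rw [← Real.exp_add]; congr 1; ring
  refine h2.trans ?_
  rw [h3]
  calc _ = Real.exp (2 * c) * (Measure.pi fun _ : Λ => μ₀).real B * Real.exp (-c) := by ring
    _ ≤ _ := by gcongr

variable [TopologicalSpace E] [PolishSpace E] [BorelSpace E]

/-- Limits along ultrafilters of measures that are asymptotically invariant under resampling
exist, on local functions, and are Gibbs measures. -/
theorem exists_isGibbs_limit (hΦ : IsInteraction Φ) {I : Type*} (𝒰 : Ultrafilter I)
    (ν : I → Measure (Config d E)) [∀ i, IsProbabilityMeasure (ν i)]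
    (h : ∀ (Λ : Finset (Site d)) (F : Config d E → ℝ), IsBoundedMeasurable F →
      Tendsto (fun i => ∫ S, condAvg μ₀ (fun S => -β * hamiltonian Φ Λ S) Λ F S ∂(ν i)
        - ∫ S, F S ∂(ν i)) 𝒰 (𝓝 0)) :
    ∃ μ : Measure (Config d E), IsGibbs Φ β μ₀ μ ∧ ∀ F : Config d E → ℝ, IsBoundedLocal F →
      Tendsto (fun i => ∫ S, F S ∂(ν i)) 𝒰 (𝓝 (∫ S, F S ∂μ)) := by
  have hne : Nonempty E := nonempty_of_isProbabilityMeasure μ₀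
  -- Ultrafilter limits exist in [0, ∞] by compactness and inherit finite additivity. Countable
  -- additivity is obtained afterwards from domination.
  set m : Set (Config d E) → ℝ≥0∞ := fun B => (𝒰.map fun i => ν i B).lim
  have hm : ∀ B, Tendsto (fun i => ν i B) 𝒰 (𝓝 (m B)) := fun B =>
    Ultrafilter.le_nhds_lim (𝒰.map fun i => ν i B)
  have hmem : ∀ B ∈ measurableCylinders fun _ : Site d => E, MeasurableSet B := fun B hB =>
    .of_mem_measurableCylinders hB
  let mc : AddContent ℝ≥0∞ (measurableCylinders fun _ : Site d => E) :=
    isSetRing_measurableCylinders.addContent_of_union m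
      (tendsto_nhds_unique (hm ∅) (by simp))
      (fun {s t} _ ht hst => tendsto_nhds_unique (hm (s ∪ t)) (by
        simpa only [measure_union hst (hmem t ht)] using (hm s).add (hm t)))
  have hmc : ∀ B, mc B = m B := fun B => rfl
  have hdom : ∀ J : Finset (Site d), ∃ ρ : Measure (J → E), IsFiniteMeasure ρ ∧
      ∀ B, MeasurableSet B → mc (cylinder J B) ≤ ρ B := by
    intro J
    obtain ⟨C, hC0, hC⟩ := hΦ.exists_condAvg_indicator_le (β := β) (μ₀ := μ₀) J
    refine ⟨ENNReal.ofReal C • Measure.pi fun _ : J => μ₀,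
      Measure.smul_finite _ ENNReal.ofReal_ne_top, fun B hB => ?_⟩
    have hcyl : MeasurableSet (cylinder J B : Set (Config d E)) :=
      .of_mem_measurableCylinders
        (cylinder_mem_measurableCylinders (α := fun _ => E) J B hB)
    have hbm := isBoundedMeasurable_indicator hcyl
    rw [hmc, Measure.smul_apply, smul_eq_mul,
      ← ofReal_measureReal (μ := Measure.pi fun _ : J => μ₀), ← ENNReal.ofReal_mul hC0]
    have h1 := (h J _ hbm).const_sub (C * (Measure.pi fun _ : J => μ₀).real B)
    rw [sub_zero] at h1
    refine le_of_tendsto_of_tendsto' (hm _) (ENNReal.tendsto_ofReal h1) fun i => ?_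
    rw [← ofReal_measureReal, ← integral_indicator_one_real _ hcyl]
    refine ENNReal.ofReal_le_ofReal ?_
    have h2 := integral_mono (((hbm.condAvg μ₀
      (hΦ.isBoundedMeasurable_exponent β J))).integrable (ν i))
      ((isBoundedMeasurable_const _).integrable (ν i)) (hC B hB)
    simp only [integral_const, probReal_univ, one_smul] at h2
    linarith
  obtain ⟨μ, hμ⟩ := exists_measure_eq_addContent mc hdom
  have hprob : IsProbabilityMeasure μ := ⟨by
    rw [hμ _ (univ_mem_measurableCylinders _), hmc]
    exact tendsto_nhds_unique (hm _) (by simp)⟩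
  have hconv : ∀ F : Config d E → ℝ, IsBoundedLocal F →
      Tendsto (fun i => ∫ S, F S ∂(ν i)) 𝒰 (𝓝 (∫ S, F S ∂μ)) := by
    intro F hF
    refine tendsto_integral_of_tendsto_cylinders (fun B hB => ?_) hF
    have := hm B
    rw [← hmc, ← hμ B hB] at this
    exact (ENNReal.tendsto_toReal (measure_ne_top μ B)).comp this
  refine ⟨μ, isGibbs_of_integral_condAvg hΦ fun Λ B hB => ?_, hconv⟩
  have hBl := isBoundedLocal_indicator hB
  rw [← integral_indicator_one_real _ (hmem B hB)]
  -- The conditional average of a cylinder event need not be local, so convergence is not known for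
  -- it directly. It is replaced by a local `G` within ε / 2, once under the limit measure and once
  -- under the approximating ones.
  refine eq_of_abs_sub_le_all fun ε hε => ?_
  obtain ⟨G, hG, hGε⟩ := hΦ.exists_local_approximation_condAvg (β := β) (μ₀ := μ₀) Λ hBl
    (half_pos hε)
  have hA := hBl.isBoundedMeasurable.condAvg μ₀ (hΦ.isBoundedMeasurable_exponent β Λ) (Λ := Λ)
  have h1 := abs_integral_sub_le μ hA hG.isBoundedMeasurable hGε
  have h2 : |∫ S, G S ∂μ - ∫ S, B.indicator (fun _ => 1) S ∂μ| ≤ ε / 2 := by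
    have h3 := ((hconv G hG).sub (hconv _ hBl)).sub (h Λ _ hBl.isBoundedMeasurable)
    rw [sub_zero] at h3
    refine le_of_tendsto h3.abs (Eventually.of_forall fun i => ?_)
    have h4 := abs_integral_sub_le (ν i) hA hG.isBoundedMeasurable hGε
    rw [abs_sub_comm] at h4
    refine le_trans (le_of_eq (congrArg _ ?_)) h4
    ring
  linarith [abs_sub_le (∫ S, condAvg μ₀ (fun S => -β * hamiltonian Φ Λ S) Λ
    (B.indicator fun _ => 1) S ∂μ) (∫ S, G S ∂μ) (∫ S, B.indicator (fun _ => (1 : ℝ)) S ∂μ)]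

end

/-! ### The variational inequality for Gibbs measures -/

section

/-- Jensen's inequality for the exponential. -/
lemma integral_le_log_integral_exp {X : Type*} [MeasurableSpace X] (ρ : Measure X)
    [IsProbabilityMeasure ρ] {F : X → ℝ} (hF : IsBoundedMeasurable F) :
    ∫ x, F x ∂ρ ≤ Real.log (∫ x, Real.exp (F x) ∂ρ) := by
  rw [Real.le_log_iff_exp_le (hF.integral_exp_pos ρ)]
  exact convexOn_exp.map_integral_le Real.continuous_exp.continuousOn isClosed_univ
    (ae_of_all _ fun _ => Set.mem_univ _) (hF.integrable ρ) (hF.exp.integrable ρ)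

variable {d : ℕ} {E : Type*} [MeasurableSpace E]

lemma IsTranslationInvariant.integral_shift {μ : Measure (Config d E)}
    (hμ : IsTranslationInvariant μ) (x : Site d) {F : Config d E → ℝ} (hF : Measurable F) :
    ∫ S, F (shift x S) ∂μ = ∫ S, F S ∂μ := by
  conv_rhs => rw [← (hμ x).map_eq]
  rw [integral_map (measurable_shift x).aemeasurable hF.aestronglyMeasurable]

lemma IsTranslationInvariant.integral_sum_shift {μ : Measure (Config d E)} [IsFiniteMeasure μ]
    (hμ : IsTranslationInvariant μ) {F : Config d E → ℝ} (hF : IsBoundedMeasurable F)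
    (Λ : Finset (Site d)) :
    ∫ S, ∑ x ∈ Λ, F (shift (-x) S) ∂μ = Λ.card * ∫ S, F S ∂μ := by
  rw [integral_finsetSum _ fun x _ => (hF.comp (measurable_shift (-x))).integrable μ]
  simp [hμ.integral_shift _ hF.measurable]

/-- The exponent `-β H_Λ + h ∑_{x ∈ Λ} g ∘ τ_{-x}`. -/
noncomputable def fieldExponent (Φ : Finset (Site d) → Config d E → ℝ) (β : ℝ)
    (g : Config d E → ℝ) (h : ℝ) (Λ : Finset (Site d)) (S : Config d E) : ℝ :=
  -β * hamiltonian Φ Λ S + h * ∑ x ∈ Λ, g (shift (-x) S)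

/-- The logarithm of the partition function in `Λ`. -/
noncomputable def logPartition (Φ : Finset (Site d) → Config d E → ℝ) (β : ℝ)
    (g : Config d E → ℝ) (μ₀ : Measure E) (h : ℝ) (Λ : Finset (Site d)) : ℝ :=
  Real.log (∫ S, Real.exp (fieldExponent Φ β g h Λ S) ∂(freeMeasure d μ₀))

/-- This brings finite-volume integrals with a boundary condition under the same product measure as
the partition functions, so that their exponents can be compared pointwise. -/
lemma integral_pi_eq_integral_freeMeasure (μ₀ : Measure E) [IsProbabilityMeasure μ₀]
    (Λ : Finset (Site d)) {K : (Λ → E) → ℝ} (hK : Measurable K) :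
    ∫ T, K T ∂(Measure.pi fun _ : Λ => μ₀) = ∫ S, K (Λ.restrict S) ∂(freeMeasure d μ₀) :=
  (integral_restrict_infinitePi (μ := fun _ : Site d => μ₀) hK.aestronglyMeasurable).symm

variable {Φ : Finset (Site d) → Config d E → ℝ} {β : ℝ} {g : Config d E → ℝ}

lemma IsInteraction.isBoundedMeasurable_fieldExponent (hΦ : IsInteraction Φ)
    (hg : IsBoundedMeasurable g) (h : ℝ) (Λ : Finset (Site d)) :
    IsBoundedMeasurable (fieldExponent Φ β g h Λ) :=
  (hΦ.isBoundedMeasurable_exponent β Λ).add ((isBoundedMeasurable_sum_shift hg Λ).const_mul h)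

lemma IsInteraction.isAsymptoticallyLocal_fieldExponent (hΦ : IsInteraction Φ)
    (hg : IsBoundedLocal g) (h : ℝ) :
    IsAsymptoticallyLocal fun L => fieldExponent Φ β g h (box d L) :=
  (hΦ.isAsymptoticallyLocal_hamiltonian.const_mul (-β)).add
    (hg.isAsymptoticallyLocal.const_mul h)

variable {μ₀ : Measure E} [IsProbabilityMeasure μ₀]

/-- The variational inequality for translation-invariant Gibbs measures. -/
theorem IsGibbs.mul_integral_le (hΦ : IsInteraction Φ) (hg : IsBoundedLocal g)
    {μ : Measure (Config d E)} (hμ : IsGibbs Φ β μ₀ μ) (hinv : IsTranslationInvariant μ)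
    (h : ℝ) {p : ℝ → ℝ} (hp : ∀ h, Tendsto
      (fun L : ℕ => 1 / (L : ℝ) ^ d * logPartition Φ β g μ₀ h (box d L)) atTop (𝓝 (p h))) :
    h * ∫ S, g S ∂μ ≤ p h - p 0 := by
  have := hμ.isProbability
  have hgb := hg.isBoundedMeasurable
  refine le_of_forall_pos_le_add fun ε hε => ?_
  refine ge_of_tendsto (((hp h).sub (hp 0)).add_const ε) ?_
  filter_upwards [(hΦ.isAsymptoticallyLocal_fieldExponent (β := β) hg h).eventually_abs_sub_le
    (half_pos hε), (hΦ.isAsymptoticallyLocal_fieldExponent (β := β) hg 0).eventually_abs_sub_le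
    (half_pos hε), eventually_gt_atTop 0] with L hL hL0 hLpos
  set Λ := box d L
  -- The boundary condition costs e^c in the numerator and e^c in the denominator, so in total `2 *
  -- c` is ε per site.
  set c := ε / 2 * (L : ℝ) ^ d
  have hLd : (0 : ℝ) < (L : ℝ) ^ d := by positivity
  have hX := (isBoundedMeasurable_sum_shift hgb Λ).const_mul h
  have hV := hΦ.isBoundedMeasurable_exponent β Λ
  have hbm := fun h => hΦ.isBoundedMeasurable_fieldExponent (β := β) hgb h Λ
  have hglue : ∀ S S' : Config d E, ∀ x ∈ Λ, glue Λ (Λ.restrict S') S x = S' x := fun S S' x hx =>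
    glue_of_mem hx
  have hgl : ∀ S : Config d E, Measurable fun S' : Config d E => glue Λ (Λ.restrict S') S :=
    fun S => (measurable_glue_left Λ S).comp (Finset.measurable_restrict Λ)
  have hnum : ∀ S, ∫ T, Real.exp (fieldExponent Φ β g h Λ (glue Λ T S))
      ∂(Measure.pi fun _ : Λ => μ₀)
      ≤ Real.exp c * ∫ S, Real.exp (fieldExponent Φ β g h Λ S) ∂(freeMeasure d μ₀) := by
    intro S
    rw [integral_pi_eq_integral_freeMeasure μ₀ Λ
      ((hbm h).comp (measurable_glue_left Λ S)).exp.measurable]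
    exact integral_exp_le_of_le_add ((hbm h).comp (hgl S)) (hbm h) _ fun S' => by
      linarith [(abs_le.1 (hL _ _ (hglue S S'))).2]
  have hden : ∀ S, ∫ S, Real.exp (fieldExponent Φ β g 0 Λ S) ∂(freeMeasure d μ₀)
      ≤ Real.exp c * ∫ T, Real.exp (-β * hamiltonian Φ Λ (glue Λ T S))
        ∂(Measure.pi fun _ : Λ => μ₀) := by
    intro S
    rw [integral_pi_eq_integral_freeMeasure μ₀ Λ
      (hV.comp (measurable_glue_left Λ S)).exp.measurable]
    refine integral_exp_le_of_le_add (hbm 0) (hV.comp (hgl S)) _ fun S' => ?_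
    have := (abs_le.1 (hL0 _ _ (hglue S S'))).1
    simp only [fieldExponent, zero_mul, add_zero] at this ⊢
    linarith
  have hcond : ∀ S, condAvg μ₀ (fun S => -β * hamiltonian Φ Λ S) Λ
      (fun S => Real.exp (h * ∑ x ∈ Λ, g (shift (-x) S))) S
      ≤ Real.exp (2 * c) * ((∫ S, Real.exp (fieldExponent Φ β g h Λ S) ∂(freeMeasure d μ₀))
        / ∫ S, Real.exp (fieldExponent Φ β g 0 Λ S) ∂(freeMeasure d μ₀)) := by
    intro S
    have h0 := (hbm 0).integral_exp_pos (freeMeasure d μ₀)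
    have h1 := (hV.comp (measurable_glue_left Λ S)).integral_exp_pos (Measure.pi fun _ : Λ => μ₀)
    have h2 := hnum S
    have h3 := hden S
    simp only [fieldExponent, add_comm (-β * _), Real.exp_add] at h2
    rw [condAvg, div_le_iff₀ h1]
    refine h2.trans ?_
    have h4 := (hbm h).integral_exp_pos (freeMeasure d μ₀)
    simp only [fieldExponent, add_comm (-β * _), Real.exp_add] at h4 h3 h0 ⊢
    rw [mul_div_assoc', div_mul_eq_mul_div, le_div_iff₀ h0, two_mul, Real.exp_add]
    have := mul_le_mul_of_nonneg_left h3 (mul_pos (Real.exp_pos c) h4).le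
    linarith
  -- By translation invariance the Jensen lower bound is h L^d times the expectation of `g`. By the
  -- DLR equation the exponential moment equals the mean of the conditional averages just bounded.
  have hJ := integral_le_log_integral_exp μ hX
  rw [← hμ.integral_condAvg hΦ Λ hX.exp, integral_const_mul,
    hinv.integral_sum_shift hgb, card_box] at hJ
  have hint : ∫ S, condAvg μ₀ (fun S => -β * hamiltonian Φ Λ S) Λ
      (fun S => Real.exp (h * ∑ x ∈ Λ, g (shift (-x) S))) S ∂μ ≤ _ :=
    integral_mono ((hX.exp.condAvg μ₀ hV).integrable μ) ((isBoundedMeasurable_const _).integrable μ)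
      hcond
  have hpos : 0 < ∫ S, condAvg μ₀ (fun S => -β * hamiltonian Φ Λ S) Λ
      (fun S => Real.exp (h * ∑ x ∈ Λ, g (shift (-x) S))) S ∂μ := by
    rw [hμ.integral_condAvg hΦ Λ hX.exp]; exact hX.integral_exp_pos μ
  have hlog := Real.log_le_log hpos hint
  rw [integral_const, probReal_univ, one_smul, Real.log_mul (Real.exp_pos _).ne'
    (div_pos ((hbm h).integral_exp_pos _) ((hbm 0).integral_exp_pos _)).ne', Real.log_exp,
    Real.log_div ((hbm h).integral_exp_pos _).ne' ((hbm 0).integral_exp_pos _).ne'] at hlog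
  have hfin := hJ.trans hlog
  change _ ≤ 2 * c + (logPartition Φ β g μ₀ h Λ - logPartition Φ β g μ₀ 0 Λ) at hfin
  push_cast at hfin
  have : 1 / (L : ℝ) ^ d * logPartition Φ β g μ₀ h Λ
      - 1 / (L : ℝ) ^ d * logPartition Φ β g μ₀ 0 Λ + ε
      = (2 * c + (logPartition Φ β g μ₀ h Λ - logPartition Φ β g μ₀ 0 Λ)) / (L : ℝ) ^ d := by
    simp only [c]; field_simp; ring
  rw [this, le_div_iff₀ hLd]
  linarith

end

/-! ### Averaged Gibbs measures with a small field -/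

section

lemma abs_integral_le_of_abs_le {X : Type*} [MeasurableSpace X] (μ : Measure X)
    [IsProbabilityMeasure μ] {F : X → ℝ} {C : ℝ} (h : ∀ x, |F x| ≤ C) : |∫ x, F x ∂μ| ≤ C := by
  have := norm_integral_le_of_norm_le_const (μ := μ)
    (ae_of_all μ fun x => (Real.norm_eq_abs (F x)).trans_le (h x))
  simpa using this

variable {d : ℕ}

/-- The fraction of the sites `x` of the box for which `x + D` is not contained in the box. -/
noncomputable def boundaryFraction (D : Finset (Site d)) (L : ℕ) : ℝ :=
  (((box d L).filter fun x => ∃ y ∈ D, x + y ∉ box d L).card : ℝ) / (L : ℝ) ^ d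

lemma tendsto_boundaryFraction (D : Finset (Site d)) :
    Tendsto (boundaryFraction D) atTop (𝓝 0) := by
  rw [Metric.tendsto_nhds]
  intro ε hε
  filter_upwards [eventually_card_boundary_le D (half_pos hε), eventually_gt_atTop 0] with L h hL
  have hLd : (0 : ℝ) < (L : ℝ) ^ d := by positivity
  have h0 : 0 ≤ boundaryFraction D L := by unfold boundaryFraction; positivity
  rw [Real.dist_eq, sub_zero, abs_of_nonneg h0, boundaryFraction, div_lt_iff₀ hLd]
  nlinarith

lemma abs_sum_le_of_filter_boundary {D : Finset (Site d)} {L : ℕ} (hL : 0 < L) {a : Site d → ℝ}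
    {c C : ℝ} (hc : 0 ≤ c) (hgood : ∀ x ∈ box d L, (∀ y ∈ D, x + y ∈ box d L) → |a x| ≤ c)
    (hC : ∀ x, |a x| ≤ C) :
    |(L ^ d : ℝ)⁻¹ * ∑ x ∈ box d L, a x| ≤ c + C * boundaryFraction D L := by
  have hLd : (0 : ℝ) < (L : ℝ) ^ d := by positivity
  rw [abs_mul, abs_of_pos (inv_pos.2 hLd), inv_mul_le_iff₀ hLd,
    ← Finset.sum_filter_add_sum_filter_not (box d L) fun x => ∃ y ∈ D, x + y ∉ box d L]
  have h1 : |∑ x ∈ (box d L).filter fun x => ∃ y ∈ D, x + y ∉ box d L, a x|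
      ≤ ((box d L).filter fun x => ∃ y ∈ D, x + y ∉ box d L).card * C :=
    (Finset.abs_sum_le_sum_abs _ _).trans
      (by simpa using Finset.sum_le_card_nsmul _ (fun x => |a x|) C fun x _ => hC x)
  have h2 : |∑ x ∈ (box d L).filter fun x => ¬ ∃ y ∈ D, x + y ∉ box d L, a x|
      ≤ (L : ℝ) ^ d * c := by
    refine (Finset.abs_sum_le_sum_abs _ _).trans
      ((Finset.sum_le_card_nsmul _ (fun x => |a x|) c fun x hx => ?_).trans ?_)
    · rw [Finset.mem_filter] at hx
      exact hgood x hx.1 fun y hy => by by_contra h; exact hx.2 ⟨y, hy, h⟩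
    · rw [nsmul_eq_mul]
      refine mul_le_mul_of_nonneg_right ?_ hc
      have := Finset.card_filter_le (box d L) fun x => ¬ ∃ y ∈ D, x + y ∉ box d L
      rw [card_box] at this
      exact_mod_cast this
  refine (abs_add_le _ _).trans ((add_le_add h1 h2).trans (le_of_eq ?_))
  rw [boundaryFraction]
  field_simp
  ring

/-- The sums over the box and over its translate by `y` share all terms except one boundary layer
each, and both layers have as many sites as the set `B` of points that `y` pushes out of the box. -/
lemma abs_sum_translate_sub_le {L : ℕ} (hL : 0 < L) {a : Site d → ℝ} {C : ℝ}
    (hC : ∀ x, |a x| ≤ C) (y : Site d) :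
    |(L ^ d : ℝ)⁻¹ * (∑ x ∈ box d L, a (x + y) - ∑ x ∈ box d L, a x)|
      ≤ 2 * C * boundaryFraction {y} L := by
  have hLd : (0 : ℝ) < (L : ℝ) ^ d := by positivity
  rw [abs_mul, abs_of_pos (inv_pos.2 hLd), inv_mul_le_iff₀ hLd]
  set B := (box d L).filter fun x => ∃ z ∈ ({y} : Finset (Site d)), x + z ∉ box d L
  set G := (box d L).filter fun x => ¬ ∃ z ∈ ({y} : Finset (Site d)), x + z ∉ box d L
  have hcard : B.card + G.card = (box d L).card := Finset.card_filter_add_card_filter_not _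
  have h1 : ∑ x ∈ box d L, a (x + y) = ∑ x ∈ B, a (x + y) + ∑ x ∈ G, a (x + y) :=
    (Finset.sum_filter_add_sum_filter_not _ _ _).symm
  have himg : G.image (· + y) ⊆ box d L := by
    intro z hz
    obtain ⟨x, hx, rfl⟩ := Finset.mem_image.1 hz
    have := (Finset.mem_filter.1 hx).2
    by_contra hcon
    exact this ⟨y, Finset.mem_singleton_self y, hcon⟩
  have h2 : ∑ x ∈ G, a (x + y) = ∑ z ∈ G.image (· + y), a z :=
    (Finset.sum_image fun x _ x' _ h => add_right_cancel h).symm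
  have h3 := Finset.sum_sdiff (f := a) himg
  have hcard2 : (box d L \ G.image (· + y)).card = B.card := by
    rw [Finset.card_sdiff_of_subset himg,
      Finset.card_image_of_injective _ (add_left_injective y)]
    omega
  have hb : ∀ (s : Finset (Site d)) (b : Site d → ℝ), (∀ x, |b x| ≤ C) →
      |∑ x ∈ s, b x| ≤ s.card * C := fun s b hb =>
    (Finset.abs_sum_le_sum_abs _ _).trans
      (by simpa using Finset.sum_le_card_nsmul s (fun x => |b x|) C fun x _ => hb x)
  have h4 := hb B (fun x => a (x + y)) fun x => hC _
  have h5 := hb (box d L \ G.image (· + y)) a hC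
  rw [hcard2] at h5
  have h6 : ∑ x ∈ box d L, a (x + y) - ∑ x ∈ box d L, a x
      = ∑ x ∈ B, a (x + y) - ∑ x ∈ box d L \ G.image (· + y), a x := by
    rw [h1, h2, ← h3]; ring
  rw [h6]
  refine (abs_sub _ _).trans ((add_le_add h4 h5).trans (le_of_eq ?_))
  rw [boundaryFraction]
  field_simp
  ring

variable {E : Type*} [MeasurableSpace E]
variable (Φ : Finset (Site d) → Config d E → ℝ) (β : ℝ) (g : Config d E → ℝ) (μ₀ : Measure E)

/-- The finite-volume Gibbs measure with free spins outside `Λ` and field `h`. -/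
noncomputable def fieldMeasure (h : ℝ) (Λ : Finset (Site d)) : Measure (Config d E) :=
  (freeMeasure d μ₀).tilted (fieldExponent Φ β g h Λ)

/-- The average of the translates of the finite-volume Gibbs measure in a box. -/
noncomputable def averagedMeasure (h : ℝ) (L : ℕ) : Measure (Config d E) :=
  ((box d L).card : ℝ≥0∞)⁻¹ • ∑ x ∈ box d L, fieldMeasure Φ β g μ₀ h (translate (-x) (box d L))

variable {Φ β g μ₀}

lemma integral_fieldMeasure (h : ℝ) (Λ : Finset (Site d)) (F : Config d E → ℝ) :
    ∫ S, F S ∂(fieldMeasure Φ β g μ₀ h Λ)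
      = (∫ S, Real.exp (fieldExponent Φ β g h Λ S) * F S ∂(freeMeasure d μ₀))
        / ∫ S, Real.exp (fieldExponent Φ β g h Λ S) ∂(freeMeasure d μ₀) := by
  rw [fieldMeasure, integral_tilted, ← integral_div]
  congr 1
  funext S
  rw [smul_eq_mul]; ring

variable [IsProbabilityMeasure μ₀]

lemma IsInteraction.fieldExponent_shift (hΦ : IsInteraction Φ) (h : ℝ) (Λ : Finset (Site d))
    (x : Site d) (S : Config d E) :
    fieldExponent Φ β g h Λ (shift (-x) S) = fieldExponent Φ β g h (translate x Λ) S := by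
  rw [fieldExponent, fieldExponent, hΦ.hamiltonian_shift, sum_shift_translate]

lemma IsInteraction.isProbabilityMeasure_fieldMeasure (hΦ : IsInteraction Φ)
    (hg : IsBoundedMeasurable g) (h : ℝ) (Λ : Finset (Site d)) :
    IsProbabilityMeasure (fieldMeasure Φ β g μ₀ h Λ) :=
  isProbabilityMeasure_tilted
    ((hΦ.isBoundedMeasurable_fieldExponent hg h Λ).exp.integrable (freeMeasure d μ₀))

lemma IsInteraction.integral_fieldMeasure_shift (hΦ : IsInteraction Φ)
    (hg : IsBoundedMeasurable g) (h : ℝ) (Λ : Finset (Site d)) (x : Site d)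
    {F : Config d E → ℝ} (hF : Measurable F) :
    ∫ S, F (shift (-x) S) ∂(fieldMeasure Φ β g μ₀ h Λ)
      = ∫ S, F S ∂(fieldMeasure Φ β g μ₀ h (translate (-x) Λ)) := by
  have hshift : ∀ S : Config d E, fieldExponent Φ β g h Λ S
      = fieldExponent Φ β g h (translate (-x) Λ) (shift (-x) S) := by
    intro S
    rw [← hΦ.fieldExponent_shift, shift_shift, neg_add_cancel, shift_zero]
  have hm := (hΦ.isBoundedMeasurable_fieldExponent (β := β) hg h (translate (-x) Λ)).exp.measurable
  rw [integral_fieldMeasure, integral_fieldMeasure]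
  simp only [hshift]
  rw [integral_freeMeasure_shift μ₀ (-x)
    (F := fun S => Real.exp (fieldExponent Φ β g h (translate (-x) Λ) S) * F S) (hm.mul hF),
    integral_freeMeasure_shift μ₀ (-x) hm]

lemma box_nonempty {L : ℕ} (hL : 0 < L) : (box d L).Nonempty := by
  rw [← Finset.card_pos, card_box]; positivity

lemma IsInteraction.isProbabilityMeasure_averagedMeasure (hΦ : IsInteraction Φ)
    (hg : IsBoundedMeasurable g) (h : ℝ) {L : ℕ} (hL : 0 < L) :
    IsProbabilityMeasure (averagedMeasure Φ β g μ₀ h L) := by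
  have := fun Λ => hΦ.isProbabilityMeasure_fieldMeasure (β := β) (μ₀ := μ₀) hg h Λ
  refine ⟨?_⟩
  rw [averagedMeasure, Measure.smul_apply, Measure.finsetSum_apply]
  simp only [measure_univ, Finset.sum_const, nsmul_eq_mul, mul_one, smul_eq_mul]
  exact ENNReal.inv_mul_cancel (by simpa using (box_nonempty hL).ne_empty) (by simp)

lemma IsInteraction.integral_averagedMeasure (hΦ : IsInteraction Φ)
    (hg : IsBoundedMeasurable g) (h : ℝ) (L : ℕ) {F : Config d E → ℝ}
    (hF : IsBoundedMeasurable F) : ∫ S, F S ∂(averagedMeasure Φ β g μ₀ h L)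
      = (L ^ d : ℝ)⁻¹ * ∑ x ∈ box d L,
        ∫ S, F S ∂(fieldMeasure Φ β g μ₀ h (translate (-x) (box d L))) := by
  have := fun Λ => hΦ.isProbabilityMeasure_fieldMeasure (β := β) (μ₀ := μ₀) hg h Λ
  rw [averagedMeasure, integral_smul_measure,
    integral_finsetSum_measure fun x _ => hF.integrable _, card_box]
  simp

/-- Jensen's inequality bounds the magnetization from below by the free-energy difference. -/
lemma IsInteraction.le_mul_integral_averagedMeasure (hΦ : IsInteraction Φ)
    (hg : IsBoundedMeasurable g) (h : ℝ) {L : ℕ} (hL : 0 < L) :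
    1 / (L : ℝ) ^ d * logPartition Φ β g μ₀ h (box d L)
      - 1 / (L : ℝ) ^ d * logPartition Φ β g μ₀ 0 (box d L)
      ≤ h * ∫ S, g S ∂(averagedMeasure Φ β g μ₀ h L) := by
  have hLd : (0 : ℝ) < (L : ℝ) ^ d := by positivity
  have := hΦ.isProbabilityMeasure_fieldMeasure (β := β) (μ₀ := μ₀) hg h (box d L)
  have hX := isBoundedMeasurable_sum_shift hg (box d L)
  -- Jensen's inequality is applied to -h times the sum of translates of `g`: this extra tilt
  -- removes the field, so the exponential moment is the partition function at 0 divided by that at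
  -- h.
  have hJ := integral_le_log_integral_exp (fieldMeasure Φ β g μ₀ h (box d L)) (hX.const_mul (-h))
  have hbm := fun h => hΦ.isBoundedMeasurable_fieldExponent (β := β) hg h (box d L)
  rw [integral_fieldMeasure h (box d L) fun S => Real.exp _] at hJ
  simp only [← Real.exp_add] at hJ
  rw [Real.log_div, integral_const_mul] at hJ
  · have h0 : ∀ S, fieldExponent Φ β g h (box d L) S + -h * ∑ x ∈ box d L, g (shift (-x) S)
        = fieldExponent Φ β g 0 (box d L) S := fun S => by simp [fieldExponent]
    simp only [h0] at hJ
    rw [hΦ.integral_averagedMeasure hg h L hg]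
    simp only [← hΦ.integral_fieldMeasure_shift hg h (box d L) _ hg.measurable]
    rw [← integral_finsetSum _ fun x _ => (hg.comp (measurable_shift (-x))).integrable _,
      ← mul_sub, one_div, mul_left_comm]
    refine mul_le_mul_of_nonneg_left ?_ (inv_pos.2 hLd).le
    simp only [logPartition]
    linarith
  · have h0 := ((hbm h).add (hX.const_mul (-h))).integral_exp_pos (freeMeasure d μ₀)
    exact h0.ne'
  · exact ((hbm h).integral_exp_pos _).ne'

/-- Shifting the test function only moves the average to the translates by x + y, so invariance
fails merely through the boundary of the box. -/
lemma IsInteraction.abs_integral_averagedMeasure_shift_sub_le (hΦ : IsInteraction Φ)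
    (hg : IsBoundedMeasurable g) (h : ℝ) {L : ℕ} (hL : 0 < L) {F : Config d E → ℝ}
    (hF : IsBoundedMeasurable F) {C : ℝ} (hC : ∀ S, |F S| ≤ C) (y : Site d) :
    |∫ S, F (shift (-y) S) ∂(averagedMeasure Φ β g μ₀ h L)
      - ∫ S, F S ∂(averagedMeasure Φ β g μ₀ h L)| ≤ 2 * C * boundaryFraction {y} L := by
  have hprob := fun Λ => hΦ.isProbabilityMeasure_fieldMeasure (β := β) (μ₀ := μ₀) hg h Λ
  rw [hΦ.integral_averagedMeasure hg h L (hF.comp (measurable_shift (-y))),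
    hΦ.integral_averagedMeasure hg h L hF, ← mul_sub]
  have htr : ∀ x, translate (-y) (translate (-x) (box d L)) = translate (-(x + y)) (box d L) := by
    intro x
    ext z
    rw [mem_translate, mem_translate, mem_translate]
    congr! 1
    abel
  simp only [hΦ.integral_fieldMeasure_shift hg h _ _ hF.measurable, htr]
  refine abs_sum_translate_sub_le hL
    (a := fun x => ∫ S, F S ∂(fieldMeasure Φ β g μ₀ h (translate (-x) (box d L)))) (fun x => ?_) y
  exact abs_integral_le_of_abs_le _ hC

/-- The measure with field has its own exact conditional averages in `Δ`. They differ from the Gibbs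
ones only through the translates of `g` that see `Δ`, that is by y in Δ - D, and each of these
varies by at most 2G. The error is thus governed by |h| and independent of `Λ`. -/
lemma IsInteraction.abs_integral_condAvg_fieldMeasure_sub_le (hΦ : IsInteraction Φ)
    (hg : IsBoundedMeasurable g) {G : ℝ} (hG : ∀ S, |g S| ≤ G) {D : Finset (Site d)}
    (hD : DependsOn g (D : Set (Site d))) (h : ℝ) {Δ Λ : Finset (Site d)} (hΔ : Δ ⊆ Λ)
    {F : Config d E → ℝ} (hF : IsBoundedMeasurable F) {C : ℝ} (hC : ∀ S, |F S| ≤ C) {δ : ℝ}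
    (hδ : |h| * ((Finset.image₂ (· - ·) Δ D).card * (2 * G)) ≤ δ) :
    |∫ S, condAvg μ₀ (fun S => -β * hamiltonian Φ Δ S) Δ F S ∂(fieldMeasure Φ β g μ₀ h Λ)
      - ∫ S, F S ∂(fieldMeasure Φ β g μ₀ h Λ)| ≤ 2 * C * (Real.exp δ - 1) * Real.exp δ := by
  have := hΦ.isProbabilityMeasure_fieldMeasure (β := β) (μ₀ := μ₀) hg h Λ
  have hV := hΦ.isBoundedMeasurable_fieldExponent (β := β) hg h Λ
  have hV' := hΦ.isBoundedMeasurable_exponent β Δ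
  have hdlr : ∫ S, F S ∂(fieldMeasure Φ β g μ₀ h Λ)
      = ∫ S, condAvg μ₀ (fieldExponent Φ β g h Λ) Δ F S ∂(fieldMeasure Φ β g μ₀ h Λ) :=
    (integral_tilted_condAvg μ₀ hV hF).symm
  rw [hdlr]
  refine abs_integral_sub_le _ (hF.condAvg μ₀ hV') (hF.condAvg μ₀ hV) fun S => ?_
  rw [abs_sub_comm]
  obtain ⟨R, hR, hHR⟩ := hΦ.hamiltonian_of_subset hΔ
  refine condAvg_congr_exponent μ₀ hF hC hV hV'
    (a := -β * R S + h * ∑ y ∈ Λ, g (shift (-y) S)) fun T => ?_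
  have h1 : fieldExponent Φ β g h Λ (glue Δ T S)
      - (-β * hamiltonian Φ Δ (glue Δ T S) + (-β * R S + h * ∑ y ∈ Λ, g (shift (-y) S)))
      = h * ∑ y ∈ Λ, (g (shift (-y) (glue Δ T S)) - g (shift (-y) S)) := by
    rw [fieldExponent, hHR, apply_glue_of_dependsOn hR, Finset.sum_sub_distrib]; ring
  rw [h1, abs_mul]
  refine (mul_le_mul_of_nonneg_left ?_ (abs_nonneg h)).trans hδ
  have hG0 : 0 ≤ G := (abs_nonneg _).trans (hG S)
  classical
  have hzero : ∀ y, y ∉ Finset.image₂ (· - ·) Δ D →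
      g (shift (-y) (glue Δ T S)) - g (shift (-y) S) = 0 := by
    intro y hy
    rw [sub_eq_zero]
    refine hD fun z hz => ?_
    rw [shift_neg_apply, shift_neg_apply, glue_of_notMem]
    intro hcon
    exact hy (Finset.mem_image₂.2 ⟨z + y, hcon, z, hz, add_sub_cancel_left z y⟩)
  rw [← Finset.sum_filter_of_ne (p := fun y => y ∈ Finset.image₂ (· - ·) Δ D) fun y _ hne => by
    by_contra hcon; exact hne (hzero y hcon)]
  refine (Finset.abs_sum_le_sum_abs _ _).trans ((Finset.sum_le_card_nsmul _ _ (2 * G)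
    fun y _ => ?_).trans ?_)
  · refine (abs_sub _ _).trans ?_
    linarith [hG (shift (-y) (glue Δ T S)), hG (shift (-y) S)]
  · rw [nsmul_eq_mul]
    refine mul_le_mul_of_nonneg_right ?_ (by positivity)
    exact_mod_cast Finset.card_le_card fun y hy => (Finset.mem_filter.1 hy).2

/-- For the sites x with x + Δ inside the box, the translate of the box by -x contains `Δ` and the
previous estimate applies. The remaining sites are a boundary fraction and are bounded trivially. -/
lemma IsInteraction.abs_integral_condAvg_averagedMeasure_sub_le (hΦ : IsInteraction Φ)
    (hg : IsBoundedMeasurable g) {G : ℝ} (hG : ∀ S, |g S| ≤ G) {D : Finset (Site d)}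
    (hD : DependsOn g (D : Set (Site d))) (h : ℝ) {L : ℕ} (hL : 0 < L) (Δ : Finset (Site d))
    {F : Config d E → ℝ} (hF : IsBoundedMeasurable F) {C : ℝ} (hC : ∀ S, |F S| ≤ C) {δ : ℝ}
    (hδ : |h| * ((Finset.image₂ (· - ·) Δ D).card * (2 * G)) ≤ δ) :
    |∫ S, condAvg μ₀ (fun S => -β * hamiltonian Φ Δ S) Δ F S ∂(averagedMeasure Φ β g μ₀ h L)
      - ∫ S, F S ∂(averagedMeasure Φ β g μ₀ h L)|
      ≤ 2 * C * (Real.exp δ - 1) * Real.exp δ + 2 * C * boundaryFraction Δ L := by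
  have hprob := fun Λ => hΦ.isProbabilityMeasure_fieldMeasure (β := β) (μ₀ := μ₀) hg h Λ
  have hV' := hΦ.isBoundedMeasurable_exponent β Δ
  have hA := hF.condAvg μ₀ hV' (Λ := Δ)
  obtain ⟨S₀⟩ := nonempty_of_isProbabilityMeasure (freeMeasure d μ₀)
  have hC0 : 0 ≤ C := (abs_nonneg _).trans (hC S₀)
  have hG0 : 0 ≤ G := (abs_nonneg _).trans (hG S₀)
  have hδ0 : 0 ≤ δ := le_trans (by positivity) hδ
  have h1 : 0 ≤ Real.exp δ - 1 := by linarith [Real.one_le_exp hδ0]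
  rw [hΦ.integral_averagedMeasure hg h L hA, hΦ.integral_averagedMeasure hg h L hF, ← mul_sub,
    ← Finset.sum_sub_distrib]
  refine abs_sum_le_of_filter_boundary hL (by positivity) (fun x hx hxD => ?_) fun x => ?_
  · refine hΦ.abs_integral_condAvg_fieldMeasure_sub_le hg hG hD h (fun y hy => ?_) hF hC hδ
    rw [mem_translate, sub_neg_eq_add, add_comm]
    exact hxD y hy
  · have h2 := abs_integral_le_of_abs_le (fieldMeasure Φ β g μ₀ h (translate (-x) (box d L))) hC
    have h3 := abs_integral_le_of_abs_le (fieldMeasure Φ β g μ₀ h (translate (-x) (box d L)))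
      (abs_condAvg_le μ₀ hF hV' hC (Λ := Δ))
    refine (abs_sub _ _).trans ?_
    linarith

/-- Translation invariance may be checked on the expectations of local functions. -/
lemma isTranslationInvariant_of_integral {μ : Measure (Config d E)} [IsProbabilityMeasure μ]
    (h : ∀ F : Config d E → ℝ, IsBoundedLocal F → ∀ y : Site d,
      ∫ S, F (shift (-y) S) ∂μ = ∫ S, F S ∂μ) : IsTranslationInvariant μ := by
  intro x
  refine ⟨measurable_shift x, ?_⟩
  have := Measure.isProbabilityMeasure_map (μ := μ) (measurable_shift (E := E) x).aemeasurable
  refine ext_of_generate_finite (measurableCylinders fun _ : Site d => E)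
    generateFrom_measurableCylinders.symm isPiSystem_measurableCylinders (fun B hB => ?_) (by simp)
  have hBm : MeasurableSet B := .of_mem_measurableCylinders hB
  have h1 := h _ (isBoundedLocal_indicator hB) (-x)
  rw [neg_neg, integral_indicator_one_real _ hBm, ← integral_map
    (φ := shift x) (f := B.indicator fun _ => (1 : ℝ)) (measurable_shift x).aemeasurable
    (isBoundedMeasurable_indicator hBm).measurable.aestronglyMeasurable,
    integral_indicator_one_real _ hBm] at h1
  exact (measureReal_eq_measureReal_iff).1 h1

lemma IsBoundedLocal.comp_shift {F : Config d E → ℝ} (hF : IsBoundedLocal F) (y : Site d) :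
    IsBoundedLocal fun S => F (shift (-y) S) := by
  obtain ⟨D, hD⟩ := hF.isLocal
  refine ⟨hF.measurable.comp (measurable_shift (-y)), ?_, translate y D, fun S S' h => ?_⟩
  · obtain ⟨C, hC⟩ := hF.bounded
    exact ⟨C, fun S => hC _⟩
  · refine hD fun z hz => ?_
    rw [shift_neg_apply, shift_neg_apply]
    exact h _ (Finset.mem_coe.2 (mem_translate.2 (by simpa using hz)))

variable [TopologicalSpace E] [PolishSpace E] [BorelSpace E]

/-- There is a translation-invariant Gibbs measure whose expectation of `g` is at least the slope
of the free energy. -/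
theorem exists_isGibbs_le_integral (hΦ : IsInteraction Φ) (hg : IsBoundedLocal g) {p : ℝ → ℝ}
    (hp : ∀ h, Tendsto (fun L : ℕ => 1 / (L : ℝ) ^ d * logPartition Φ β g μ₀ h (box d L)) atTop
      (𝓝 (p h))) {m : ℝ} (hm : ∀ h > 0, h * m ≤ p h - p 0) :
    ∃ μ : Measure (Config d E), IsGibbs Φ β μ₀ μ ∧ IsTranslationInvariant μ ∧
      m ≤ ∫ S, g S ∂μ := by
  have hgb := hg.isBoundedMeasurable
  obtain ⟨G, hG⟩ := hg.bounded
  obtain ⟨D, hD⟩ := hg.isLocal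
  -- At field h = 1 / (k + 1) the limiting difference is at least h * m, so some box of side larger
  -- than k has finite-volume difference above h * m - h * h. Dividing by h leaves an error h, which
  -- tends to 0.
  have hchoose : ∀ k : ℕ, ∃ L : ℕ, k < L ∧ m - 1 / ((k : ℝ) + 1)
      ≤ ∫ S, g S ∂(averagedMeasure Φ β g μ₀ (1 / ((k : ℝ) + 1)) L) := by
    intro k
    set h : ℝ := 1 / ((k : ℝ) + 1)
    have hh : 0 < h := by positivity
    have hlt : h * m - h * h < p h - p 0 := by nlinarith [hm h hh]
    obtain ⟨L, h1, h2⟩ := ((((hp h).sub (hp 0)).eventually (lt_mem_nhds hlt)).and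
      (eventually_gt_atTop k)).exists
    refine ⟨L, h2, ?_⟩
    have h3 := hΦ.le_mul_integral_averagedMeasure (β := β) (μ₀ := μ₀) hgb h
      (Nat.zero_lt_of_lt h2)
    refine le_of_mul_le_mul_left ?_ hh
    rw [mul_sub]
    linarith
  choose L hkL hLm using hchoose
  have hLpos : ∀ k, 0 < L k := fun k => Nat.zero_lt_of_lt (hkL k)
  have hLlim : Tendsto L atTop atTop := tendsto_atTop_mono (fun k => (hkL k).le) tendsto_id
  have hhlim : Tendsto (fun k : ℕ => 1 / ((k : ℝ) + 1)) atTop (𝓝 0) :=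
    tendsto_one_div_add_atTop_nhds_zero_nat
  have hprob : ∀ k : ℕ, IsProbabilityMeasure (averagedMeasure Φ β g μ₀ (1 / ((k : ℝ) + 1)) (L k)) :=
    fun k => hΦ.isProbabilityMeasure_averagedMeasure hgb _ (hLpos k)
  have hle : ((hyperfilter ℕ : Ultrafilter ℕ) : Filter ℕ) ≤ atTop := Nat.hyperfilter_le_atTop
  obtain ⟨μ, hμ, hconv⟩ := exists_isGibbs_limit (β := β) (μ₀ := μ₀) hΦ (hyperfilter ℕ)
    (fun k : ℕ => averagedMeasure Φ β g μ₀ (1 / ((k : ℝ) + 1)) (L k)) (fun Δ F hF => by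
      obtain ⟨C, hC⟩ := hF.bounded
      refine Tendsto.mono_left ?_ hle
      have hlim : Tendsto (fun k : ℕ => 2 * C
          * (Real.exp (|1 / ((k : ℝ) + 1)| * ((Finset.image₂ (· - ·) Δ D).card * (2 * G))) - 1)
          * Real.exp (|1 / ((k : ℝ) + 1)| * ((Finset.image₂ (· - ·) Δ D).card * (2 * G)))
          + 2 * C * boundaryFraction Δ (L k)) atTop (𝓝 0) := by
        have hc : Continuous fun h : ℝ => 2 * C
          * (Real.exp (|h| * ((Finset.image₂ (· - ·) Δ D).card * (2 * G))) - 1)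
          * Real.exp (|h| * ((Finset.image₂ (· - ·) Δ D).card * (2 * G))) := by fun_prop
        have h1 := ((hc.tendsto 0).comp hhlim).add
          (((tendsto_boundaryFraction Δ).comp hLlim).const_mul (2 * C))
        simpa using h1
      exact squeeze_zero_norm (fun k => hΦ.abs_integral_condAvg_averagedMeasure_sub_le hgb hG hD _
        (hLpos k) Δ hF hC le_rfl) hlim)
  have := hμ.isProbability
  refine ⟨μ, hμ, isTranslationInvariant_of_integral fun F hF y => ?_, ?_⟩
  · obtain ⟨C, hC⟩ := hF.bounded
    have h1 := (hconv _ (hF.comp_shift y)).sub (hconv F hF)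
    have h2 : Tendsto (fun k : ℕ => 2 * C * boundaryFraction {y} (L k)) (hyperfilter ℕ) (𝓝 0) := by
      have := ((tendsto_boundaryFraction {y}).comp hLlim).const_mul (2 * C)
      rw [mul_zero] at this
      exact this.mono_left hle
    have h3 := squeeze_zero_norm (fun k : ℕ => (Real.norm_eq_abs _).trans_le
      (hΦ.abs_integral_averagedMeasure_shift_sub_le (β := β) (μ₀ := μ₀) hgb (1 / ((k : ℝ) + 1))
        (hLpos k) hF.isBoundedMeasurable hC y)) h2
    exact sub_eq_zero.1 (tendsto_nhds_unique h1 h3)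
  · have h1 : Tendsto (fun k : ℕ => m - 1 / ((k : ℝ) + 1)) (hyperfilter ℕ) (𝓝 m) := by
      have := hhlim.const_sub m
      rw [sub_zero] at this
      exact this.mono_left hle
    exact le_of_tendsto_of_tendsto' h1 (hconv g hg) hLm

end

/-! ### Conditioning on invariant events, extreme points and ergodicity -/

section

open scoped symmDiff

variable {d : ℕ} {E : Type*} [MeasurableSpace E]

lemma integral_cond {X : Type*} [MeasurableSpace X] (μ : Measure X) [IsFiniteMeasure μ] {B : Set X}
    (hB : MeasurableSet B) (F : X → ℝ) :
    ∫ x, F x ∂(μ[|B]) = (μ.real B)⁻¹ * ∫ x, B.indicator (fun _ => 1) x * F x ∂μ := by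
  rw [ProbabilityTheory.cond, integral_smul_measure, integral_indicator_one_mul μ hB, smul_eq_mul,
    ENNReal.toReal_inv]
  rfl

lemma abs_integral_indicator_sub_le {X : Type*} [MeasurableSpace X] (μ : Measure X)
    [IsFiniteMeasure μ] {A B : Set X} (hA : MeasurableSet A) (hB : MeasurableSet B) {F : X → ℝ}
    (hF : IsBoundedMeasurable F) {C : ℝ} (hC : ∀ x, |F x| ≤ C) :
    |∫ x, A.indicator (fun _ => 1) x * F x ∂μ - ∫ x, B.indicator (fun _ => 1) x * F x ∂μ|
      ≤ C * μ.real (A ∆ B) := by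
  have hA' := isBoundedMeasurable_indicator hA
  have hB' := isBoundedMeasurable_indicator hB
  have hAB : MeasurableSet (A ∆ B) := hA.symmDiff hB
  rw [← integral_sub ((hA'.mul hF).integrable μ) ((hB'.mul hF).integrable μ),
    ← integral_indicator_one_real μ hAB, ← integral_const_mul]
  refine abs_integral_le_integral_abs.trans (integral_mono
    (((hA'.mul hF).sub (hB'.mul hF)).integrable μ).abs
    (((isBoundedMeasurable_indicator hAB).const_mul C).integrable μ) fun x => ?_)
  have := hC x
  by_cases h1 : x ∈ A <;> by_cases h2 : x ∈ B <;> simp [h1, h2, Set.mem_symmDiff, this]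

lemma IsTranslationInvariant.cond {μ : Measure (Config d E)} (hμ : IsTranslationInvariant μ)
    {B : Set (Config d E)} (hB : MeasurableSet B) (hinv : ∀ x : Site d, shift x ⁻¹' B = B) :
    IsTranslationInvariant (μ[|B]) := by
  intro x
  have h := (hμ x).restrict_preimage hB
  rw [hinv x] at h
  exact h.smul_measure _

/-- A translation-invariant event is approximated by local events outside a given finite set. -/
lemma IsTranslationInvariant.exists_symmDiff_lt (hd : 1 ≤ d) {μ : Measure (Config d E)}
    [IsFiniteMeasure μ] (hμ : IsTranslationInvariant μ) {B : Set (Config d E)}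
    (hB : MeasurableSet B) (hinv : ∀ x : Site d, shift x ⁻¹' B = B) (Λ : Finset (Site d))
    {ε : ℝ} (hε : 0 < ε) :
    ∃ A, MeasurableSet A ∧ DependsOn (A.indicator fun _ => (1 : ℝ)) ((Λ : Set (Site d))ᶜ) ∧
      μ.real (A ∆ B) ≤ ε := by
  -- First `B` is approximated by a cylinder. As `μ` is finite, the whole space alone serves as the
  -- required countable cover by sets of finite measure.
  obtain ⟨A, hA, hAB⟩ := exists_measure_symmDiff_lt_of_generateFrom_isSetRing (μ := μ)
    (C := measurableCylinders fun _ : Site d => E) isSetRing_measurableCylinders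
    ⟨{Set.univ}, Set.countable_singleton _,
      Set.singleton_subset_iff.2 (univ_mem_measurableCylinders _), by simp⟩
    generateFrom_measurableCylinders.symm hB (ENNReal.ofReal_pos.2 hε)
  have hAm : MeasurableSet A := .of_mem_measurableCylinders hA
  obtain ⟨D, hD⟩ := (isBoundedLocal_indicator hA).isLocal
  have : NeZero d := ⟨by omega⟩
  classical
  -- For x outside Λ - D the translate D + x misses `Λ`. Such x exists since the lattice is
  -- infinite, which uses d ≥ 1. The invariance of `B` and `μ` preserves the approximation error.
  obtain ⟨x, hx⟩ := Infinite.exists_notMem_finset (Finset.image₂ (· - ·) Λ D)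
  refine ⟨shift (-x) ⁻¹' A, measurable_shift _ hAm, fun S S' h => ?_, ?_⟩
  · refine hD (x := shift (-x) S) (y := shift (-x) S') fun z hz => ?_
    rw [shift_neg_apply, shift_neg_apply]
    refine h _ fun hcon => hx (Finset.mem_image₂.2 ⟨z + x, hcon, z, hz, add_sub_cancel_left z x⟩)
  · have h1 : (shift (-x) ⁻¹' A) ∆ B = shift (-x) ⁻¹' (A ∆ B) := by
      rw [Set.preimage_symmDiff, hinv]
    rw [h1, measureReal_def, (hμ (-x)).measure_preimage (hAm.symmDiff hB).nullMeasurableSet]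
    exact ENNReal.toReal_le_of_le_ofReal hε.le hAB.le

variable {Φ : Finset (Site d) → Config d E → ℝ} {β : ℝ} {μ₀ : Measure E} [IsProbabilityMeasure μ₀]

/-- Conditioning on a translation-invariant event preserves the Gibbs property. -/
lemma IsGibbs.cond (hd : 1 ≤ d) (hΦ : IsInteraction Φ) {μ : Measure (Config d E)}
    (hμ : IsGibbs Φ β μ₀ μ) (hti : IsTranslationInvariant μ) {B : Set (Config d E)}
    (hB : MeasurableSet B) (hinv : ∀ x : Site d, shift x ⁻¹' B = B) (hB0 : μ B ≠ 0) :
    IsGibbs Φ β μ₀ (μ[|B]) := by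
  have := hμ.isProbability
  have := cond_isProbabilityMeasure hB0
  refine isGibbs_of_integral_condAvg hΦ fun Λ C hC => ?_
  have hCm : MeasurableSet C := .of_mem_measurableCylinders hC
  have hF := isBoundedMeasurable_indicator hCm
  have hV := hΦ.isBoundedMeasurable_exponent β Λ
  have hA := hF.condAvg μ₀ hV (Λ := Λ)
  have hF1 : ∀ S, |C.indicator (fun _ => (1 : ℝ)) S| ≤ 1 := fun S => by
    by_cases h : S ∈ C <;> simp [h]
  rw [← integral_indicator_one_real _ hCm, integral_cond μ hB, integral_cond μ hB]
  congr 1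
  refine eq_of_abs_sub_le_all fun ε hε => ?_
  -- The indicator of `B` cannot be pulled through the conditional average in `Λ`, but that of `A`
  -- can. Each exchange costs at most ε / 2.
  obtain ⟨A, hAm, hAΛ, hAB⟩ := hti.exists_symmDiff_lt hd hB hinv Λ (half_pos hε)
  have h1 := abs_integral_indicator_sub_le μ hAm hB hA (abs_condAvg_le μ₀ hF hV hF1 (Λ := Λ))
  have h2 := abs_integral_indicator_sub_le μ hAm hB hF hF1
  have h3 := hμ.integral_condAvg hΦ Λ ((isBoundedMeasurable_indicator hAm).mul hF)
  simp only [condAvg_mul_of_dependsOn μ₀ hAΛ] at h3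
  rw [h3] at h1
  rw [abs_sub_comm] at h1
  linarith [abs_sub_le (∫ x, B.indicator (fun _ => (1 : ℝ)) x
    * condAvg μ₀ (fun S => -β * hamiltonian Φ Λ S) Λ (C.indicator fun _ => 1) x ∂μ)
    (∫ x, A.indicator (fun _ => (1 : ℝ)) x * C.indicator (fun _ => 1) x ∂μ)
    (∫ x, B.indicator (fun _ => (1 : ℝ)) x * C.indicator (fun _ => 1) x ∂μ)]

/-- The values of a measure on cylinders. -/
def cylinderValues (μ : Measure (Config d E)) :
    measurableCylinders (fun _ : Site d => E) → ℝ := fun B => μ.real B.1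

lemma cylinderValues_injective {μ μ' : Measure (Config d E)} [IsProbabilityMeasure μ]
    [IsProbabilityMeasure μ'] (h : cylinderValues μ = cylinderValues μ') : μ = μ' :=
  ext_of_generate_finite (measurableCylinders fun _ : Site d => E)
    generateFrom_measurableCylinders.symm isPiSystem_measurableCylinders
    (fun B hB => (measureReal_eq_measureReal_iff).1 (congrFun h ⟨B, hB⟩)) (by simp)

variable (Φ β μ₀) in
/-- The translation-invariant Gibbs measures with a given expectation of `g`. -/
def invariantGibbs (g : Config d E → ℝ) (m : ℝ) : Set (Measure (Config d E)) :=
  {μ | IsGibbs Φ β μ₀ μ ∧ IsTranslationInvariant μ ∧ ∫ S, g S ∂μ = m}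

/-- Extreme points of the set of translation-invariant Gibbs measures that maximize the expectation
of `g` are ergodic. -/
lemma isErgodic_of_mem_extremePoints (hd : 1 ≤ d) (hΦ : IsInteraction Φ) {g : Config d E → ℝ}
    (hg : IsBoundedMeasurable g) {m : ℝ} (hm : ∀ μ : Measure (Config d E), IsGibbs Φ β μ₀ μ →
      IsTranslationInvariant μ → ∫ S, g S ∂μ ≤ m) {μ : Measure (Config d E)}
    (hμ : μ ∈ invariantGibbs Φ β μ₀ g m)
    (hext : cylinderValues μ ∈
      Set.extremePoints ℝ (cylinderValues '' invariantGibbs Φ β μ₀ g m)) : IsErgodic μ := by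
  obtain ⟨hG, hti, hint⟩ := hμ
  have hprob := hG.isProbability
  refine ⟨hprob, hti, fun B hB hinv => ?_⟩
  by_contra! hcon
  obtain ⟨hB0, hB1⟩ := hcon
  have hBc0 : μ Bᶜ ≠ 0 := fun h => hB1 ((prob_compl_eq_zero_iff hB).1 h)
  have hinvc : ∀ x : Site d, shift x ⁻¹' Bᶜ = Bᶜ := fun x => by
    rw [Set.preimage_compl, hinv]
  have hG1 := hG.cond hd hΦ hti hB hinv hB0
  have hG2 := hG.cond hd hΦ hti hB.compl hinvc hBc0
  have hT1 := hti.cond hB hinv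
  have hT2 := hti.cond hB.compl hinvc
  have hp1 := hG1.isProbability
  have hp2 := hG2.isProbability
  have hb : 0 < μ.real B := ENNReal.toReal_pos hB0 (measure_ne_top _ _)
  have hbc : 0 < μ.real Bᶜ := ENNReal.toReal_pos hBc0 (measure_ne_top _ _)
  have hsum : μ.real B + μ.real Bᶜ = 1 := probReal_add_probReal_compl hB
  have hdecomp : ∀ F : Config d E → ℝ, IsBoundedMeasurable F →
      μ.real B * ∫ S, F S ∂(μ[|B]) + μ.real Bᶜ * ∫ S, F S ∂(μ[|Bᶜ]) = ∫ S, F S ∂μ := by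
    intro F hF
    rw [integral_cond μ hB, integral_cond μ hB.compl, mul_inv_cancel_left₀ hb.ne',
      mul_inv_cancel_left₀ hbc.ne', integral_indicator_one_mul μ hB,
      integral_indicator_one_mul μ hB.compl]
    exact integral_add_compl hB (hF.integrable μ)
  have hle1 := hm _ hG1 hT1
  have hle2 := hm _ hG2 hT2
  have hg' := hdecomp g hg
  rw [hint] at hg'
  -- The conditional expectations of `g` are at most m and average to m with positive weights, so
  -- both equal m. Hence both conditioned measures are again maximizers.
  have hmm : μ.real B * m + μ.real Bᶜ * m = m := by rw [← add_mul, hsum, one_mul]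
  have he1 : ∫ S, g S ∂(μ[|B]) = m := by
    refine le_antisymm hle1 ?_
    by_contra! hlt
    linarith [mul_lt_mul_of_pos_left hlt hb, mul_le_mul_of_nonneg_left hle2 hbc.le]
  have he2 : ∫ S, g S ∂(μ[|Bᶜ]) = m := by
    refine le_antisymm hle2 ?_
    by_contra! hlt
    linarith [mul_lt_mul_of_pos_left hlt hbc, mul_le_mul_of_nonneg_left hle1 hb.le]
  have hseg : cylinderValues μ ∈ openSegment ℝ (cylinderValues (μ[|B]))
      (cylinderValues (μ[|Bᶜ])) := by
    refine ⟨μ.real B, μ.real Bᶜ, hb, hbc, hsum, funext fun A => ?_⟩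
    have hA : MeasurableSet A.1 := .of_mem_measurableCylinders A.2
    have := hdecomp _ (isBoundedMeasurable_indicator hA)
    simp only [integral_indicator_one_real _ hA] at this
    exact this
  have heq := ((mem_extremePoints.1 hext).2 _ ⟨_, ⟨hG1, hT1, he1⟩, rfl⟩ _
    ⟨_, ⟨hG2, hT2, he2⟩, rfl⟩ hseg).1
  have hμ1 := cylinderValues_injective heq
  have h1 : (μ[|B]) B = 1 := by
    rw [cond_apply hB, Set.inter_self, ENNReal.inv_mul_cancel hB0 (measure_ne_top _ _)]
  rw [hμ1] at h1
  exact hB1 h1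

variable [TopologicalSpace E] [PolishSpace E] [BorelSpace E]

/-- Lift an ultrafilter on the image to a family of measures. Each is exactly invariant under
resampling, so `exists_isGibbs_limit` gives a limit, and invariance and the expectation of `g` pass
to it because they involve only local functions. -/
lemma isCompact_cylinderValues_invariantGibbs (hΦ : IsInteraction Φ) {g : Config d E → ℝ}
    (hg : IsBoundedLocal g) (m : ℝ) (hne : (invariantGibbs Φ β μ₀ g m).Nonempty) :
    IsCompact (cylinderValues '' invariantGibbs Φ β μ₀ g m) := by
  rw [isCompact_iff_ultrafilter_le_nhds]
  intro 𝒰 h𝒰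
  obtain ⟨μ₁, hμ₁⟩ := hne
  -- Points outside the image are lifted to the fixed element `μ₁`. The ultrafilter contains the
  -- image, so these values do not affect the limit.
  have hsec : ∀ y : measurableCylinders (fun _ : Site d => E) → ℝ, ∃ μ ∈ invariantGibbs Φ β μ₀ g m,
      y ∈ cylinderValues '' invariantGibbs Φ β μ₀ g m → cylinderValues μ = y := by
    intro y
    by_cases hy : y ∈ cylinderValues '' invariantGibbs Φ β μ₀ g m
    · obtain ⟨μ, hμ, h⟩ := hy
      exact ⟨μ, hμ, fun _ => h⟩
    · exact ⟨μ₁, hμ₁, fun h => absurd h hy⟩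
  choose σ hσ hσy using hsec
  have hprob : ∀ y, IsProbabilityMeasure (σ y) := fun y => (hσ y).1.isProbability
  obtain ⟨μ, hμ, hconv⟩ := exists_isGibbs_limit (β := β) (μ₀ := μ₀) hΦ 𝒰 σ fun Λ F hF => by
    simp only [(hσ _).1.integral_condAvg hΦ Λ hF, sub_self]
    exact tendsto_const_nhds
  have := hμ.isProbability
  refine ⟨cylinderValues μ, ⟨μ, ⟨hμ, isTranslationInvariant_of_integral fun F hF y => ?_, ?_⟩, rfl⟩,
    ?_⟩
  · refine tendsto_nhds_unique (hconv _ (hF.comp_shift y)) ?_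
    simp only [(hσ _).2.1.integral_shift _ hF.measurable]
    exact hconv F hF
  · refine tendsto_nhds_unique (hconv g hg) ?_
    simp only [(hσ _).2.2]
    exact tendsto_const_nhds
  · have : Tendsto id (𝒰 : Filter (measurableCylinders (fun _ : Site d => E) → ℝ))
        (𝓝 (cylinderValues μ)) := by
      rw [tendsto_pi_nhds]
      intro B
      have hB : MeasurableSet B.1 := .of_mem_measurableCylinders B.2
      have h1 := hconv _ (isBoundedLocal_indicator B.2)
      simp only [integral_indicator_one_real _ hB] at h1
      refine h1.congr' (Eventually.filter_mono h𝒰 (eventually_principal.2 fun y hy => ?_))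
      exact congrFun (hσy y hy) B
    exact this

/-- The maximal expectation of `g` is attained at an ergodic Gibbs measure. -/
theorem exists_isErgodic_isGibbs (hd : 1 ≤ d) (hΦ : IsInteraction Φ) {g : Config d E → ℝ}
    (hg : IsBoundedLocal g) {m : ℝ} (hm : ∀ μ : Measure (Config d E), IsGibbs Φ β μ₀ μ →
      IsTranslationInvariant μ → ∫ S, g S ∂μ ≤ m)
    (hne : (invariantGibbs Φ β μ₀ g m).Nonempty) :
    ∃ μ : Measure (Config d E), IsGibbs Φ β μ₀ μ ∧ IsErgodic μ ∧ ∫ S, g S ∂μ = m := by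
  obtain ⟨y, hy⟩ := (isCompact_cylinderValues_invariantGibbs hΦ hg m hne).extremePoints_nonempty
    (hne.image _)
  obtain ⟨μ, hμ, rfl⟩ := extremePoints_subset hy
  exact ⟨μ, hμ.1, isErgodic_of_mem_extremePoints hd hΦ hg.isBoundedMeasurable hm hμ hy, hμ.2.2⟩

end

/-! ### Normalization of the a priori law and assembly of the theorem -/

section

variable {d : ℕ} {E : Type*} [MeasurableSpace E]

lemma pi_const_smul {ι : Type*} [Fintype ι] (ρ : Measure E) [IsFiniteMeasure ρ] {c : ℝ≥0∞}
    (hc : c ≠ ∞) :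
    (Measure.pi fun _ : ι => c • ρ) = c ^ Fintype.card ι • Measure.pi fun _ : ι => ρ := by
  have := ρ.smul_finite hc
  refine Measure.pi_eq fun s _ => ?_
  simp [Measure.pi_pi, Finset.prod_mul_distrib]

variable (Φ : Finset (Site d) → Config d E → ℝ) (β : ℝ)

lemma finiteGibbs_smul (ρ : Measure E) [IsFiniteMeasure ρ] {c : ℝ≥0∞} (hc : c ≠ 0) (hc' : c ≠ ∞)
    (Λ : Finset (Site d)) (S : Config d E) :
    finiteGibbs Φ β (c • ρ) Λ S = finiteGibbs Φ β ρ Λ S := by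
  rw [finiteGibbs, pi_const_smul ρ hc',
    boltzmann_smul _ _ _ (pow_ne_zero _ hc) (ENNReal.pow_ne_top hc'), finiteGibbs]

lemma isGibbs_smul_iff (ρ : Measure E) [IsFiniteMeasure ρ] {c : ℝ≥0∞} (hc : c ≠ 0) (hc' : c ≠ ∞)
    (μ : Measure (Config d E)) : IsGibbs Φ β (c • ρ) μ ↔ IsGibbs Φ β ρ μ := by
  constructor <;> rintro ⟨h1, h2⟩ <;> refine ⟨h1, fun Λ B hB => ?_⟩ <;>
    simpa only [finiteGibbs_smul Φ β ρ hc hc'] using h2 Λ B hB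

lemma torusGibbs_smul {L : ℕ} [NeZero L] (H : (Torus d L → E) → ℝ) (ρ : Measure E)
    [IsFiniteMeasure ρ] {c : ℝ≥0∞} (hc : c ≠ 0) (hc' : c ≠ ∞) :
    torusGibbs H β (c • ρ) = torusGibbs H β ρ := by
  rw [torusGibbs, pi_const_smul ρ hc',
    boltzmann_smul _ _ _ (pow_ne_zero _ hc) (ENNReal.pow_ne_top hc'), torusGibbs]

variable {Φ β} {g : Config d E → ℝ} {μ₀ : Measure E} [IsProbabilityMeasure μ₀]

lemma IsInteraction.exists_tendsto_logPartition (hΦ : IsInteraction Φ) (hg : IsBoundedLocal g) :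
    ∃ p : ℝ → ℝ, ∀ h, Tendsto
      (fun L : ℕ => 1 / (L : ℝ) ^ d * logPartition Φ β g μ₀ h (box d L)) atTop (𝓝 (p h)) :=
  ⟨_, fun h => ((hΦ.isAsymptoticallyLocal_fieldExponent hg h).exists_tendsto_pressure μ₀
    fun _ => hΦ.isBoundedMeasurable_fieldExponent hg.isBoundedMeasurable h _).choose_spec⟩

lemma IsInteraction.convexOn_pressure (hΦ : IsInteraction Φ) (hg : IsBoundedLocal g) {p : ℝ → ℝ}
    (hp : ∀ h, Tendsto
      (fun L : ℕ => 1 / (L : ℝ) ^ d * logPartition Φ β g μ₀ h (box d L)) atTop (𝓝 (p h))) :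
    ConvexOn ℝ Set.univ p :=
  convexOn_of_tendsto (fun L => (convexOn_log_integral_exp (freeMeasure d μ₀)
    (hΦ.isBoundedMeasurable_exponent β (box d L))
    (isBoundedMeasurable_sum_shift hg.isBoundedMeasurable _)).smul (by positivity)) hp

lemma IsInteraction.tendsto_torusFreeEnergy_hamiltonian (hΦ : IsInteraction Φ)
    (hg : IsBoundedLocal g) {p : ℝ → ℝ} (hp : ∀ h, Tendsto
      (fun L : ℕ => 1 / (L : ℝ) ^ d * logPartition Φ β g μ₀ h (box d L)) atTop (𝓝 (p h)))
    (h : ℝ) : Tendsto (fun n : ℕ => torusFreeEnergy g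
      (torusGibbs (torusHamiltonian Φ (n + 1)) β μ₀) h) atTop (𝓝 (p h - p 0)) := by
  have h0 := hp 0
  simp only [logPartition, fieldExponent, zero_mul, add_zero] at h0
  exact tendsto_torusFreeEnergy μ₀ hΦ.isAsymptoticallyLocal_hamiltonian
    (fun L => hΦ.isBoundedMeasurable_hamiltonian _) hg β h (hp h) h0

lemma IsInteraction.tendsto_torusFreeEnergy_periodizedHamiltonian (hΦ : IsInteraction Φ)
    (hg : IsBoundedLocal g) {p : ℝ → ℝ} (hp : ∀ h, Tendsto
      (fun L : ℕ => 1 / (L : ℝ) ^ d * logPartition Φ β g μ₀ h (box d L)) atTop (𝓝 (p h)))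
    (h : ℝ) : Tendsto (fun n : ℕ => torusFreeEnergy g
      (torusGibbs (periodizedHamiltonian Φ (n + 1)) β μ₀) h) atTop (𝓝 (p h - p 0)) := by
  have hVm : ∀ L, IsBoundedMeasurable (proportionalHamiltonian Φ (box d L)) := fun L =>
    ⟨hΦ.measurable_proportionalHamiltonian _, hΦ.exists_abs_proportionalHamiltonian_le _⟩
  have hlim : ∀ h, Tendsto (fun L : ℕ => 1 / (L : ℝ) ^ d * Real.log (∫ S, Real.exp
      (-β * proportionalHamiltonian Φ (box d L) S + h * ∑ x ∈ box d L, g (shift (-x) S))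
        ∂(freeMeasure d μ₀))) atTop (𝓝 (p h)) := by
    intro h
    refine tendsto_log_integral_exp_congr (fun _ => freeMeasure d μ₀)
      (V := fun L => fieldExponent Φ β g h (box d L)) (a := fun L : ℕ => (L : ℝ) ^ d) ?_
      (fun L => ((hVm L).const_mul _).add
        ((isBoundedMeasurable_sum_shift hg.isBoundedMeasurable _).const_mul h))
      (fun L => hΦ.isBoundedMeasurable_fieldExponent hg.isBoundedMeasurable h _)
      (fun ε hε => ?_) (hp h)
    · filter_upwards [eventually_gt_atTop 0] with L hL
      positivity
    · filter_upwards [hΦ.eventually_abs_hamiltonian_sub_le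
        (show 0 < ε / (|β| + 1) by positivity)] with L hL S
      rw [fieldExponent, add_sub_add_right_eq_sub, ← mul_sub, abs_mul, abs_neg]
      refine (mul_le_mul_of_nonneg_left (hL S) (abs_nonneg β)).trans ?_
      rw [← mul_assoc]
      refine mul_le_mul_of_nonneg_right ?_ (by positivity)
      rw [mul_div_assoc', div_le_iff₀ (by positivity)]
      nlinarith [abs_nonneg β]
  have h0 := hlim 0
  simp only [zero_mul, add_zero] at h0
  exact tendsto_torusFreeEnergy μ₀ hΦ.isAsymptoticallyLocal_proportionalHamiltonian hVm hg β h
    (hlim h) h0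

variable [TopologicalSpace E] [PolishSpace E] [BorelSpace E]

/-- The limiting Gibbs measure has expectation at least m, and m bounds all such expectations from
above. Thus the set of maximizers is nonempty and contains an ergodic measure. -/
lemma exists_isErgodic_isGibbs_of_slope (hd : 1 ≤ d) (hΦ : IsInteraction Φ)
    (hg : IsBoundedLocal g) {p : ℝ → ℝ} (hp : ∀ h, Tendsto
      (fun L : ℕ => 1 / (L : ℝ) ^ d * logPartition Φ β g μ₀ h (box d L)) atTop (𝓝 (p h)))
    {m : ℝ} (hm : ∀ h > 0, h * m ≤ p h - p 0) (hle : ∀ μ : Measure (Config d E),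
      IsGibbs Φ β μ₀ μ → IsTranslationInvariant μ → ∫ S, g S ∂μ ≤ m) :
    ∃ μ : Measure (Config d E), IsGibbs Φ β μ₀ μ ∧ IsErgodic μ ∧ ∫ S, g S ∂μ = m := by
  obtain ⟨μ, hG, hT, hμ⟩ := exists_isGibbs_le_integral hΦ hg hp hm
  exact exists_isErgodic_isGibbs hd hΦ hg hle ⟨μ, hG, hT, (hle μ hG hT).antisymm hμ⟩

/-- The free energy and its one-sided derivatives, for a normalized a priori law on a Polish
space. -/
theorem exists_freeEnergy (hd : 1 ≤ d) (hΦ : IsInteraction Φ) (hg : IsBoundedLocal g) :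
    ∃ f : ℝ → ℝ,
      (∀ h : ℝ, Tendsto (fun n : ℕ => torusFreeEnergy g
        (torusGibbs (torusHamiltonian Φ (n + 1)) β μ₀) h) atTop (𝓝 (f h))) ∧
      (∀ h : ℝ, Tendsto (fun n : ℕ => torusFreeEnergy g
        (torusGibbs (periodizedHamiltonian Φ (n + 1)) β μ₀) h) atTop (𝓝 (f h))) ∧
      ConvexOn ℝ Set.univ f ∧
      ∃ fm fp : ℝ,
        HasDerivWithinAt f fm (Set.Iio 0) 0 ∧ HasDerivWithinAt f fp (Set.Ioi 0) 0 ∧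
        (∀ μ : Measure (Config d E), IsGibbs Φ β μ₀ μ → IsTranslationInvariant μ →
          fm ≤ ∫ S, g S ∂μ ∧ ∫ S, g S ∂μ ≤ fp) ∧
        (∃ μp : Measure (Config d E), IsGibbs Φ β μ₀ μp ∧ IsErgodic μp ∧ ∫ S, g S ∂μp = fp) ∧
        (∃ μm : Measure (Config d E), IsGibbs Φ β μ₀ μm ∧ IsErgodic μm ∧
          ∫ S, g S ∂μm = fm) := by
  obtain ⟨p, hp⟩ := hΦ.exists_tendsto_logPartition (β := β) (μ₀ := μ₀) hg
  set f : ℝ → ℝ := fun h => p h - p 0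
  have hconv : ConvexOn ℝ Set.univ f := (hΦ.convexOn_pressure hg hp).add_const (-p 0)
  have hf0 : f 0 = 0 := sub_self _
  have hint : (0 : ℝ) ∈ interior (Set.univ : Set ℝ) := by simp
  have hdp := hconv.hasDerivWithinAt_rightDeriv_of_mem_interior hint
  have hdm := hconv.hasDerivWithinAt_leftDeriv_of_mem_interior hint
  set fp := derivWithin f (Set.Ioi 0) 0
  set fm := derivWithin f (Set.Iio 0) 0
  have hslope : ∀ h, slope f 0 h = f h / h := fun h => by
    rw [slope_def_field, hf0, sub_zero, sub_zero]
  have hfp : ∀ h > 0, h * fp ≤ f h := fun h hh => by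
    have := hconv.rightDeriv_le_slope_of_mem_interior hint (Set.mem_univ h) hh
    rw [hslope, le_div_iff₀ hh] at this
    linarith
  have hfm : ∀ h < 0, h * fm ≤ f h := fun h hh => by
    have := hconv.slope_le_leftDeriv_of_mem_interior (Set.mem_univ h) hint hh
    rw [slope_comm, hslope, div_le_iff_of_neg hh] at this
    linarith
  have hbd : ∀ μ : Measure (Config d E), IsGibbs Φ β μ₀ μ → IsTranslationInvariant μ →
      fm ≤ ∫ S, g S ∂μ ∧ ∫ S, g S ∂μ ≤ fp := by
    intro μ hG hT
    have hvar := fun h => hG.mul_integral_le hΦ hg hT h hp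
    constructor
    · have h1 := (hasDerivWithinAt_iff_tendsto_slope' (by simp)).1 hdm
      refine le_of_tendsto h1 (eventually_mem_nhdsWithin.mono fun h (hh : h < 0) => ?_)
      rw [hslope, div_le_iff_of_neg hh]
      linarith [hvar h]
    · have h1 := (hasDerivWithinAt_iff_tendsto_slope' (by simp)).1 hdp
      refine ge_of_tendsto h1 (eventually_mem_nhdsWithin.mono fun h (hh : 0 < h) => ?_)
      rw [hslope, le_div_iff₀ hh]
      linarith [hvar h]
  refine ⟨f, hΦ.tendsto_torusFreeEnergy_hamiltonian hg hp,
    hΦ.tendsto_torusFreeEnergy_periodizedHamiltonian hg hp, hconv, fm, fp, hdm, hdp, hbd,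
    exists_isErgodic_isGibbs_of_slope hd hΦ hg hp hfp fun μ hG hT => (hbd μ hG hT).2, ?_⟩
  -- Replacing g by -g reflects the pressure, so the slope hypothesis at -fm is the tangent bound of
  -- f on the negative axis.
  have hp' : ∀ h, Tendsto (fun L : ℕ => 1 / (L : ℝ) ^ d *
      logPartition Φ β (fun S => -1 * g S) μ₀ h (box d L)) atTop (𝓝 (p (-h))) := by
    intro h
    refine (hp (-h)).congr fun L => ?_
    simp only [logPartition, fieldExponent, ← Finset.mul_sum]
    simp only [neg_mul, one_mul, mul_neg]
  obtain ⟨μ, hG, hE, hμ⟩ := exists_isErgodic_isGibbs_of_slope hd hΦ (hg.const_mul (-1)) hp'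
    (m := -fm) (fun h hh => by
      have := hfm (-h) (neg_lt_zero.2 hh)
      rw [neg_zero]
      simp only [f] at this
      linarith) fun μ hG hT => by
        rw [integral_const_mul]
        linarith [(hbd μ hG hT).1]
  refine ⟨μ, hG, hE, ?_⟩
  rw [integral_const_mul] at hμ
  linarith

end

end LatticeSpin

theorem mainTheorem9 (d ν : ℕ) (hd : 1 ≤ d)
    (Ω : Set (EuclideanSpace ℝ (Fin ν))) (hΩ : IsClosed Ω)
    (μ₀ : Measure Ω) [IsFiniteMeasure μ₀] (hμ₀ : μ₀ ≠ 0)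
    (Φ : Finset (LatticeSpin.Site d) → LatticeSpin.Config d Ω → ℝ)
    (hΦ : LatticeSpin.IsInteraction Φ) (β : ℝ) (hβ : 0 ≤ β)
    (g : LatticeSpin.Config d Ω → ℝ) (hg : LatticeSpin.IsBoundedLocal g) :
    ∃ f : ℝ → ℝ,
      (∀ h : ℝ, Tendsto (fun n : ℕ => LatticeSpin.torusFreeEnergy g
          (LatticeSpin.torusGibbs (LatticeSpin.torusHamiltonian Φ (n + 1)) β μ₀) h)
        atTop (𝓝 (f h))) ∧
      (∀ h : ℝ, Tendsto (fun n : ℕ => LatticeSpin.torusFreeEnergy g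
          (LatticeSpin.torusGibbs (LatticeSpin.periodizedHamiltonian Φ (n + 1)) β μ₀) h)
        atTop (𝓝 (f h))) ∧
      ConvexOn ℝ Set.univ f ∧
      ∃ fm fp : ℝ,
        HasDerivWithinAt f fm (Set.Iio 0) 0 ∧ HasDerivWithinAt f fp (Set.Ioi 0) 0 ∧
        (∀ μ : Measure (LatticeSpin.Config d Ω), LatticeSpin.IsGibbs Φ β μ₀ μ →
          LatticeSpin.IsTranslationInvariant μ → fm ≤ ∫ S, g S ∂μ ∧ ∫ S, g S ∂μ ≤ fp) ∧
        (∃ μp : Measure (LatticeSpin.Config d Ω), LatticeSpin.IsGibbs Φ β μ₀ μp ∧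
          LatticeSpin.IsErgodic μp ∧ ∫ S, g S ∂μp = fp) ∧
        (∃ μm : Measure (LatticeSpin.Config d Ω), LatticeSpin.IsGibbs Φ β μ₀ μm ∧
          LatticeSpin.IsErgodic μm ∧ ∫ S, g S ∂μm = fm) := by
  have hpolish : PolishSpace Ω := hΩ.polishSpace
  have : NeZero μ₀ := ⟨hμ₀⟩
  have hc : μ₀ Set.univ ≠ 0 := by simpa using hμ₀
  have hc' : μ₀ Set.univ ≠ ∞ := measure_ne_top _ _
  -- The Gibbs measures in finite and infinite volume and on the torus do not see the total mass of
  -- the a priori law, so the normalized case suffices.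
  have hρ : IsProbabilityMeasure ((μ₀ Set.univ)⁻¹ • μ₀) := isProbabilityMeasureSMul
  have h := LatticeSpin.exists_freeEnergy (β := β) (μ₀ := (μ₀ Set.univ)⁻¹ • μ₀) hd hΦ hg
  simpa only [LatticeSpin.isGibbs_smul_iff Φ β μ₀ (ENNReal.inv_ne_zero.2 hc')
    (ENNReal.inv_ne_top.2 hc), LatticeSpin.torusGibbs_smul β _ μ₀ (ENNReal.inv_ne_zero.2 hc')
    (ENNReal.inv_ne_top.2 hc)] using h
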